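/- Let $\mathbf k$ be a field of any characteristic. A CDGA $(A,d)$ is a non-negatively graded, graded commutative $\mathbf k$-algebra ($a^2=0$ for $|a|$ odd, also in characteristic $2$) with a differential of degree $+1$. A Poincaré duality algebra in dimension $n$ is a connected graded commutative algebra $H$ with a linear map $H^n\to\mathbf k$ for which all pairings $H^i\otimes H^{n-i}\to H^n\to\mathbf k$ are non-degenerate. An orientation of $(A,d)$ is a linear map $\epsilon\colon A^n\to\mathbf k$ (extended by $0$ to $A$) with $\epsilon(dA^{n-1})=0$ and $\epsilon(\mu)=1$ for some cocycle $\mu\in A^n$. We say that $(A,d,\epsilon)$ satisfies (H) if $A$ is of finite type, $A^0\cong\mathbf k$, $A^1=0$, $A^2\subset\ker d$, $H^*(A,d)$ is a Poincaré duality algebra in dimension $n\ge 7$, and $\epsilon$ is an orientation. The set of orphans is $\mathcal O=\{a\in A\mid \epsilon(ab)=0\ \forall b\in A\}$; it is $k$-half-acyclic if $\mathcal O^i\cap\ker d\subset d(\mathcal O^{i-1})$ for all $i$ with $n/2+1\le i\le k$. Let $(A,d,\epsilon)$ satisfy (H) and let $k\ge n/2+1$ be an integer. Make the following choices: * linearly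 independent $\alpha_1,\dots,\alpha_l$ with $\mathcal O^k\cap\ker d=d(\mathcal O^{k-1})\oplus\langle\alpha_1,\dots,\alpha_l\rangle$, and $\gamma_i'\in A^{k-1}$ with $d\gamma'_i=\alpha_i$; * homogeneous cocycles $h_1,\dots,h_m$ whose classes form a basis of $H^*(A,d)$, and homogeneous cocycles $h_j^*$ of degree $n-|h_j|$ with $\epsilon(h_j^*h_i)=\delta_{ij}$; put $\gamma_i=\gamma_i'-\sum_j\epsilon(\gamma_i'h_j)h_j^*$ and $\Gamma=\langle\gamma_1,\dots,\gamma_l\rangle$; * a graded complement $Z$ of $\mathcal O\cap d(A)$ in $\mathcal O$ and a graded complement $U$ of $Z+\Gamma+d(A)$ in $A$; put $T=Z+\Gamma+U$. Let $\hat A=A\otimes\wedge(c_i,w_i)_{1\le i\le l}$ if $\operatorname{char}\mathbf k=0$ or $k$ is odd, and $\hat A=A\otimes\wedge(c_i,w_i,u_{i,j},v_{i,j})_{1\le i\le l,\,j\ge1}$ if $\operatorname{char}\mathbf k=p$ is a prime and $k$ is even, where $|c_i|=k-1$, $|w_i|=k-2$, $|v_{i,j}|=p^j(k-2)$, $|u_{i,j}|=p^j(k-2)-1$,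 with the differential $\hat d$ that extends $d$ and satisfies $$\hat dc_i=\alpha_i,\quad \hat dw_i=c_i-\gamma_i,\quad \hat du_{i,1}=w_i^p,\quad \hat du_{i,j}=v_{i,j-1}^p\ (j\ge 2),$$ $$\hat dv_{i,1}=(c_i-\gamma_i)w_i^{p-1},\quad \hat dv_{i,j}=v_{i,j-1}^{p-1}\,\hat dv_{i,j-1}\ (j\ge 2).$$ Consider the following conditions on a linear map $\hat\epsilon\colon\hat A\to\mathbf k$, for all $\xi\in A^{+}$ (the span of the elements of positive degree), $t\in T$ and all indices: * (i) $\hat\epsilon(\xi)=\epsilon(\xi)$; * (ii) $\hat\epsilon(w_i\,d\xi)=(-1)^k\epsilon(\gamma_i\xi)$; * (iii) $\hat\epsilon(c_ic_j)=-\epsilon(\gamma_i\gamma_j)$; * (iv) $\hat\epsilon$ vanishes on $w_i$, $w_it$, $c_i$, $c_i\xi$, $c_ic_j\xi$, $c_iw_j$, $c_iw_j\xi$, $w_iw_j$, $w_iw_j\xi$ and, where these generators exist, on $u_{i,1}$, $w_iu_{j,1}$, $v_{i,1}$, $u_{i,1}\xi$, $v_{i,1}\xi$; * (v) $\hat\epsilon(x)=0$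 if $x$ is homogeneous of degree $\ne n$. Proposition. Such choices exist, and for all such choices there is exactly one linear map $\hat\epsilon$ satisfying (i)–(v). The triple $(\hat A,\hat d,\hat\epsilon)$ again satisfies (H), with the same $n$. Moreover, if the set of orphans of $(A,d,\epsilon)$ is $(k-1)$-half-acyclic, then the set of orphans of $(\hat A,\hat d,\hat\epsilon)$ is $k$-half-acyclic. -/

import Mathlib

universe u v w

/-- A commutative differential (non-negatively) graded algebra over the field `𝕜`, with differential
of degree `+1`. Graded commutativity is strict: odd elements square to zero in any characteristic. -/
structure CDGA (𝕜 : Type u) [Field 𝕜] where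
  carrier : Type v
  [ring : Ring carrier]
  [algebra : Algebra 𝕜 carrier]
  gr : ℕ → Submodule 𝕜 carrier
  [graded : GradedAlgebra gr]
  mul_comm_of_mem : ∀ {i j : ℕ} {a b : carrier}, a ∈ gr i → b ∈ gr j →
    a * b = (-1 : 𝕜) ^ (i * j) • (b * a)
  mul_self_of_odd : ∀ {i : ℕ} {a : carrier}, Odd i → a ∈ gr i → a * a = 0
  d : carrier →ₗ[𝕜] carrier
  d_mem : ∀ {i : ℕ} {a : carrier}, a ∈ gr i → d a ∈ gr (i + 1)
  d_d : ∀ a : carrier, d (d a) = 0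
  leibniz : ∀ {i : ℕ} {a : carrier} (b : carrier), a ∈ gr i →
    d (a * b) = d a * b + (-1 : 𝕜) ^ i • (a * d b)

namespace CDGA

attribute [instance] CDGA.ring CDGA.algebra CDGA.graded

section Basic

variable {𝕜 : Type u} [Field 𝕜] (A : CDGA.{u, v} 𝕜)

theorem mem_induction {P : A.carrier → Prop} (a : A.carrier) (h0 : P 0)
    (hom : ∀ (i : ℕ) (x : A.carrier), x ∈ A.gr i → P x)
    (add : ∀ x y, P x → P y → P (x + y)) : P a :=
  DirectSum.Decomposition.inductionOn A.gr h0 (fun {i} m => hom i m m.2) add a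

theorem d_one : A.d 1 = 0 := by
  have h := A.leibniz (1 : A.carrier) (SetLike.GradedOne.one_mem (A := A.gr))
  simpa using h

/-! ### Cohomology -/

theorem d_mul_cocycle (x : A.carrier) {b : A.carrier} (hb : A.d b = 0) :
    A.d (x * b) = A.d x * b := by
  refine A.mem_induction (P := fun x => A.d (x * b) = A.d x * b) x ?_ ?_ ?_
  · rw [zero_mul, map_zero, zero_mul]
  · intro i x hx
    rw [A.leibniz b hx, hb, mul_zero, smul_zero, add_zero]
  · intro x y hx hy
    rw [add_mul, map_add, hx, hy, map_add, add_mul]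

/-- The subalgebra `ker d`. -/
def cocycles : Subalgebra 𝕜 A.carrier where
  carrier := {a | A.d a = 0}
  mul_mem' := by
    intro a b ha hb
    have ha' : A.d a = 0 := ha
    change A.d (a * b) = 0
    rw [A.d_mul_cocycle a hb, ha', zero_mul]
  add_mem' := by
    intro a b ha hb
    have ha' : A.d a = 0 := ha
    have hb' : A.d b = 0 := hb
    change A.d (a + b) = 0
    rw [map_add, ha', hb', add_zero]
  algebraMap_mem' := by
    intro r
    change A.d (algebraMap 𝕜 A.carrier r) = 0
    rw [Algebra.algebraMap_eq_smul_one, map_smul, A.d_one, smul_zero]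

/-- A cocycle times a coboundary is a coboundary. -/
theorem exists_d_eq_cocycle_mul (a x : A.carrier) (ha : A.d a = 0) :
    ∃ y, A.d y = a * A.d x := by
  classical
  have hcomp : ∀ i, A.d (GradedRing.proj A.gr i a) = 0 := by
    intro i
    have hsum := DirectSum.sum_support_decompose A.gr a
    have h1 : A.d a = ∑ j ∈ (DirectSum.decompose A.gr a).support,
        A.d ((DirectSum.decompose A.gr a j : A.gr j) : A.carrier) := by
      conv_lhs => rw [← hsum]
      rw [map_sum]
    have h2 := congrArg (GradedRing.proj A.gr (i + 1)) h1
    rw [ha, map_zero, map_sum, Finset.sum_eq_single i] at h2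
    · rw [GradedRing.proj_apply,
        DirectSum.decompose_of_mem_same _ (A.d_mem (SetLike.coe_mem _))] at h2
      rw [GradedRing.proj_apply]
      exact h2.symm
    · intro j _ hj
      have hne : j + 1 ≠ i + 1 := by omega
      rw [GradedRing.proj_apply]
      exact DirectSum.decompose_of_mem_ne _
        (A.d_mem (SetLike.coe_mem (DirectSum.decompose A.gr a j))) hne
    · intro hi
      rw [DFinsupp.notMem_support_iff] at hi
      rw [hi]
      simp
  refine ⟨∑ i ∈ (DirectSum.decompose A.gr a).support,
    (-1 : 𝕜) ^ i • (GradedRing.proj A.gr i a * x), ?_⟩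
  rw [map_sum]
  conv_rhs => rw [← DirectSum.sum_support_decompose A.gr a]
  rw [Finset.sum_mul]
  refine Finset.sum_congr rfl fun i _ => ?_
  have hm : GradedRing.proj A.gr i a ∈ A.gr i := by
    rw [GradedRing.proj_apply]
    exact SetLike.coe_mem _
  rw [map_smul, A.leibniz x hm, hcomp i, zero_mul, zero_add, smul_smul, ← mul_pow]
  simp

/-- The ideal `im d` of `ker d`. -/
def coboundaries : Ideal A.cocycles where
  carrier := {a | ∃ x : A.carrier, A.d x = a}
  add_mem' := by
    rintro a b ⟨x, hx⟩ ⟨y, hy⟩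
    exact ⟨x + y, by rw [map_add, hx, hy]; rfl⟩
  zero_mem' := ⟨0, by simp⟩
  smul_mem' := by
    rintro c a ⟨x, hx⟩
    obtain ⟨y, hy⟩ := A.exists_d_eq_cocycle_mul c x c.2
    exact ⟨y, by rw [hy, hx]; rfl⟩

instance : A.coboundaries.IsTwoSided where
  mul_mem_of_left := by
    rintro a b ⟨x, hx⟩
    exact ⟨x * b, by rw [A.d_mul_cocycle x b.2, hx]; rfl⟩

/-- The cohomology algebra `H(A, d) = ker d / im d`. -/
abbrev Cohomology : Type v := A.cocycles ⧸ A.coboundaries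

/-- The cohomology class of a cocycle. -/
def cls : A.cocycles →ₐ[𝕜] A.Cohomology := Ideal.Quotient.mkₐ 𝕜 A.coboundaries

/-- The classes of degree `i` in cohomology. -/
def cohomologyGr (i : ℕ) : Submodule 𝕜 A.Cohomology :=
  ((A.gr i).comap A.cocycles.val.toLinearMap).map A.cls.toLinearMap

end Basic

/-- `(H, ε)` is an oriented Poincaré duality algebra of dimension `n` for some `ε : Hⁿ → 𝕜`
(extended by zero to `H`), where `H` is a graded commutative algebra with components `gr`:
`H` is connected and all the pairings `Hⁱ ⊗ Hⁿ⁻ⁱ → 𝕜` are non-degenerate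
(in particular `Hⁱ = 0` for `i > n`). -/
def IsPoincareDuality {𝕜 : Type u} [Field 𝕜] {H : Type v} [Ring H] [Algebra 𝕜 H]
    (gr : ℕ → Submodule 𝕜 H) (n : ℕ) : Prop :=
  (1 : H) ≠ 0 ∧ gr 0 = Submodule.span 𝕜 {1} ∧
  ∃ ε : H →ₗ[𝕜] 𝕜, (∀ i, i ≠ n → ∀ x ∈ gr i, ε x = 0) ∧
    (∀ i, ∀ x ∈ gr i, (∀ j, i + j = n → ∀ y ∈ gr j, ε (x * y) = 0) → x = 0) ∧
    (∀ j, ∀ y ∈ gr j, (∀ i, i + j = n → ∀ x ∈ gr i, ε (x * y) = 0) → y = 0)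

section Orientation

variable {𝕜 : Type u} [Field 𝕜] (A : CDGA.{u, v} 𝕜)

/-- An orientation of `(A, d)` in dimension `n`: a linear map `Aⁿ → 𝕜`, extended by zero to `A`
(that is, a map of graded vector spaces `A → s⁻ⁿ𝕜`), which vanishes on `d A` and takes the
value `1` on some cocycle of degree `n`. -/
structure IsOrientation (n : ℕ) (ε : A.carrier →ₗ[𝕜] 𝕜) : Prop where
  eq_zero_of_ne : ∀ i, i ≠ n → ∀ a ∈ A.gr i, ε a = 0
  map_d : ∀ a, ε (A.d a) = 0
  exists_cocycle : ∃ μ ∈ A.gr n, A.d μ = 0 ∧ ε μ = 1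

/-- The standing hypotheses on an oriented CDGA `(A, d, ε)`: `A` is of finite type, `A⁰ ≅ 𝕜`,
`A¹ = 0`, `A² ⊆ ker d`, the cohomology is a Poincaré duality algebra in dimension `n ≥ 7`,
and `ε` is an orientation. -/
structure IsReduced (n : ℕ) (ε : A.carrier →ₗ[𝕜] 𝕜) : Prop where
  finite_type : ∀ i, Module.Finite 𝕜 (A.gr i)
  one_ne_zero : (1 : A.carrier) ≠ 0
  gr_zero : A.gr 0 = Submodule.span 𝕜 {1}
  gr_one : A.gr 1 = ⊥
  gr_two : ∀ a ∈ A.gr 2, A.d a = 0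
  poincare : IsPoincareDuality A.cohomologyGr n
  seven_le : 7 ≤ n
  orientation : A.IsOrientation n ε

/-- The set of orphans `𝒪 = {a | ∀ b, ε (a * b) = 0}`. -/
def orphans (ε : A.carrier →ₗ[𝕜] 𝕜) : Submodule 𝕜 A.carrier where
  carrier := {a | ∀ b, ε (a * b) = 0}
  add_mem' := by
    intro a b ha hb c
    rw [add_mul, map_add, ha c, hb c, add_zero]
  zero_mem' := by
    intro b
    simp
  smul_mem' := by
    intro r a ha b
    rw [smul_mul_assoc, map_smul, ha b, smul_zero]

/-- The orphans are `k`-half-acyclic: `𝒪ⁱ ∩ ker d ⊆ d (𝒪ⁱ⁻¹)` for `n / 2 + 1 ≤ i ≤ k`. -/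
def IsHalfAcyclic (n : ℕ) (ε : A.carrier →ₗ[𝕜] 𝕜) (k : ℕ) : Prop :=
  ∀ i, n + 2 ≤ 2 * i → i ≤ k → ∀ a ∈ A.gr i, a ∈ A.orphans ε → A.d a = 0 →
    ∃ b ∈ A.gr (i - 1), b ∈ A.orphans ε ∧ A.d b = a

/-- A linear subspace spanned by homogeneous elements. -/
def IsGradedSubspace (W : Submodule 𝕜 A.carrier) : Prop :=
  ∀ a ∈ W, ∀ i, GradedRing.proj A.gr i a ∈ W

end Orientation

/-! ### Free extensions -/

section FreeExtension

variable {𝕜 : Type u} [Field 𝕜] (A : CDGA.{u, v} 𝕜) {X : Type w} (deg : X → ℕ)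

/-- Homogeneous elements of `A` (with their degree), together with the new generators `X`. -/
abbrev Letter (X : Type w) : Type (max v w) := (Σ i, A.gr i) ⊕ X

/-- The degree of a letter. -/
def wt : A.Letter X → ℕ
  | Sum.inl a => a.1
  | Sum.inr x => deg x

/-- The relations that hold in `A` between homogeneous elements of `A`, the sign rule for any two
letters, and the vanishing of the squares of letters of odd degree. -/
inductive FreeExtRel : FreeAlgebra 𝕜 (A.Letter X) → FreeAlgebra 𝕜 (A.Letter X) → Prop
  | add (i : ℕ) (a b : A.gr i) :
      FreeExtRel (FreeAlgebra.ι 𝕜 (Sum.inl ⟨i, a + b⟩))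
        (FreeAlgebra.ι 𝕜 (Sum.inl ⟨i, a⟩) + FreeAlgebra.ι 𝕜 (Sum.inl ⟨i, b⟩))
  | smul (i : ℕ) (r : 𝕜) (a : A.gr i) :
      FreeExtRel (FreeAlgebra.ι 𝕜 (Sum.inl ⟨i, r • a⟩)) (r • FreeAlgebra.ι 𝕜 (Sum.inl ⟨i, a⟩))
  | one : FreeExtRel
      (FreeAlgebra.ι 𝕜 (Sum.inl ⟨0, ⟨1, SetLike.GradedOne.one_mem (A := A.gr)⟩⟩)) 1
  | mul (i j : ℕ) (a : A.gr i) (b : A.gr j) :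
      FreeExtRel
        (FreeAlgebra.ι 𝕜 (Sum.inl ⟨i + j, ⟨(a : A.carrier) * b, SetLike.mul_mem_graded a.2 b.2⟩⟩))
        (FreeAlgebra.ι 𝕜 (Sum.inl ⟨i, a⟩) * FreeAlgebra.ι 𝕜 (Sum.inl ⟨j, b⟩))
  | comm (y z : A.Letter X) :
      FreeExtRel (FreeAlgebra.ι 𝕜 y * FreeAlgebra.ι 𝕜 z)
        ((-1 : 𝕜) ^ (A.wt deg y * A.wt deg z) • (FreeAlgebra.ι 𝕜 z * FreeAlgebra.ι 𝕜 y))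
  | sq (y : A.Letter X) (hy : Odd (A.wt deg y)) :
      FreeExtRel (FreeAlgebra.ι 𝕜 y * FreeAlgebra.ι 𝕜 y) 0

/-- The graded algebra `A ⊗ ⋀X`: the free (strictly) graded commutative algebra over `A` on
generators `x ∈ X` of degree `deg x`, presented by generators and relations. -/
def FreeExt : Type (max u v w) := RingQuot (A.FreeExtRel deg)

noncomputable instance : Ring (A.FreeExt deg) := inferInstanceAs (Ring (RingQuot (A.FreeExtRel deg)))

noncomputable instance : Algebra 𝕜 (A.FreeExt deg) :=
  inferInstanceAs (Algebra 𝕜 (RingQuot (A.FreeExtRel deg)))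

/-- The quotient map of the presentation. -/
noncomputable def freeMk : FreeAlgebra 𝕜 (A.Letter X) →ₐ[𝕜] A.FreeExt deg :=
  RingQuot.mkAlgHom 𝕜 (A.FreeExtRel deg)

/-- The image of a letter in `A ⊗ ⋀X`. -/
noncomputable def letter (y : A.Letter X) : A.FreeExt deg := A.freeMk deg (FreeAlgebra.ι 𝕜 y)

/-- The generator `x` of `A ⊗ ⋀X`. -/
noncomputable def gen (x : X) : A.FreeExt deg := A.letter deg (Sum.inr x)

theorem freeMk_rel {x y : FreeAlgebra 𝕜 (A.Letter X)} (h : A.FreeExtRel deg x y) :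
    A.freeMk deg x = A.freeMk deg y := RingQuot.mkAlgHom_rel 𝕜 h

theorem letter_add (i : ℕ) (a b : A.gr i) : A.letter deg (Sum.inl ⟨i, a + b⟩) =
    A.letter deg (Sum.inl ⟨i, a⟩) + A.letter deg (Sum.inl ⟨i, b⟩) := by
  simpa [letter] using A.freeMk_rel deg (FreeExtRel.add i a b)

theorem letter_smul (i : ℕ) (r : 𝕜) (a : A.gr i) : A.letter deg (Sum.inl ⟨i, r • a⟩) =
    r • A.letter deg (Sum.inl ⟨i, a⟩) := by
  simpa [letter] using A.freeMk_rel deg (FreeExtRel.smul i r a)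

theorem letter_one :
    A.letter deg (Sum.inl ⟨0, ⟨1, SetLike.GradedOne.one_mem (A := A.gr)⟩⟩) = 1 := by
  simpa [letter] using A.freeMk_rel deg FreeExtRel.one

theorem letter_mul (i j : ℕ) (a : A.gr i) (b : A.gr j) :
    A.letter deg (Sum.inl ⟨i + j, ⟨(a : A.carrier) * b, SetLike.mul_mem_graded a.2 b.2⟩⟩) =
      A.letter deg (Sum.inl ⟨i, a⟩) * A.letter deg (Sum.inl ⟨j, b⟩) := by
  simpa [letter] using A.freeMk_rel deg (FreeExtRel.mul i j a b)

theorem letter_comm (y z : A.Letter X) : A.letter deg y * A.letter deg z =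
    (-1 : 𝕜) ^ (A.wt deg y * A.wt deg z) • (A.letter deg z * A.letter deg y) := by
  simpa [letter] using A.freeMk_rel deg (FreeExtRel.comm y z)

theorem letter_sq (y : A.Letter X) (hy : Odd (A.wt deg y)) :
    A.letter deg y * A.letter deg y = 0 := by
  simpa [letter] using A.freeMk_rel deg (FreeExtRel.sq y hy)

/-- The inclusion `A → A ⊗ ⋀X` on the components of `A`. -/
noncomputable def inclGr (i : ℕ) : A.gr i →ₗ[𝕜] A.FreeExt deg where
  toFun a := A.letter deg (Sum.inl ⟨i, a⟩)
  map_add' := A.letter_add deg i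
  map_smul' := A.letter_smul deg i

/-- The inclusion `A → A ⊗ ⋀X`. -/
noncomputable def incl : A.carrier →ₐ[𝕜] A.FreeExt deg :=
  (DirectSum.toAlgebra 𝕜 (fun i => A.gr i) (A.inclGr deg)
    (A.letter_one deg) (fun {i j} a b => A.letter_mul deg i j a b)).comp
  (DirectSum.decomposeAlgEquiv A.gr : A.carrier →ₐ[𝕜] DirectSum ℕ fun i => A.gr i)

theorem incl_of_mem {i : ℕ} {a : A.carrier} (ha : a ∈ A.gr i) :
    A.incl deg a = A.letter deg (Sum.inl ⟨i, ⟨a, ha⟩⟩) := by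
  have h : DirectSum.decompose A.gr a = DirectSum.of (fun i => A.gr i) i ⟨a, ha⟩ :=
    DirectSum.decompose_of_mem A.gr ha
  change DirectSum.toAddMonoid (fun i => (A.inclGr deg i).toAddMonoidHom)
    (DirectSum.decompose A.gr a) = _
  rw [h, DirectSum.toAddMonoid_of]
  rfl

/-- The product of a word in the letters. -/
noncomputable def word (L : List (A.Letter X)) : A.FreeExt deg := (L.map (A.letter deg)).prod

/-- The degree of a word. -/
def wordWt (L : List (A.Letter X)) : ℕ := (L.map (A.wt deg)).sum

/-- The component of degree `i` of `A ⊗ ⋀X`, spanned by the words of degree `i`. -/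
noncomputable def freeGr (i : ℕ) : Submodule 𝕜 (A.FreeExt deg) :=
  Submodule.span 𝕜 {x | ∃ L : List (A.Letter X), A.wordWt deg L = i ∧ A.word deg L = x}

theorem word_mem (L : List (A.Letter X)) : A.word deg L ∈ A.freeGr deg (A.wordWt deg L) :=
  Submodule.subset_span ⟨L, rfl, rfl⟩

@[simp] theorem word_nil : A.word deg ([] : List (A.Letter X)) = 1 := rfl

@[simp] theorem word_cons (y : A.Letter X) (L : List (A.Letter X)) :
    A.word deg (y :: L) = A.letter deg y * A.word deg L := by simp [word]

@[simp] theorem wordWt_nil : A.wordWt deg ([] : List (A.Letter X)) = 0 := rfl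

@[simp] theorem wordWt_cons (y : A.Letter X) (L : List (A.Letter X)) :
    A.wordWt deg (y :: L) = A.wt deg y + A.wordWt deg L := by simp [wordWt]

theorem letter_mem (y : A.Letter X) : A.letter deg y ∈ A.freeGr deg (A.wt deg y) := by
  simpa using A.word_mem deg [y]

theorem gen_mem (x : X) : A.gen deg x ∈ A.freeGr deg (deg x) := A.letter_mem deg (Sum.inr x)

theorem incl_mem {i : ℕ} {a : A.carrier} (ha : a ∈ A.gr i) : A.incl deg a ∈ A.freeGr deg i := by
  rw [A.incl_of_mem deg ha]
  exact A.letter_mem deg (Sum.inl ⟨i, ⟨a, ha⟩⟩)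

instance freeGr_gradedMonoid : SetLike.GradedMonoid (A.freeGr deg) where
  one_mem := A.word_mem deg []
  mul_mem := by
    intro i j a b ha hb
    induction ha using Submodule.span_induction with
    | zero => simp
    | add x y _ _ hx hy => rw [add_mul]; exact add_mem hx hy
    | smul r x _ hx => rw [smul_mul_assoc]; exact Submodule.smul_mem _ _ hx
    | mem x hx =>
      obtain ⟨L, rfl, rfl⟩ := hx
      induction hb using Submodule.span_induction with
      | zero => simp
      | add x y _ _ hx hy => rw [mul_add]; exact add_mem hx hy
      | smul r x _ hx => rw [mul_smul_comm]; exact Submodule.smul_mem _ _ hx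
      | mem x hx =>
        obtain ⟨M, rfl, rfl⟩ := hx
        refine Submodule.subset_span ⟨L ++ M, ?_, ?_⟩
        · rw [wordWt, List.map_append, List.sum_append]
          rfl
        · rw [word, List.map_append, List.prod_append]
          rfl

/-- Two algebra homomorphisms out of `A ⊗ ⋀X` that agree on letters are equal. -/
theorem freeExt_hom_ext {B : Type*} [Semiring B] [Algebra 𝕜 B] {f g : A.FreeExt deg →ₐ[𝕜] B}
    (h : ∀ y, f (A.letter deg y) = g (A.letter deg y)) : f = g := by
  apply RingQuot.ringQuot_ext' (S := 𝕜) (s := A.FreeExtRel deg)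
  apply FreeAlgebra.hom_ext
  funext y
  exact h y

/-- Algebra homomorphisms out of `A ⊗ ⋀X` are given by their values on letters. -/
noncomputable def freeLift {B : Type*} [Ring B] [Algebra 𝕜 B] (f : A.Letter X → B)
    (hf : ∀ ⦃x y⦄, A.FreeExtRel deg x y → FreeAlgebra.lift 𝕜 f x = FreeAlgebra.lift 𝕜 f y) :
    A.FreeExt deg →ₐ[𝕜] B :=
  RingQuot.liftAlgHom 𝕜 ⟨FreeAlgebra.lift 𝕜 f, hf⟩

theorem freeLift_letter {B : Type*} [Ring B] [Algebra 𝕜 B] (f : A.Letter X → B)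
    (hf : ∀ ⦃x y⦄, A.FreeExtRel deg x y → FreeAlgebra.lift 𝕜 f x = FreeAlgebra.lift 𝕜 f y)
    (y : A.Letter X) : A.freeLift deg f hf (A.letter deg y) = f y := by
  have h := RingQuot.liftAlgHom_mkAlgHom_apply 𝕜 (FreeAlgebra.lift 𝕜 f) hf (FreeAlgebra.ι 𝕜 y)
  rw [FreeAlgebra.lift_ι_apply] at h
  exact h

/-- An element of degree `i` viewed in the direct sum of the components. -/
noncomputable def toDS (i : ℕ) (x : A.FreeExt deg) (hx : x ∈ A.freeGr deg i) :
    DirectSum ℕ (fun i => A.freeGr deg i) :=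
  DirectSum.of (fun i => A.freeGr deg i) i ⟨x, hx⟩

theorem toDS_congr {i j : ℕ} {x y : A.FreeExt deg} (hx : x ∈ A.freeGr deg i)
    (hy : y ∈ A.freeGr deg j) (hij : i = j) (hxy : x = y) :
    A.toDS deg i x hx = A.toDS deg j y hy := by
  subst hij hxy
  rfl

theorem toDS_add {i : ℕ} {x y : A.FreeExt deg} (hx : x ∈ A.freeGr deg i)
    (hy : y ∈ A.freeGr deg i) :
    A.toDS deg i x hx + A.toDS deg i y hy = A.toDS deg i (x + y) (add_mem hx hy) :=
  (map_add (DirectSum.of (fun i => A.freeGr deg i) i) ⟨x, hx⟩ ⟨y, hy⟩).symm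

theorem toDS_smul {i : ℕ} (r : 𝕜) {x : A.FreeExt deg} (hx : x ∈ A.freeGr deg i) :
    r • A.toDS deg i x hx = A.toDS deg i (r • x) (Submodule.smul_mem _ r hx) :=
  ((DirectSum.lof 𝕜 ℕ (fun i => A.freeGr deg i) i).map_smul r ⟨x, hx⟩).symm

theorem toDS_mul {i j : ℕ} {x y : A.FreeExt deg} (hx : x ∈ A.freeGr deg i)
    (hy : y ∈ A.freeGr deg j) :
    A.toDS deg i x hx * A.toDS deg j y hy =
      A.toDS deg (i + j) (x * y) (SetLike.mul_mem_graded hx hy) :=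
  DirectSum.of_mul_of _ _

theorem toDS_zero {i : ℕ} : A.toDS deg i 0 (zero_mem _) = 0 :=
  map_zero (DirectSum.of (fun i => A.freeGr deg i) i)

theorem toDS_one : A.toDS deg 0 1 (SetLike.GradedOne.one_mem (A := A.freeGr deg)) = 1 := rfl

/-- The decomposition of `A ⊗ ⋀X` into components. -/
noncomputable def freeDecompose : A.FreeExt deg →ₐ[𝕜] DirectSum ℕ (fun i => A.freeGr deg i) :=
  A.freeLift deg (fun y => A.toDS deg (A.wt deg y) (A.letter deg y) (A.letter_mem deg y)) (by
    intro x y h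
    cases h with
    | add i a b =>
      simp only [FreeAlgebra.lift_ι_apply, map_add]
      exact (A.toDS_congr deg _ _ rfl (A.letter_add deg i a b)).trans (A.toDS_add deg _ _).symm
    | smul i r a =>
      simp only [FreeAlgebra.lift_ι_apply, map_smul]
      exact (A.toDS_congr deg _ _ rfl (A.letter_smul deg i r a)).trans (A.toDS_smul deg r _).symm
    | one =>
      simp only [FreeAlgebra.lift_ι_apply, map_one]
      exact (A.toDS_congr deg _ _ rfl (A.letter_one deg)).trans (A.toDS_one deg)
    | mul i j a b =>
      simp only [FreeAlgebra.lift_ι_apply, map_mul]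
      exact (A.toDS_congr deg _ _ rfl (A.letter_mul deg i j a b)).trans (A.toDS_mul deg _ _).symm
    | comm y z =>
      simp only [FreeAlgebra.lift_ι_apply, map_mul, map_smul]
      rw [A.toDS_mul, A.toDS_mul, A.toDS_smul]
      exact A.toDS_congr deg _ _ (add_comm _ _) (A.letter_comm deg y z)
    | sq y hy =>
      simp only [FreeAlgebra.lift_ι_apply, map_mul, map_zero]
      rw [A.toDS_mul, ← A.toDS_zero deg]
      exact A.toDS_congr deg _ _ rfl (A.letter_sq deg y hy))

theorem freeDecompose_letter (y : A.Letter X) : A.freeDecompose deg (A.letter deg y) =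
    A.toDS deg (A.wt deg y) (A.letter deg y) (A.letter_mem deg y) :=
  A.freeLift_letter deg _ _ y

theorem freeDecompose_word (L : List (A.Letter X)) : A.freeDecompose deg (A.word deg L) =
    A.toDS deg (A.wordWt deg L) (A.word deg L) (A.word_mem deg L) := by
  induction L with
  | nil => exact (map_one (A.freeDecompose deg)).trans (A.toDS_one deg).symm
  | cons y L ih =>
    have h : A.freeDecompose deg (A.word deg (y :: L)) =
        A.freeDecompose deg (A.letter deg y) * A.freeDecompose deg (A.word deg L) := by
      rw [word_cons, map_mul]
    rw [h, ih, freeDecompose_letter, A.toDS_mul]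
    exact A.toDS_congr deg _ _ (A.wordWt_cons deg y L).symm (A.word_cons deg y L).symm

theorem freeDecompose_of_mem {i : ℕ} {x : A.FreeExt deg} (hx : x ∈ A.freeGr deg i) :
    A.freeDecompose deg x = A.toDS deg i x hx := by
  induction hx using Submodule.span_induction with
  | mem x h =>
    obtain ⟨L, rfl, rfl⟩ := h
    exact A.freeDecompose_word deg L
  | zero => rw [map_zero]; exact (A.toDS_zero deg).symm
  | add x y _ _ hx hy => rw [map_add, hx, hy]; exact A.toDS_add deg _ _
  | smul r x _ hx => rw [map_smul, hx]; exact A.toDS_smul deg r _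

noncomputable instance freeGr_graded : GradedAlgebra (A.freeGr deg) :=
  GradedAlgebra.ofAlgHom (A.freeGr deg) (A.freeDecompose deg)
    (A.freeExt_hom_ext deg fun y => by
      rw [AlgHom.comp_apply, freeDecompose_letter]
      exact DirectSum.coeAlgHom_of _ _ _)
    (fun _ x => A.freeDecompose_of_mem deg x.2)

theorem word_letter_comm (y : A.Letter X) (L : List (A.Letter X)) :
    A.letter deg y * A.word deg L =
      (-1 : 𝕜) ^ (A.wt deg y * A.wordWt deg L) • (A.word deg L * A.letter deg y) := by
  induction L with
  | nil => simp
  | cons z L ih =>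
    rw [word_cons, ← mul_assoc, A.letter_comm deg y z, smul_mul_assoc, mul_assoc, ih,
      mul_smul_comm, smul_smul, ← pow_add, ← mul_add, wordWt_cons, mul_assoc]

theorem word_comm (L M : List (A.Letter X)) :
    A.word deg L * A.word deg M =
      (-1 : 𝕜) ^ (A.wordWt deg L * A.wordWt deg M) • (A.word deg M * A.word deg L) := by
  induction L with
  | nil => simp
  | cons y L ih =>
    rw [word_cons, mul_assoc, ih, mul_smul_comm, ← mul_assoc, A.word_letter_comm deg y M,
      smul_mul_assoc, smul_smul, ← pow_add, wordWt_cons, mul_assoc, add_mul, add_comm]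

theorem free_mul_comm {i j : ℕ} {a b : A.FreeExt deg} (ha : a ∈ A.freeGr deg i)
    (hb : b ∈ A.freeGr deg j) : a * b = (-1 : 𝕜) ^ (i * j) • (b * a) := by
  induction ha using Submodule.span_induction with
  | zero => simp
  | add x y _ _ hx hy => rw [add_mul, mul_add, smul_add, hx, hy]
  | smul r x _ hx => rw [smul_mul_assoc, mul_smul_comm, hx, smul_comm]
  | mem x hx =>
    obtain ⟨L, rfl, rfl⟩ := hx
    induction hb using Submodule.span_induction with
    | zero => simp
    | add x y _ _ hx hy => rw [add_mul, mul_add, smul_add, hx, hy]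
    | smul r x _ hx => rw [smul_mul_assoc, mul_smul_comm, hx, smul_comm]
    | mem x hx =>
      obtain ⟨M, rfl, rfl⟩ := hx
      exact A.word_comm deg L M

theorem word_sq (L : List (A.Letter X)) (hL : Odd (A.wordWt deg L)) :
    A.word deg L * A.word deg L = 0 := by
  induction L with
  | nil => simp at hL
  | cons y L ih =>
    have h1 : A.word deg (y :: L) * A.word deg (y :: L) =
        (-1 : 𝕜) ^ (A.wordWt deg L * A.wt deg y) •
          ((A.letter deg y * A.letter deg y) * (A.word deg L * A.word deg L)) := by
      have h2 := A.free_mul_comm deg (A.word_mem deg L) (A.letter_mem deg y)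
      rw [word_cons]
      calc A.letter deg y * A.word deg L * (A.letter deg y * A.word deg L)
          = A.letter deg y * (A.word deg L * A.letter deg y) * A.word deg L := by
            simp only [mul_assoc]
        _ = _ := by
            rw [h2]
            simp only [mul_assoc, smul_mul_assoc, mul_smul_comm]
    rw [h1]
    rw [wordWt_cons, Nat.odd_add] at hL
    by_cases hy : Odd (A.wt deg y)
    · rw [A.letter_sq deg y hy, zero_mul, smul_zero]
    · have : Odd (A.wordWt deg L) := by
        rw [← Nat.not_even_iff_odd]
        exact fun h => hy (hL.2 h)
      rw [ih this, mul_zero, smul_zero]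

theorem free_mul_self {i : ℕ} {a : A.FreeExt deg} (hi : Odd i) (ha : a ∈ A.freeGr deg i) :
    a * a = 0 := by
  induction ha using Submodule.span_induction with
  | mem x h =>
    obtain ⟨L, rfl, rfl⟩ := h
    exact A.word_sq deg L hi
  | zero => simp
  | add x y hx hy hxx hyy =>
    have h := A.free_mul_comm deg hx hy
    rw [Odd.neg_one_pow (hi.mul hi)] at h
    rw [add_mul, mul_add, mul_add, hxx, hyy, h]
    simp
  | smul r x _ hx => rw [smul_mul_assoc, mul_smul_comm, hx, smul_zero, smul_zero]

/-! #### The differential with prescribed values on the generators -/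

/-- The prescribed values of the differential on letters. -/
noncomputable def dLetter (δ : X → A.FreeExt deg) : A.Letter X → A.FreeExt deg
  | Sum.inl a => A.incl deg (A.d a.2)
  | Sum.inr x => δ x

theorem dLetter_mem (δ : X → A.FreeExt deg) (hδ : ∀ x, δ x ∈ A.freeGr deg (deg x + 1))
    (y : A.Letter X) : A.dLetter deg δ y ∈ A.freeGr deg (A.wt deg y + 1) := by
  cases y with
  | inl a => exact A.incl_mem deg (A.d_mem a.2.2)
  | inr x => exact hδ x

/-- A graded derivation `D` is encoded as the algebra homomorphism
`a ↦ !![(-1)^|a| a, D a; 0, a]`. -/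
noncomputable def dMatrix (δ : X → A.FreeExt deg) (hδ : ∀ x, δ x ∈ A.freeGr deg (deg x + 1)) :
    A.FreeExt deg →ₐ[𝕜] Matrix (Fin 2) (Fin 2) (A.FreeExt deg) :=
  A.freeLift deg
    (fun y => !![(-1 : 𝕜) ^ A.wt deg y • A.letter deg y, A.dLetter deg δ y; 0, A.letter deg y]) (by
    intro x y h
    cases h with
    | add i a b =>
      simp only [FreeAlgebra.lift_ι_apply, map_add]
      ext r s
      fin_cases r <;> fin_cases s <;> simp [wt, dLetter, letter_add, smul_add]
    | smul i r a =>
      simp only [FreeAlgebra.lift_ι_apply, map_smul]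
      ext r s
      fin_cases r <;> fin_cases s <;> simp [wt, dLetter, letter_smul]
      rw [smul_comm]
    | one =>
      simp only [FreeAlgebra.lift_ι_apply, map_one]
      ext r s
      fin_cases r <;> fin_cases s <;> simp [wt, dLetter, letter_one, d_one]
    | mul i j a b =>
      simp only [FreeAlgebra.lift_ι_apply, map_mul]
      ext r s
      have h1 := A.incl_of_mem deg a.2
      have h2 := A.incl_of_mem deg b.2
      have h3 := A.leibniz (b : A.carrier) a.2
      fin_cases r <;> fin_cases s
      · simp [Matrix.mul_apply, Fin.sum_univ_two, wt, letter_mul, smul_smul, pow_add]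
        rw [mul_comm]
      · simp [Matrix.mul_apply, Fin.sum_univ_two, wt, dLetter, h3, ← h1, ← h2]
        rw [add_comm]
      · simp [Matrix.mul_apply, Fin.sum_univ_two]
      · simp [Matrix.mul_apply, Fin.sum_univ_two, letter_mul]
    | comm y z =>
      simp only [FreeAlgebra.lift_ι_apply, map_mul, map_smul]
      have h0 := A.letter_comm deg y z
      have h1 := A.free_mul_comm deg (A.dLetter_mem deg δ hδ y) (A.letter_mem deg z)
      have h2 := A.free_mul_comm deg (A.letter_mem deg y) (A.dLetter_mem deg δ hδ z)
      ext r s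
      fin_cases r <;> fin_cases s
      · simp only [Matrix.mul_apply, Fin.sum_univ_two]
        simp [h0, smul_smul]
        congr 1
        ring
      · simp only [Matrix.mul_apply, Fin.sum_univ_two]
        simp [h1, h2, smul_smul]
        rw [add_comm]
        congr 2
        · rw [add_mul, pow_add, one_mul]
        · rw [mul_add, pow_add, mul_one, mul_comm, mul_assoc, ← mul_pow]
          simp
      · simp [Matrix.mul_apply, Fin.sum_univ_two]
      · simp only [Matrix.mul_apply, Fin.sum_univ_two]
        simp [h0]
    | sq y hy =>
      simp only [FreeAlgebra.lift_ι_apply, map_mul, map_zero]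
      have h0 := A.letter_sq deg y hy
      have h1 := A.free_mul_comm deg (A.dLetter_mem deg δ hδ y) (A.letter_mem deg y)
      rw [Even.neg_one_pow (hy.add_one.mul_right _), one_smul] at h1
      ext r s
      fin_cases r <;> fin_cases s <;>
        simp [Matrix.mul_apply, Fin.sum_univ_two, h0, h1, hy.neg_one_pow])

/-- The derivation of `A ⊗ ⋀X` that extends `d` and takes the values `δ` on the generators. -/
noncomputable def freeD (δ : X → A.FreeExt deg) (hδ : ∀ x, δ x ∈ A.freeGr deg (deg x + 1)) :
    A.FreeExt deg →ₗ[𝕜] A.FreeExt deg where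
  toFun a := A.dMatrix deg δ hδ a 0 1
  map_add' := by intro a b; simp
  map_smul' := by intro r a; simp

section

variable (δ : X → A.FreeExt deg) (hδ : ∀ x, δ x ∈ A.freeGr deg (deg x + 1))

theorem freeD_letter (y : A.Letter X) : A.freeD deg δ hδ (A.letter deg y) = A.dLetter deg δ y := by
  have h := A.freeLift_letter deg (fun y => !![(-1 : 𝕜) ^ A.wt deg y • A.letter deg y,
    A.dLetter deg δ y; 0, A.letter deg y])
  change A.dMatrix deg δ hδ (A.letter deg y) 0 1 = _
  rw [dMatrix, h]
  simp

theorem freeD_gen (x : X) : A.freeD deg δ hδ (A.gen deg x) = δ x :=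
  A.freeD_letter deg δ hδ (Sum.inr x)

theorem dMatrix_word (L : List (A.Letter X)) :
    A.dMatrix deg δ hδ (A.word deg L) 0 0 = (-1 : 𝕜) ^ A.wordWt deg L • A.word deg L ∧
    A.dMatrix deg δ hδ (A.word deg L) 1 1 = A.word deg L ∧
    A.dMatrix deg δ hδ (A.word deg L) 1 0 = 0 := by
  induction L with
  | nil => simp
  | cons y L ih =>
    obtain ⟨h1, h2, h3⟩ := ih
    have hy := A.freeLift_letter deg (fun y => !![(-1 : 𝕜) ^ A.wt deg y • A.letter deg y,
      A.dLetter deg δ y; 0, A.letter deg y])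
    rw [word_cons, map_mul]
    refine ⟨?_, ?_, ?_⟩ <;> rw [Matrix.mul_apply, Fin.sum_univ_two]
    · rw [h1, h3, dMatrix, hy]
      simp [smul_smul, pow_add]
      rw [mul_comm]
    · rw [h2, dMatrix, hy]
      simp
    · rw [h3, dMatrix, hy]
      simp

theorem dMatrix_of_mem {i : ℕ} {a : A.FreeExt deg} (ha : a ∈ A.freeGr deg i) :
    A.dMatrix deg δ hδ a 0 0 = (-1 : 𝕜) ^ i • a ∧ A.dMatrix deg δ hδ a 1 1 = a := by
  induction ha using Submodule.span_induction with
  | mem x h =>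
    obtain ⟨L, rfl, rfl⟩ := h
    exact ⟨(A.dMatrix_word deg δ hδ L).1, (A.dMatrix_word deg δ hδ L).2.1⟩
  | zero => simp
  | add x y _ _ hx hy => simp [hx.1, hx.2, hy.1, hy.2]
  | smul r x _ hx =>
    rw [map_smul, Matrix.smul_apply, Matrix.smul_apply, hx.1, hx.2, smul_comm]
    exact ⟨rfl, rfl⟩

theorem dMatrix_one_one (a : A.FreeExt deg) : A.dMatrix deg δ hδ a 1 1 = a := by
  refine DirectSum.Decomposition.inductionOn (A.freeGr deg) (by simp) ?_ ?_ a
  · intro i m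
    exact (A.dMatrix_of_mem deg δ hδ m.2).2
  · intro x y hx hy
    rw [map_add, Matrix.add_apply, hx, hy]

theorem freeD_leibniz {i : ℕ} {a : A.FreeExt deg} (b : A.FreeExt deg) (ha : a ∈ A.freeGr deg i) :
    A.freeD deg δ hδ (a * b) =
      A.freeD deg δ hδ a * b + (-1 : 𝕜) ^ i • (a * A.freeD deg δ hδ b) := by
  change A.dMatrix deg δ hδ (a * b) 0 1 = A.dMatrix deg δ hδ a 0 1 * b +
    (-1 : 𝕜) ^ i • (a * A.dMatrix deg δ hδ b 0 1)
  rw [map_mul, Matrix.mul_apply, Fin.sum_univ_two, (A.dMatrix_of_mem deg δ hδ ha).1,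
    A.dMatrix_one_one, smul_mul_assoc, add_comm]

theorem freeD_one : A.freeD deg δ hδ 1 = 0 := by
  change A.dMatrix deg δ hδ 1 0 1 = 0
  simp

theorem freeD_mem {i : ℕ} {a : A.FreeExt deg} (ha : a ∈ A.freeGr deg i) :
    A.freeD deg δ hδ a ∈ A.freeGr deg (i + 1) := by
  induction ha using Submodule.span_induction with
  | mem x h =>
    obtain ⟨L, rfl, rfl⟩ := h
    induction L with
    | nil => rw [word_nil, freeD_one]; exact zero_mem _
    | cons y L ih =>
      rw [word_cons, A.freeD_leibniz deg δ hδ _ (A.letter_mem deg y), freeD_letter, wordWt_cons]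
      refine add_mem ?_ (Submodule.smul_mem _ _ ?_)
      · have h := SetLike.mul_mem_graded (A.dLetter_mem deg δ hδ y) (A.word_mem deg L)
        rwa [add_right_comm] at h
      · have h := SetLike.mul_mem_graded (A.letter_mem deg y) ih
        rwa [← add_assoc] at h
  | zero => rw [map_zero]; exact zero_mem _
  | add x y _ _ hx hy => rw [map_add]; exact add_mem hx hy
  | smul r x _ hx => rw [map_smul]; exact Submodule.smul_mem _ _ hx

theorem freeD_incl (a : A.carrier) : A.freeD deg δ hδ (A.incl deg a) = A.incl deg (A.d a) := by
  refine A.mem_induction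
    (P := fun a => A.freeD deg δ hδ (A.incl deg a) = A.incl deg (A.d a)) a ?_ ?_ ?_
  · rw [map_zero, map_zero, map_zero, map_zero]
  · intro i x hx
    rw [A.incl_of_mem deg hx, freeD_letter]
    rfl
  · intro x y hx hy
    simp only [map_add, hx, hy]

theorem freeD_freeD (hdd : ∀ x, A.freeD deg δ hδ (δ x) = 0) (a : A.FreeExt deg) :
    A.freeD deg δ hδ (A.freeD deg δ hδ a) = 0 := by
  have hl : ∀ y, A.freeD deg δ hδ (A.freeD deg δ hδ (A.letter deg y)) = 0 := by
    intro y
    rw [freeD_letter]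
    cases y with
    | inl a =>
      change A.freeD deg δ hδ (A.incl deg (A.d a.2)) = 0
      rw [freeD_incl, A.d_d, map_zero]
    | inr x => exact hdd x
  have hw : ∀ L, A.freeD deg δ hδ (A.freeD deg δ hδ (A.word deg L)) = 0 := by
    intro L
    induction L with
    | nil => rw [word_nil, freeD_one, map_zero]
    | cons y L ih =>
      have h1 := A.letter_mem deg y
      rw [word_cons, A.freeD_leibniz deg δ hδ _ h1, map_add, map_smul,
        A.freeD_leibniz deg δ hδ _ (A.freeD_mem deg δ hδ h1), A.freeD_leibniz deg δ hδ _ h1,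
        hl y, ih, pow_succ]
      simp
  refine DirectSum.Decomposition.inductionOn (A.freeGr deg) (by simp) ?_ ?_ a
  · rintro i ⟨x, hx⟩
    change A.freeD deg δ hδ (A.freeD deg δ hδ x) = 0
    induction hx using Submodule.span_induction with
    | mem x h =>
      obtain ⟨L, rfl, rfl⟩ := h
      exact hw L
    | zero => simp
    | add x y _ _ hx hy => rw [map_add, map_add, hx, hy, add_zero]
    | smul r x _ hx => rw [map_smul, map_smul, hx, smul_zero]
  · intro x y hx hy
    rw [map_add, map_add, hx, hy, add_zero]

theorem freeD_pow_even {i : ℕ} (hi : Even i) {a : A.FreeExt deg} (ha : a ∈ A.freeGr deg i)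
    (m : ℕ) : A.freeD deg δ hδ (a ^ m) = m • (a ^ (m - 1) * A.freeD deg δ hδ a) := by
  induction m with
  | zero => simp [freeD_one]
  | succ m ih =>
    have hc : A.freeD deg δ hδ a * a ^ m = a ^ m * A.freeD deg δ hδ a := by
      have h1 : Commute (A.freeD deg δ hδ a) a := by
        have h := A.free_mul_comm deg (A.freeD_mem deg δ hδ ha) ha
        rwa [Even.neg_one_pow (hi.mul_left _), one_smul] at h
      exact (h1.pow_right m)
    rw [pow_succ', A.freeD_leibniz deg δ hδ _ ha, hi.neg_one_pow, one_smul, ih, hc]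
    cases m with
    | zero => simp
    | succ m =>
      simp only [Nat.add_sub_cancel, mul_smul_comm, ← mul_assoc, ← pow_succ']
      rw [succ_nsmul (n := m + 1), add_comm]

/-- The CDGA `(A ⊗ ⋀X, d)` with `d x = δ x` for the generators `x ∈ X`. -/
noncomputable def adjoin (hdd : ∀ x, A.freeD deg δ hδ (δ x) = 0) : CDGA.{u, max u v w} 𝕜 where
  carrier := A.FreeExt deg
  gr := A.freeGr deg
  mul_comm_of_mem := A.free_mul_comm deg
  mul_self_of_odd := A.free_mul_self deg
  d := A.freeD deg δ hδ
  d_mem := A.freeD_mem deg δ hδ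
  d_d := A.freeD_freeD deg δ hδ hdd
  leibniz := A.freeD_leibniz deg δ hδ

end

end FreeExtension

/-! ### The extension that kills the obstructions in degree `k` -/

section Extension

variable {𝕜 : Type u} [Field 𝕜] {A : CDGA.{u, v} 𝕜} {n : ℕ} {ε : A.carrier →ₗ[𝕜] 𝕜} {k : ℕ}

/-- The choice of a basis `α` of a complement of `d (𝒪ᵏ⁻¹)` in `𝒪ᵏ ∩ ker d`, of elements `γ'`
with `d γ' = α`, of cocycles `h` whose classes form a homogeneous basis of the cohomology, and of
homogeneous cocycles `h*` dual to them. -/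
structure ObstructionChoice (A : CDGA.{u, v} 𝕜) (n : ℕ) (ε : A.carrier →ₗ[𝕜] 𝕜) (k : ℕ) where
  l : ℕ
  α : Fin l → A.carrier
  linearIndependent_α : LinearIndependent 𝕜 α
  disjoint_α : Disjoint ((A.orphans ε ⊓ A.gr (k - 1)).map A.d) (Submodule.span 𝕜 (Set.range α))
  sup_α : (A.orphans ε ⊓ A.gr (k - 1)).map A.d ⊔ Submodule.span 𝕜 (Set.range α) =
    A.orphans ε ⊓ A.gr k ⊓ LinearMap.ker A.d
  γ' : Fin l → A.carrier
  γ'_mem : ∀ i, γ' i ∈ A.gr (k - 1)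
  d_γ' : ∀ i, A.d (γ' i) = α i
  m : ℕ
  hdeg : Fin m → ℕ
  h : Fin m → A.cocycles
  h_mem : ∀ j, (h j : A.carrier) ∈ A.gr (hdeg j)
  linearIndependent_h : LinearIndependent 𝕜 fun j => A.cls (h j)
  span_h : Submodule.span 𝕜 (Set.range fun j => A.cls (h j)) = ⊤
  hstar : Fin m → A.cocycles
  hstar_mem : ∀ j, ∃ e, e + hdeg j = n ∧ (hstar j : A.carrier) ∈ A.gr e
  dual : ∀ i j, ε ((hstar j : A.carrier) * (h i : A.carrier)) = if i = j then 1 else 0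

namespace ObstructionChoice

variable (C : ObstructionChoice A n ε k)

/-- `γᵢ = γ'ᵢ - ∑ⱼ ε(γ'ᵢ hⱼ) h*ⱼ`. -/
noncomputable def γ (i : Fin C.l) : A.carrier :=
  C.γ' i - ∑ j, ε (C.γ' i * (C.h j : A.carrier)) • (C.hstar j : A.carrier)

/-- The span `Γ` of the `γᵢ`. -/
noncomputable def Γ : Submodule 𝕜 A.carrier := Submodule.span 𝕜 (Set.range C.γ)

theorem α_mem_inf (i : Fin C.l) : C.α i ∈ A.orphans ε ⊓ A.gr k ⊓ LinearMap.ker A.d := by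
  rw [← C.sup_α]
  exact Submodule.mem_sup_right (Submodule.subset_span ⟨i, rfl⟩)

theorem α_mem (i : Fin C.l) : C.α i ∈ A.gr k := (C.α_mem_inf i).1.2

theorem d_α (i : Fin C.l) : A.d (C.α i) = 0 := (C.α_mem_inf i).2

theorem d_γ (i : Fin C.l) : A.d (C.γ i) = C.α i := by
  rw [γ, map_sub, C.d_γ', map_sum, Finset.sum_eq_zero, sub_zero]
  intro j _
  rw [map_smul, show A.d (C.hstar j : A.carrier) = 0 from (C.hstar j).2, smul_zero]

theorem γ_mem (hε : A.IsOrientation n ε) (i : Fin C.l) : C.γ i ∈ A.gr (k - 1) := by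
  refine sub_mem (C.γ'_mem i) (sum_mem fun j _ => ?_)
  obtain ⟨e, he, hm⟩ := C.hstar_mem j
  by_cases hk : k - 1 + C.hdeg j = n
  · have : e = k - 1 := by omega
    subst this
    exact Submodule.smul_mem _ _ hm
  · rw [hε.eq_zero_of_ne _ hk _ (SetLike.mul_mem_graded (C.γ'_mem i) (C.h_mem j)), zero_smul]
    exact zero_mem _

end ObstructionChoice

/-- In addition, the choice of a graded complement `Z` of `𝒪 ∩ d A` in `𝒪` and of a graded
complement `U` of `Z ⊕ Γ ⊕ d A` in `A`. -/
structure ExtensionChoice (A : CDGA.{u, v} 𝕜) (n : ℕ) (ε : A.carrier →ₗ[𝕜] 𝕜) (k : ℕ) extends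
    ObstructionChoice A n ε k where
  Z : Submodule 𝕜 A.carrier
  graded_Z : A.IsGradedSubspace Z
  disjoint_Z : Disjoint Z (A.orphans ε ⊓ LinearMap.range A.d)
  sup_Z : Z ⊔ (A.orphans ε ⊓ LinearMap.range A.d) = A.orphans ε
  U : Submodule 𝕜 A.carrier
  graded_U : A.IsGradedSubspace U
  isCompl_U : IsCompl (Z ⊔ toObstructionChoice.Γ ⊔ LinearMap.range A.d) U

/-- The condition "`char 𝕜` is a prime and `k` is even" under which there are the additional
generators `u` and `v`. -/
def NeedsUV (𝕜 : Type u) [Field 𝕜] (k : ℕ) : Prop := ringChar 𝕜 ≠ 0 ∧ Even k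

/-- The new generators `cᵢ`, `wᵢ`, and, under the condition `P`, also `uᵢⱼ` and `vᵢⱼ`. The index `j`
starts from `0` here, so that `u _ i 0` is the first `u`-generator with index `i`. -/
inductive ExtGen (l : ℕ) (P : Prop) : Type
  | c (i : Fin l)
  | w (i : Fin l)
  | u (hP : P) (i : Fin l) (j : ℕ)
  | v (hP : P) (i : Fin l) (j : ℕ)

/-- The degrees of the new generators. -/
def ExtGen.deg (p k : ℕ) {l : ℕ} {P : Prop} : ExtGen l P → ℕ
  | .c _ => k - 1
  | .w _ => k - 2
  | .u _ _ j => p ^ (j + 1) * (k - 2) - 1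
  | .v _ _ j => p ^ (j + 1) * (k - 2)

namespace ObstructionChoice

variable (C : ObstructionChoice A n ε k)

/-- The type of the new generators. -/
abbrev Gens : Type := ExtGen C.l (NeedsUV 𝕜 k)

/-- The degree function on the new generators. -/
noncomputable abbrev genDeg : C.Gens → ℕ := ExtGen.deg (ringChar 𝕜) k

/-- The differential of `vᵢⱼ`: `(cᵢ - γᵢ) wᵢᵖ⁻¹` for the first `j`, then `vᵢⱼᵖ⁻¹ d vᵢⱼ`
for the next index. -/
noncomputable def dv (hP : NeedsUV 𝕜 k) (i : Fin C.l) : ℕ → A.FreeExt C.genDeg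
  | 0 => (A.gen C.genDeg (.c i) - A.incl C.genDeg (C.γ i)) *
      A.gen C.genDeg (.w i) ^ (ringChar 𝕜 - 1)
  | j + 1 => A.gen C.genDeg (.v hP i j) ^ (ringChar 𝕜 - 1) * dv hP i j

/-- The differential of the new generators. -/
noncomputable def dGen : C.Gens → A.FreeExt C.genDeg
  | .c i => A.incl C.genDeg (C.α i)
  | .w i => A.gen C.genDeg (.c i) - A.incl C.genDeg (C.γ i)
  | .u _ i 0 => A.gen C.genDeg (.w i) ^ ringChar 𝕜
  | .u hP i (j + 1) => A.gen C.genDeg (.v hP i j) ^ ringChar 𝕜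
  | .v hP i j => C.dv hP i j

theorem c_sub_γ_mem (hε : A.IsOrientation n ε) (i : Fin C.l) :
    A.gen C.genDeg (.c i) - A.incl C.genDeg (C.γ i) ∈ A.freeGr C.genDeg (k - 1) :=
  sub_mem (A.gen_mem C.genDeg (.c i)) (A.incl_mem C.genDeg (C.γ_mem hε i))

theorem gen_pow_mem (x : C.Gens) (m : ℕ) :
    A.gen C.genDeg x ^ m ∈ A.freeGr C.genDeg (m * C.genDeg x) := by
  have h := SetLike.pow_mem_graded m (A.gen_mem C.genDeg x)
  rwa [smul_eq_mul] at h

theorem dv_mem (hε : A.IsOrientation n ε) (hk : 3 ≤ k) (hP : NeedsUV 𝕜 k) (i : Fin C.l) (j : ℕ) :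
    C.dv hP i j ∈ A.freeGr C.genDeg (ringChar 𝕜 ^ (j + 1) * (k - 2) + 1) := by
  obtain ⟨q, hq⟩ : ∃ q, ringChar 𝕜 = q + 1 := Nat.exists_eq_succ_of_ne_zero hP.1
  induction j with
  | zero =>
    have h := SetLike.mul_mem_graded (C.c_sub_γ_mem hε i) (C.gen_pow_mem (.w i) (ringChar 𝕜 - 1))
    have e : k - 1 + (ringChar 𝕜 - 1) * C.genDeg (.w i) =
        ringChar 𝕜 ^ (0 + 1) * (k - 2) + 1 := by
      simp only [ExtGen.deg, hq]
      obtain ⟨r, rfl⟩ : ∃ r, k = r + 2 := ⟨k - 2, by omega⟩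
      simp only [Nat.add_sub_cancel, show r + 2 - 1 = r + 1 by omega]
      ring
    rw [e] at h
    exact h
  | succ j ih =>
    have h := SetLike.mul_mem_graded (C.gen_pow_mem (.v hP i j) (ringChar 𝕜 - 1)) ih
    have e : (ringChar 𝕜 - 1) * C.genDeg (.v hP i j) + (ringChar 𝕜 ^ (j + 1) * (k - 2) + 1) =
        ringChar 𝕜 ^ (j + 1 + 1) * (k - 2) + 1 := by
      simp only [ExtGen.deg, hq, Nat.add_sub_cancel]
      ring
    rw [e] at h
    exact h

theorem dGen_mem (hε : A.IsOrientation n ε) (hk : 3 ≤ k) (x : C.Gens) :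
    C.dGen x ∈ A.freeGr C.genDeg (C.genDeg x + 1) := by
  have hpos : ∀ (_ : NeedsUV 𝕜 k) (j : ℕ), 0 < ringChar 𝕜 ^ (j + 1) * (k - 2) := fun hP j =>
    Nat.mul_pos (Nat.pow_pos (Nat.pos_of_ne_zero hP.1)) (by omega)
  match x with
  | .c i =>
    have e : C.genDeg (.c i) + 1 = k := by simp only [ExtGen.deg]; omega
    rw [e]
    exact A.incl_mem _ (C.α_mem i)
  | .w i =>
    have e : C.genDeg (.w i) + 1 = k - 1 := by simp only [ExtGen.deg]; omega
    rw [e]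
    exact C.c_sub_γ_mem hε i
  | .u hP i 0 =>
    have e : C.genDeg (.u hP i 0) + 1 = ringChar 𝕜 * C.genDeg (.w i) := by
      have := hpos hP 0
      simp only [ExtGen.deg]
      rw [Nat.sub_add_cancel this, zero_add, pow_one]
    rw [e]
    exact C.gen_pow_mem (.w i) _
  | .u hP i (j + 1) =>
    have e : C.genDeg (.u hP i (j + 1)) + 1 = ringChar 𝕜 * C.genDeg (.v hP i j) := by
      have := hpos hP (j + 1)
      simp only [ExtGen.deg]
      rw [Nat.sub_add_cancel this, pow_succ' _ (j + 1), mul_assoc]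
    rw [e]
    exact C.gen_pow_mem (.v hP i j) _
  | .v hP i j => exact C.dv_mem hε hk hP i j

section

variable (hε : A.IsOrientation n ε) (hk : 3 ≤ k)

/-- The derivation of `A ⊗ ⋀(c, w)` or `A ⊗ ⋀(c, w, u, v)`. -/
noncomputable abbrev extD : A.FreeExt C.genDeg →ₗ[𝕜] A.FreeExt C.genDeg :=
  A.freeD C.genDeg C.dGen (C.dGen_mem hε hk)

theorem extD_c_sub_γ (i : Fin C.l) :
    C.extD hε hk (A.gen C.genDeg (.c i) - A.incl C.genDeg (C.γ i)) = 0 := by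
  rw [map_sub, freeD_gen, freeD_incl, C.d_γ]
  exact sub_self _

theorem ringChar_nsmul (m : A.FreeExt C.genDeg) : ringChar 𝕜 • m = 0 := by
  rw [← Nat.cast_smul_eq_nsmul 𝕜, CharP.cast_eq_zero, zero_smul]

theorem odd_wt (hP : NeedsUV 𝕜 k) (hk : 3 ≤ k) (j : ℕ) :
    Odd (ringChar 𝕜 ^ (j + 1) * (k - 2) + 1) := by
  refine Even.add_one (Even.mul_left ?_ _)
  obtain ⟨r, hr⟩ := hP.2
  exact ⟨r - 1, by omega⟩

theorem extD_dv (hP : NeedsUV 𝕜 k) (i : Fin C.l) (j : ℕ) :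
    C.extD hε hk (C.dv hP i j) = 0 := by
  have hodd : Odd (k - 1) := by
    obtain ⟨r, hr⟩ := hP.2
    exact ⟨r - 1, by omega⟩
  have heven : Even (k - 2) := by
    obtain ⟨r, hr⟩ := hP.2
    exact ⟨r - 1, by omega⟩
  cases j with
  | zero =>
    have hm := C.c_sub_γ_mem hε i
    have hw := A.gen_mem C.genDeg (ExtGen.w i : C.Gens)
    have hwd : A.freeD C.genDeg C.dGen (C.dGen_mem hε hk) (A.gen C.genDeg (.w i)) =
      A.gen C.genDeg (.c i) - A.incl C.genDeg (C.γ i) := A.freeD_gen _ _ _ _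
    have hcomm := A.free_mul_comm C.genDeg
      (C.gen_pow_mem (.w i) (ringChar 𝕜 - 1 - 1)) hm
    have hev : Even ((ringChar 𝕜 - 1 - 1) * C.genDeg (ExtGen.w i : C.Gens) * (k - 1)) :=
      (heven.mul_left _).mul_right _
    rw [hev.neg_one_pow, one_smul] at hcomm
    rw [dv, A.freeD_leibniz C.genDeg _ _ _ hm, C.extD_c_sub_γ hε hk, zero_mul, zero_add,
      A.freeD_pow_even C.genDeg _ _ heven hw, hwd, hcomm, mul_smul_comm, ← mul_assoc,
      A.free_mul_self C.genDeg hodd hm, zero_mul, smul_zero, smul_zero]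
  | succ j =>
    have ih := extD_dv hP i j
    have hev : Even (C.genDeg (ExtGen.v hP i j : C.Gens)) := heven.mul_left _
    have hv := A.gen_mem C.genDeg (ExtGen.v hP i j : C.Gens)
    have hvd : A.freeD C.genDeg C.dGen (C.dGen_mem hε hk) (A.gen C.genDeg (.v hP i j)) =
      C.dv hP i j := A.freeD_gen _ _ _ _
    rw [dv, A.freeD_leibniz C.genDeg _ _ _ (C.gen_pow_mem (.v hP i j) _), ih, mul_zero, smul_zero,
      add_zero, A.freeD_pow_even C.genDeg _ _ hev hv, hvd, smul_mul_assoc, mul_assoc,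
      A.free_mul_self C.genDeg (odd_wt hP hk j) (C.dv_mem hε hk hP i j), mul_zero, smul_zero]

theorem extD_dGen (x : C.Gens) : C.extD hε hk (C.dGen x) = 0 := by
  match x with
  | .c i => rw [dGen, freeD_incl, C.d_α, map_zero]
  | .w i => exact C.extD_c_sub_γ hε hk i
  | .u hP i 0 =>
    have heven : Even (C.genDeg (ExtGen.w i : C.Gens)) := by
      obtain ⟨r, hr⟩ := hP.2
      exact ⟨r - 1, by simp only [ExtGen.deg]; omega⟩
    rw [dGen, A.freeD_pow_even C.genDeg _ _ heven (A.gen_mem C.genDeg (.w i)), C.ringChar_nsmul]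
  | .u hP i (j + 1) =>
    have heven : Even (C.genDeg (ExtGen.v hP i j : C.Gens)) := by
      obtain ⟨r, hr⟩ := hP.2
      exact Even.mul_left ⟨r - 1, by omega⟩ _
    rw [dGen, A.freeD_pow_even C.genDeg _ _ heven (A.gen_mem C.genDeg (.v hP i j)),
      C.ringChar_nsmul]
  | .v hP i j => exact C.extD_dv hε hk hP i j

end

/-- The condition `k ≥ n / 2 + 1` with `n ≥ 7` gives `k ≥ 3`. -/
theorem _root_.CDGA.IsReduced.three_le (hA : A.IsReduced n ε) (hk : n + 2 ≤ 2 * k) : 3 ≤ k := by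
  have := hA.seven_le
  omega

variable (hA : A.IsReduced n ε) (hk : n + 2 ≤ 2 * k)

/-- The CDGA `Â = (A ⊗ ⋀(cᵢ, wᵢ), d)` if `char 𝕜 = 0` or `k` is odd, and
`Â = (A ⊗ ⋀(cᵢ, wᵢ, uᵢⱼ, vᵢⱼ), d)` if `char 𝕜` is a prime and `k` is even. -/
noncomputable def extension : CDGA.{u, max u v} 𝕜 :=
  A.adjoin C.genDeg C.dGen (C.dGen_mem hA.orientation (hA.three_le hk))
    (C.extD_dGen hA.orientation (hA.three_le hk))

/-- The inclusion `A → Â`. -/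
noncomputable def emb : A.carrier →ₐ[𝕜] (C.extension hA hk).carrier := A.incl C.genDeg

/-- The generator `cᵢ` of `Â`. -/
noncomputable def c (i : Fin C.l) : (C.extension hA hk).carrier := A.gen C.genDeg (.c i)

/-- The generator `wᵢ` of `Â`. -/
noncomputable def w (i : Fin C.l) : (C.extension hA hk).carrier := A.gen C.genDeg (.w i)

/-- The first generator `u` of index `i` of `Â`. -/
noncomputable def u₁ (hP : NeedsUV 𝕜 k) (i : Fin C.l) : (C.extension hA hk).carrier :=
  A.gen C.genDeg (.u hP i 0)

/-- The first generator `v` of index `i` of `Â`. -/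
noncomputable def v₁ (hP : NeedsUV 𝕜 k) (i : Fin C.l) : (C.extension hA hk).carrier :=
  A.gen C.genDeg (.v hP i 0)

end ObstructionChoice

/-- The subspace `A⁺` of elements of positive degree. -/
def positive (A : CDGA.{u, v} 𝕜) : Submodule 𝕜 A.carrier := ⨆ i : ℕ, A.gr (i + 1)

namespace ExtensionChoice

variable (C : ExtensionChoice A n ε k)

/-- The complement `T = Z ⊕ Γ ⊕ U` of `d A` in `A`. -/
noncomputable def T : Submodule 𝕜 A.carrier := C.Z ⊔ C.Γ ⊔ C.U

variable (hA : A.IsReduced n ε) (hk : n + 2 ≤ 2 * k)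

/-- The formulas that define the extension `ε̂ : Â → s⁻ⁿ𝕜` of `ε`. -/
structure IsExtendedOrientation (e : (C.extension hA hk).carrier →ₗ[𝕜] 𝕜) : Prop where
  emb : ∀ ξ ∈ A.positive, e (C.emb hA hk ξ) = ε ξ
  w_d : ∀ i, ∀ ξ ∈ A.positive,
    e (C.w hA hk i * C.emb hA hk (A.d ξ)) = (-1 : 𝕜) ^ k * ε (C.γ i * ξ)
  c_c : ∀ i j, e (C.c hA hk i * C.c hA hk j) = -ε (C.γ i * C.γ j)
  w : ∀ i, e (C.w hA hk i) = 0
  w_t : ∀ i, ∀ t ∈ C.T, e (C.w hA hk i * C.emb hA hk t) = 0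
  c : ∀ i, e (C.c hA hk i) = 0
  c_ξ : ∀ i, ∀ ξ ∈ A.positive, e (C.c hA hk i * C.emb hA hk ξ) = 0
  c_c_ξ : ∀ i j, ∀ ξ ∈ A.positive, e (C.c hA hk i * C.c hA hk j * C.emb hA hk ξ) = 0
  c_w : ∀ i j, e (C.c hA hk i * C.w hA hk j) = 0
  c_w_ξ : ∀ i j, ∀ ξ ∈ A.positive, e (C.c hA hk i * C.w hA hk j * C.emb hA hk ξ) = 0
  w_w : ∀ i j, e (C.w hA hk i * C.w hA hk j) = 0
  w_w_ξ : ∀ i j, ∀ ξ ∈ A.positive, e (C.w hA hk i * C.w hA hk j * C.emb hA hk ξ) = 0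
  u : ∀ hP i, e (C.u₁ hA hk hP i) = 0
  w_u : ∀ hP i j, e (C.w hA hk i * C.u₁ hA hk hP j) = 0
  v : ∀ hP i, e (C.v₁ hA hk hP i) = 0
  u_ξ : ∀ hP i, ∀ ξ ∈ A.positive, e (C.u₁ hA hk hP i * C.emb hA hk ξ) = 0
  v_ξ : ∀ hP i, ∀ ξ ∈ A.positive, e (C.v₁ hA hk hP i * C.emb hA hk ξ) = 0
  eq_zero_of_ne : ∀ i, i ≠ n → ∀ x ∈ (C.extension hA hk).gr i, e x = 0

end ExtensionChoice

end Extension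

end CDGA

/-! The obstruction in degree `k` is spanned by the `αᵢ`, orphan cocycles that represent the orphan
cocycles modulo differentials of orphans. An orphan is orthogonal to every cocycle, so Poincaré
duality makes `αᵢ` exact in `A`; the correction by the `h*ⱼ` makes the primitive `γᵢ` orthogonal to
every cocycle too. In `Â` the generator `cᵢ` is a second primitive of `αᵢ`, on which the functional
can be prescribed so that `cᵢ` pairs to zero with `A`, and `wᵢ` kills the new class `cᵢ - γᵢ`.

The inclusion `A → Â` is a quasi-isomorphism. It is injective in cohomology because of the
retraction `cᵢ ↦ γᵢ`, all other generators `↦ 0`, a chain map. For surjectivity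
(`exists_eq_incl_add_d`) the indices `i` are removed one at a time. If `k` is odd, `cᵢ - γᵢ` is an
even cocycle and `wᵢ` an odd primitive, which is harmless in every characteristic. If `k` is even,
`y = d wᵢ` is odd and `d (wᵢᵐ) = m wᵢᵐ⁻¹ y`: in characteristic zero nothing survives, while in
characteristic `p` the powers up to `p - 1` leave the class `wᵢᵖ⁻¹ y` (`IsQuasiFree.powSum`), and
`uᵢ₁` removes the higher powers. The next generator `vᵢ₁` has this surviving class as its
differential, and the argument repeats; an element involves finitely many generators, so its
surviving class is exact one stage later.

For the orientation, `k ≥ n/2 + 1` and `n ≥ 7` leave very few monomials of degree at most `n`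
(`gr_le_span_lowMonomial`). On these the conditions determine the functional because `A = T ⊕ dA`,
and the value on `wᵢ dξ` is well defined because `γᵢ` is orthogonal to cocycles. Vanishing on
coboundaries is a check on the monomials of degree `n - 1`; the values on `wᵢ dξ` and `cᵢcⱼ` are
those that make the terms cancel.

For the orphans, a cocycle of `Â` in degree at most `k` is `a + ∑ rᵢ cᵢ` with `a` in `A`, and if it
is an orphan then `a` is an orphan and all `rᵢ` vanish. In degree `k` such an `a` is `d (z + ∑ rᵢ
γᵢ) = d (z + ∑ rᵢ cᵢ)` with `z ∈ Z`. Pairing `a` with `wⱼ` gives `∑ rᵢ ε(γᵢ γⱼ) = 0`, which is what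
makes `∑ rᵢ cᵢ` an orphan. Elements of `Z` in the relevant degrees remain orphans in `Â` because the
functional vanishes on `wᵢ T`. -/

namespace CDGA

/-! ### Signs, homogeneous components, graded complements and orphans in a CDGA. -/

section Sign

variable {𝕜 : Type u} [Field 𝕜]

/-- The sign involution `a ↦ (-1)^|a| a` of a graded algebra. -/
noncomputable def signHom {R : Type*} [Ring R] [Algebra 𝕜 R] (gr : ℕ → Submodule 𝕜 R)
    [GradedAlgebra gr] : R →ₐ[𝕜] R :=
  (DirectSum.toAlgebra 𝕜 (fun i => gr i) (fun i => (-1 : 𝕜) ^ i • (gr i).subtype)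
    (by simp)
    (fun {i j} a b => by
      simp [pow_add, smul_smul]
      rw [mul_comm])).comp
  (DirectSum.decomposeAlgEquiv gr : R →ₐ[𝕜] DirectSum ℕ fun i => gr i)

theorem signHom_of_mem {R : Type*} [Ring R] [Algebra 𝕜 R] (gr : ℕ → Submodule 𝕜 R)
    [GradedAlgebra gr] {i : ℕ} {a : R} (ha : a ∈ gr i) : signHom gr a = (-1 : 𝕜) ^ i • a := by
  have h : DirectSum.decompose gr a = DirectSum.of (fun i => gr i) i ⟨a, ha⟩ :=
    DirectSum.decompose_of_mem gr ha
  change DirectSum.toAddMonoid (fun i => ((-1 : 𝕜) ^ i • (gr i).subtype).toAddMonoidHom)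
    (DirectSum.decompose gr a) = _
  rw [h, DirectSum.toAddMonoid_of]
  rfl

end Sign

section Basic

variable {𝕜 : Type u} [Field 𝕜] (A : CDGA.{u, v} 𝕜)

/-- The sign involution of a CDGA. -/
noncomputable def sgn : A.carrier →ₐ[𝕜] A.carrier := signHom A.gr

theorem sgn_of_mem {i : ℕ} {a : A.carrier} (ha : a ∈ A.gr i) : A.sgn a = (-1 : 𝕜) ^ i • a :=
  signHom_of_mem A.gr ha

theorem sgn_sgn (a : A.carrier) : A.sgn (A.sgn a) = a := by
  refine A.mem_induction (P := fun a => A.sgn (A.sgn a) = a) a (by simp) ?_ ?_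
  · intro i x hx
    rw [A.sgn_of_mem hx, map_smul, A.sgn_of_mem hx, smul_smul, ← mul_pow]
    simp
  · intro x y hx hy
    simp [hx, hy]

theorem d_mul (a b : A.carrier) : A.d (a * b) = A.d a * b + A.sgn a * A.d b := by
  refine A.mem_induction (P := fun a => A.d (a * b) = A.d a * b + A.sgn a * A.d b) a (by simp) ?_ ?_
  · intro i x hx
    rw [A.leibniz b hx, A.sgn_of_mem hx, smul_mul_assoc]
  · intro x y hx hy
    simp only [map_add, add_mul, hx, hy]
    abel

theorem even_mul_comm {i : ℕ} {z : A.carrier} (hi : Even i) (hz : z ∈ A.gr i) (a : A.carrier) :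
    z * a = a * z := by
  refine A.mem_induction (P := fun a => z * a = a * z) a (by simp) ?_ ?_
  · intro j x hx
    rw [A.mul_comm_of_mem hz hx, (hi.mul_right j).neg_one_pow, one_smul]
  · intro x y hx hy
    rw [mul_add, add_mul, hx, hy]

theorem odd_mul_comm {i : ℕ} {z : A.carrier} (hi : Odd i) (hz : z ∈ A.gr i) (a : A.carrier) :
    z * a = A.sgn a * z := by
  refine A.mem_induction (P := fun a => z * a = A.sgn a * z) a (by simp) ?_ ?_
  · intro j x hx
    rw [A.mul_comm_of_mem hz hx, A.sgn_of_mem hx, smul_mul_assoc, pow_mul, hi.neg_one_pow]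
  · intro x y hx hy
    rw [mul_add, map_add, add_mul, hx, hy]

theorem proj_of_mem {i : ℕ} {a : A.carrier} (ha : a ∈ A.gr i) : GradedRing.proj A.gr i a = a := by
  rw [GradedRing.proj_apply, DirectSum.decompose_of_mem_same _ ha]

theorem proj_of_mem_ne {i j : ℕ} {a : A.carrier} (ha : a ∈ A.gr i) (hij : i ≠ j) :
    GradedRing.proj A.gr j a = 0 := by
  rw [GradedRing.proj_apply, DirectSum.decompose_of_mem_ne _ ha hij]

theorem proj_mem (i : ℕ) (a : A.carrier) : GradedRing.proj A.gr i a ∈ A.gr i := by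
  rw [GradedRing.proj_apply]
  exact SetLike.coe_mem _

theorem proj_smul (i : ℕ) (r : 𝕜) (a : A.carrier) :
    GradedRing.proj A.gr i (r • a) = r • GradedRing.proj A.gr i a := by
  rw [GradedRing.proj_apply, GradedRing.proj_apply, DirectSum.decompose_smul]
  rfl

/-- The projection to the component of degree `i`, as a linear map. -/
noncomputable def projₗ (i : ℕ) : A.carrier →ₗ[𝕜] A.carrier where
  toFun := GradedRing.proj A.gr i
  map_add' := map_add _
  map_smul' := A.proj_smul i

theorem exists_sum_proj (a : A.carrier) :
    ∃ s : Finset ℕ, ∑ i ∈ s, GradedRing.proj A.gr i a = a := by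
  classical
  refine ⟨(DirectSum.decompose A.gr a).support, ?_⟩
  simp only [GradedRing.proj_apply]
  exact DirectSum.sum_support_decompose A.gr a

theorem eq_zero_of_proj {a : A.carrier} (h : ∀ i, GradedRing.proj A.gr i a = 0) : a = 0 := by
  obtain ⟨s, hs⟩ := A.exists_sum_proj a
  rw [← hs]
  exact Finset.sum_eq_zero fun i _ => h i

theorem proj_d (i : ℕ) (a : A.carrier) :
    GradedRing.proj A.gr (i + 1) (A.d a) = A.d (GradedRing.proj A.gr i a) := by
  refine A.mem_induction
    (P := fun a => GradedRing.proj A.gr (i + 1) (A.d a) = A.d (GradedRing.proj A.gr i a)) a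
    (by simp) ?_ ?_
  · intro j x hx
    by_cases h : j = i
    · subst h
      rw [A.proj_of_mem hx, A.proj_of_mem (A.d_mem hx)]
    · rw [A.proj_of_mem_ne hx h, A.proj_of_mem_ne (A.d_mem hx) (by omega), map_zero]
  · intro x y hx hy
    simp only [map_add, hx, hy]

theorem proj_zero_d (a : A.carrier) : GradedRing.proj A.gr 0 (A.d a) = 0 := by
  refine A.mem_induction (P := fun a => GradedRing.proj A.gr 0 (A.d a) = 0) a (by simp) ?_ ?_
  · intro j x hx
    exact A.proj_of_mem_ne (A.d_mem hx) (by omega)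
  · intro x y hx hy
    rw [map_add, map_add, hx, hy, add_zero]

theorem proj_mul_left {i : ℕ} {z : A.carrier} (hz : z ∈ A.gr i) (j : ℕ) (a : A.carrier) :
    GradedRing.proj A.gr (i + j) (z * a) = z * GradedRing.proj A.gr j a := by
  refine A.mem_induction (P := fun a => GradedRing.proj A.gr (i + j) (z * a) =
    z * GradedRing.proj A.gr j a) a (by simp) ?_ ?_
  · intro l x hx
    by_cases h : l = j
    · subst h
      rw [A.proj_of_mem hx, A.proj_of_mem (SetLike.mul_mem_graded hz hx)]
    · rw [A.proj_of_mem_ne hx h, A.proj_of_mem_ne (SetLike.mul_mem_graded hz hx) (by omega),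
        mul_zero]
  · intro x y hx hy
    simp only [map_add, mul_add, hx, hy]

/-! ### Graded subspaces -/

theorem IsGradedSubspace.inf {V W : Submodule 𝕜 A.carrier} (hV : A.IsGradedSubspace V)
    (hW : A.IsGradedSubspace W) : A.IsGradedSubspace (V ⊓ W) :=
  fun a ha i => ⟨hV a ha.1 i, hW a ha.2 i⟩

theorem IsGradedSubspace.sup {V W : Submodule 𝕜 A.carrier} (hV : A.IsGradedSubspace V)
    (hW : A.IsGradedSubspace W) : A.IsGradedSubspace (V ⊔ W) := by
  intro a ha i
  obtain ⟨x, hx, y, hy, rfl⟩ := Submodule.mem_sup.1 ha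
  rw [map_add]
  exact Submodule.add_mem_sup (hV x hx i) (hW y hy i)

theorem isGradedSubspace_range_d : A.IsGradedSubspace (LinearMap.range A.d) := by
  rintro _ ⟨x, rfl⟩ i
  cases i with
  | zero => rw [A.proj_zero_d]; exact zero_mem _
  | succ i => rw [A.proj_d]; exact ⟨_, rfl⟩

theorem isGradedSubspace_span {ι : Type*} {f : ι → A.carrier} {e : ℕ} (hf : ∀ j, f j ∈ A.gr e) :
    A.IsGradedSubspace (Submodule.span 𝕜 (Set.range f)) := by
  intro a ha i
  have hle : Submodule.span 𝕜 (Set.range f) ≤ A.gr e := by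
    rw [Submodule.span_le]
    rintro _ ⟨j, rfl⟩
    exact hf j
  by_cases h : e = i
  · subst h
    rwa [A.proj_of_mem (hle ha)]
  · rw [A.proj_of_mem_ne (hle ha) h]
    exact zero_mem _

/-- Intersect a complement of `W₁` in the whole space with `W₂`; the modular law does the rest. -/
theorem exists_relative_complement {W₁ W₂ : Submodule 𝕜 A.carrier} (h : W₁ ≤ W₂) :
    ∃ Z, Disjoint Z W₁ ∧ Z ⊔ W₁ = W₂ := by
  obtain ⟨C, hC⟩ := exists_isCompl W₁
  refine ⟨W₂ ⊓ C, ?_, ?_⟩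
  · exact (hC.disjoint.symm.mono_left inf_le_right)
  · rw [inf_sup_assoc_of_le C h, sup_comm C, hC.sup_eq_top, inf_top_eq]

/-- A graded subspace of a graded subspace has a graded complement. -/
theorem exists_graded_complement {W₁ W₂ : Submodule 𝕜 A.carrier} (h₁ : A.IsGradedSubspace W₁)
    (h₂ : A.IsGradedSubspace W₂) (h : W₁ ≤ W₂) :
    ∃ Z, A.IsGradedSubspace Z ∧ Disjoint Z W₁ ∧ Z ⊔ W₁ = W₂ := by
  have hex : ∀ i, ∃ Z, Disjoint Z (W₁ ⊓ A.gr i) ∧ Z ⊔ (W₁ ⊓ A.gr i) = W₂ ⊓ A.gr i :=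
    fun i => A.exists_relative_complement (inf_le_inf_right _ h)
  choose Z hZ₁ hZ₂ using hex
  have hZle : ∀ i, Z i ≤ W₂ ⊓ A.gr i := fun i => (le_sup_left).trans (hZ₂ i).le
  have hhom : ∀ i, ∀ z ∈ Z i, ∀ j, GradedRing.proj A.gr j z ∈ Z j := by
    intro i z hz j
    by_cases hij : i = j
    · subst hij
      rwa [A.proj_of_mem (hZle _ hz).2]
    · rw [A.proj_of_mem_ne (hZle _ hz).2 hij]
      exact zero_mem _
  -- The complement consists of the elements all of whose components lie in the complements chosen
  -- degree by degree.
  refine ⟨⨅ i, (Z i).comap (A.projₗ i), ?_, ?_, ?_⟩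
  · intro a ha i
    rw [Submodule.mem_iInf] at ha ⊢
    exact hhom i _ (ha i)
  · rw [Submodule.disjoint_def]
    intro a ha haW
    rw [Submodule.mem_iInf] at ha
    exact A.eq_zero_of_proj fun i =>
      Submodule.disjoint_def.1 (hZ₁ i) _ (ha i) ⟨h₁ a haW i, A.proj_mem i a⟩
  · apply le_antisymm
    · refine sup_le ?_ h
      intro a ha
      rw [Submodule.mem_iInf] at ha
      obtain ⟨s, hs⟩ := A.exists_sum_proj a
      rw [← hs]
      exact sum_mem fun i _ => (hZle i (ha i)).1
    · intro a ha
      obtain ⟨s, hs⟩ := A.exists_sum_proj a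
      rw [← hs]
      refine sum_mem fun i _ => ?_
      have hi : GradedRing.proj A.gr i a ∈ Z i ⊔ (W₁ ⊓ A.gr i) := by
        rw [hZ₂]
        exact ⟨h₂ a ha i, A.proj_mem i a⟩
      obtain ⟨x, hx, y, hy, hxy⟩ := Submodule.mem_sup.1 hi
      rw [← hxy]
      refine Submodule.add_mem_sup ?_ hy.1
      rw [Submodule.mem_iInf]
      exact hhom i x hx

/-- A homogeneous coboundary is the differential of a homogeneous element. -/
theorem exists_homogeneous_d {i : ℕ} {a x : A.carrier} (ha : a ∈ A.gr (i + 1)) (hx : A.d x = a) :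
    ∃ y ∈ A.gr i, A.d y = a := by
  refine ⟨_, A.proj_mem i x, ?_⟩
  rw [← A.proj_d, hx, A.proj_of_mem ha]

theorem positive_of_mem {i : ℕ} (hi : i ≠ 0) {a : A.carrier} (ha : a ∈ A.gr i) :
    a ∈ A.positive := by
  obtain ⟨j, rfl⟩ := Nat.exists_eq_succ_of_ne_zero hi
  exact Submodule.mem_iSup_of_mem j ha

end Basic

section Orientation

variable {𝕜 : Type u} [Field 𝕜] {A : CDGA.{u, v} 𝕜} {n : ℕ} {ε : A.carrier →ₗ[𝕜] 𝕜}

theorem IsOrientation.apply_proj (hε : A.IsOrientation n ε) (a : A.carrier) :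
    ε (GradedRing.proj A.gr n a) = ε a := by
  refine A.mem_induction (P := fun a => ε (GradedRing.proj A.gr n a) = ε a) a (by simp) ?_ ?_
  · intro i x hx
    by_cases h : i = n
    · subst h
      rw [A.proj_of_mem hx]
    · rw [A.proj_of_mem_ne hx h, hε.eq_zero_of_ne i h x hx, map_zero]
  · intro x y hx hy
    simp only [map_add, hx, hy]

theorem IsOrientation.apply_sgn (hε : A.IsOrientation n ε) (a : A.carrier) :
    ε (A.sgn a) = (-1 : 𝕜) ^ n * ε a := by
  refine A.mem_induction (P := fun a => ε (A.sgn a) = (-1 : 𝕜) ^ n * ε a) a (by simp) ?_ ?_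
  · intro i x hx
    rw [A.sgn_of_mem hx, map_smul, smul_eq_mul]
    by_cases h : i = n
    · rw [h]
    · rw [hε.eq_zero_of_ne i h x hx, mul_zero, mul_zero]
  · intro x y hx hy
    simp only [map_add, hx, hy, mul_add]

/-- `sgn` is an involutive algebra homomorphism that multiplies `ε` by `(-1)ⁿ`. -/
theorem sgn_mem_orphans (hε : A.IsOrientation n ε) {a : A.carrier} (ha : a ∈ A.orphans ε) :
    A.sgn a ∈ A.orphans ε := by
  intro b
  have : A.sgn a * b = A.sgn (a * A.sgn b) := by rw [map_mul, A.sgn_sgn]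
  rw [this, hε.apply_sgn, ha, mul_zero]

/-- Since `ε` vanishes on `d (ab)`, the Leibniz rule trades `ε (da · b)` for a pairing with the
orphan `sgn a`. -/
theorem d_mem_orphans (hε : A.IsOrientation n ε) {a : A.carrier} (ha : a ∈ A.orphans ε) :
    A.d a ∈ A.orphans ε := by
  intro b
  have h := hε.map_d (a * b)
  rw [A.d_mul, map_add, sgn_mem_orphans hε ha, add_zero] at h
  exact h

/-- Against a homogeneous `b` of degree `n - i`, only the component of `a` of degree `i` contributes
to `ε (ab)`; against other degrees that component pairs to zero anyway. -/
theorem isGradedSubspace_orphans (hε : A.IsOrientation n ε) :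
    A.IsGradedSubspace (A.orphans ε) := by
  intro a ha i b
  refine A.mem_induction (P := fun b => ε (GradedRing.proj A.gr i a * b) = 0) b (by simp) ?_ ?_
  · intro j y hy
    by_cases hij : i + j = n
    · rw [← ha y, ← hε.apply_proj (a * y), ← hij]
      congr 1
      refine A.mem_induction (P := fun a => GradedRing.proj A.gr i a * y =
        GradedRing.proj A.gr (i + j) (a * y)) a (by simp) ?_ ?_
      · intro l x hx
        by_cases h : l = i
        · subst h
          rw [A.proj_of_mem hx, A.proj_of_mem (SetLike.mul_mem_graded hx hy)]
        · rw [A.proj_of_mem_ne hx h, A.proj_of_mem_ne (SetLike.mul_mem_graded hx hy) (by omega),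
            zero_mul]
      · intro x y hx hy
        simp only [map_add, add_mul, hx, hy]
    · exact hε.eq_zero_of_ne _ hij _ (SetLike.mul_mem_graded (A.proj_mem i a) hy)
  · intro x y hx hy
    rw [mul_add, map_add, hx, hy, add_zero]

/-- A homogeneous element of degree `i` is an orphan as soon as `ε` vanishes on its products with
homogeneous elements of degree `n - i`. -/
theorem mem_orphans_of_homogeneous (hε : ∀ i, i ≠ n → ∀ a ∈ A.gr i, ε a = 0) {i : ℕ}
    {a : A.carrier} (ha : a ∈ A.gr i)
    (h : ∀ j, i + j = n → ∀ b ∈ A.gr j, ε (a * b) = 0) : a ∈ A.orphans ε := by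
  intro b
  refine A.mem_induction (P := fun b => ε (a * b) = 0) b (by simp) ?_ ?_
  · intro j y hy
    by_cases hij : i + j = n
    · exact h j hij y hy
    · exact hε _ hij _ (SetLike.mul_mem_graded ha hy)
  · intro x y hx hy
    rw [mul_add, map_add, hx, hy, add_zero]

end Orientation

end CDGA

/-! ### Homomorphisms out of `A ⊗ ⋀X`, coefficients of generators, subalgebras and spanning
monomials. -/

namespace CDGA

section FreeTools

variable {𝕜 : Type u} [Field 𝕜] (A : CDGA.{u, v} 𝕜) {X : Type w} (deg : X → ℕ)

theorem neg_one_pow_mul_self (m : ℕ) : (-1 : 𝕜) ^ m * (-1 : 𝕜) ^ m = 1 := by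
  rw [← mul_pow]
  simp

/-- An algebra homomorphism out of `A ⊗ ⋀X` given by its values on `A` and on the generators. -/
noncomputable def liftGen {B : Type*} [Ring B] [Algebra 𝕜 B] (φ : A.carrier →ₐ[𝕜] B) (g : X → B)
    (hac : ∀ (i : ℕ) (a : A.carrier) (x : X), a ∈ A.gr i →
      φ a * g x = (-1 : 𝕜) ^ (i * deg x) • (g x * φ a))
    (hcc : ∀ x y, g x * g y = (-1 : 𝕜) ^ (deg x * deg y) • (g y * g x))
    (hsq : ∀ x, Odd (deg x) → g x * g x = 0) : A.FreeExt deg →ₐ[𝕜] B :=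
  A.freeLift deg (Sum.elim (fun a => φ a.2) g) (by
    intro x y h
    cases h with
    | add i a b => simp
    | smul i r a => simp
    | one => simp
    | mul i j a b => simp
    | comm y z =>
      simp only [FreeAlgebra.lift_ι_apply, map_mul, map_smul]
      rcases y with ⟨i, a⟩ | x <;> rcases z with ⟨j, b⟩ | y
      · simp only [Sum.elim_inl, wt, ← map_mul, ← map_smul]
        rw [A.mul_comm_of_mem a.2 b.2]
      · exact hac i a y a.2
      · simp only [Sum.elim_inl, Sum.elim_inr, wt]
        rw [hac j b x b.2, smul_smul, mul_comm j, neg_one_pow_mul_self, one_smul]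
      · exact hcc x y
    | sq y hy =>
      simp only [FreeAlgebra.lift_ι_apply, map_mul, map_zero]
      rcases y with ⟨i, a⟩ | x
      · simp only [Sum.elim_inl, ← map_mul]
        rw [A.mul_self_of_odd hy a.2, map_zero]
      · exact hsq x hy)

section

variable {B : Type*} [Ring B] [Algebra 𝕜 B] (φ : A.carrier →ₐ[𝕜] B) (g : X → B)
    (hac : ∀ (i : ℕ) (a : A.carrier) (x : X), a ∈ A.gr i →
      φ a * g x = (-1 : 𝕜) ^ (i * deg x) • (g x * φ a))
    (hcc : ∀ x y, g x * g y = (-1 : 𝕜) ^ (deg x * deg y) • (g y * g x))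
    (hsq : ∀ x, Odd (deg x) → g x * g x = 0)

theorem liftGen_gen (x : X) : A.liftGen deg φ g hac hcc hsq (A.gen deg x) = g x :=
  A.freeLift_letter deg _ _ (Sum.inr x)

theorem liftGen_incl (a : A.carrier) : A.liftGen deg φ g hac hcc hsq (A.incl deg a) = φ a := by
  refine A.mem_induction
    (P := fun a => A.liftGen deg φ g hac hcc hsq (A.incl deg a) = φ a) a (by simp) ?_ ?_
  · intro i x hx
    rw [A.incl_of_mem deg hx]
    exact A.freeLift_letter deg _ _ (Sum.inl ⟨i, ⟨x, hx⟩⟩)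
  · intro x y hx hy
    simp only [map_add, hx, hy]

end

theorem incl_mul_gen {i : ℕ} {a : A.carrier} (ha : a ∈ A.gr i) (x : X) :
    A.incl deg a * A.gen deg x = (-1 : 𝕜) ^ (i * deg x) • (A.gen deg x * A.incl deg a) :=
  A.free_mul_comm deg (A.incl_mem deg ha) (A.gen_mem deg x)

theorem gen_mul_gen (x y : X) :
    A.gen deg x * A.gen deg y = (-1 : 𝕜) ^ (deg x * deg y) • (A.gen deg y * A.gen deg x) :=
  A.free_mul_comm deg (A.gen_mem deg x) (A.gen_mem deg y)

/-- The augmentation `A ⊗ ⋀X → A` that vanishes on the generators. -/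
noncomputable def aug : A.FreeExt deg →ₐ[𝕜] A.carrier :=
  A.liftGen deg (AlgHom.id 𝕜 _) (fun _ => 0) (by simp) (by simp) (by simp)

@[simp] theorem aug_gen (x : X) : A.aug deg (A.gen deg x) = 0 := A.liftGen_gen deg _ _ _ _ _ x

@[simp] theorem aug_incl (a : A.carrier) : A.aug deg (A.incl deg a) = a :=
  A.liftGen_incl deg _ _ _ _ _ a

theorem incl_injective : Function.Injective (A.incl deg) :=
  Function.LeftInverse.injective (A.aug_incl deg)

open Classical in
/-- The endomorphism of `A ⊗ ⋀X` that sends the generators in `s` to zero and is the identity on `A`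
and on the other generators. -/
noncomputable def kill (s : Set X) : A.FreeExt deg →ₐ[𝕜] A.FreeExt deg :=
  A.liftGen deg (A.incl deg) (fun x => if x ∈ s then 0 else A.gen deg x)
    (by
      intro i a x ha
      split_ifs
      · simp
      · exact A.incl_mul_gen deg ha x)
    (by
      intro x y
      split_ifs
      · simp
      · simp
      · simp
      · exact A.gen_mul_gen deg x y)
    (by
      intro x hx
      split_ifs
      · simp
      · exact A.free_mul_self deg hx (A.gen_mem deg x))

theorem kill_gen_of_mem {s : Set X} {x : X} (hx : x ∈ s) : A.kill deg s (A.gen deg x) = 0 := by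
  rw [kill, liftGen_gen, if_pos hx]

theorem kill_gen_of_notMem {s : Set X} {x : X} (hx : x ∉ s) :
    A.kill deg s (A.gen deg x) = A.gen deg x := by
  rw [kill, liftGen_gen, if_neg hx]

theorem kill_incl (s : Set X) (a : A.carrier) : A.kill deg s (A.incl deg a) = A.incl deg a :=
  A.liftGen_incl deg _ _ _ _ _ a

/-! ### The coefficient of a generator -/

section Coeff

variable {R : Type*} [Ring R] [Algebra 𝕜 R] (x : X) (φ : A.FreeExt deg →ₐ[𝕜] R)
  (hφ : φ (A.gen deg x) = 0)

open Classical in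
/-- The coefficient `F` of the generator `x`, followed by an algebra homomorphism `φ` that vanishes
on `x`, is encoded as the algebra homomorphism `a ↦ !![± φ a, F a; 0, φ a]`. -/
noncomputable def coeffMatrix : A.FreeExt deg →ₐ[𝕜] Matrix (Fin 2) (Fin 2) R :=
  A.freeLift deg
    (fun y => !![(-1 : 𝕜) ^ (A.wt deg y * deg x) • φ (A.letter deg y),
      if y = Sum.inr x then 1 else 0; 0, φ (A.letter deg y)]) (by
    have hx : φ (A.letter deg (Sum.inr x)) = 0 := hφ
    intro a b h
    cases h with
    | add i a b =>
      simp only [FreeAlgebra.lift_ι_apply, map_add]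
      ext r s
      fin_cases r <;> fin_cases s <;> simp [wt, letter_add, smul_add]
    | smul i r a =>
      simp only [FreeAlgebra.lift_ι_apply, map_smul]
      ext r s
      fin_cases r <;> fin_cases s <;> simp [wt, letter_smul]
      rw [smul_comm]
    | one =>
      simp only [FreeAlgebra.lift_ι_apply, map_one]
      ext r s
      fin_cases r <;> fin_cases s <;> simp [wt, letter_one]
    | mul i j a b =>
      simp only [FreeAlgebra.lift_ι_apply, map_mul]
      ext r s
      fin_cases r <;> fin_cases s
      · simp [Matrix.mul_apply, Fin.sum_univ_two, wt, letter_mul, smul_smul, pow_add, add_mul]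
        rw [mul_comm]
      · simp [Matrix.mul_apply, Fin.sum_univ_two]
      · simp [Matrix.mul_apply, Fin.sum_univ_two]
      · simp [Matrix.mul_apply, Fin.sum_univ_two, letter_mul]
    | comm y z =>
      simp only [FreeAlgebra.lift_ι_apply, map_mul, map_smul]
      have h0 : φ (A.letter deg y) * φ (A.letter deg z) =
          (-1 : 𝕜) ^ (A.wt deg y * A.wt deg z) • (φ (A.letter deg z) * φ (A.letter deg y)) := by
        rw [← map_mul, A.letter_comm deg y z, map_smul, map_mul]
      ext r s
      fin_cases r <;> fin_cases s
      · generalize (if y = Sum.inr x then (1 : R) else 0) = e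
        generalize (if z = Sum.inr x then (1 : R) else 0) = e'
        simp only [Matrix.mul_apply, Fin.sum_univ_two]
        simp [h0, smul_smul]
        congr 1
        ring
      · simp only [Matrix.mul_apply, Fin.sum_univ_two]
        by_cases hy : y = Sum.inr x <;> by_cases hz : z = Sum.inr x
        · simp [hy, hz, hx]
        · simp [hy, hz, hx, smul_smul, wt, mul_comm (deg x), neg_one_pow_mul_self]
        · simp [hy, hz, hx, wt]
        · simp [hy, hz]
      · simp [Matrix.mul_apply, Fin.sum_univ_two]
      · simp only [Matrix.mul_apply, Fin.sum_univ_two]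
        simp [h0]
    | sq y hy =>
      simp only [FreeAlgebra.lift_ι_apply, map_mul, map_zero]
      have h0 : φ (A.letter deg y) * φ (A.letter deg y) = 0 := by
        rw [← map_mul, A.letter_sq deg y hy, map_zero]
      ext r s
      fin_cases r <;> fin_cases s
      · simp [Matrix.mul_apply, Fin.sum_univ_two, h0]
      · by_cases hyx : y = Sum.inr x
        · simp [Matrix.mul_apply, Fin.sum_univ_two, hyx, hx]
        · simp [Matrix.mul_apply, Fin.sum_univ_two, hyx]
      · simp [Matrix.mul_apply, Fin.sum_univ_two]
      · simp [Matrix.mul_apply, Fin.sum_univ_two, h0])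

/-- The coefficient of the generator `x`, followed by `φ`. -/
noncomputable def coeffOne : A.FreeExt deg →ₗ[𝕜] R where
  toFun a := A.coeffMatrix deg x φ hφ a 0 1
  map_add' := by intro a b; simp
  map_smul' := by intro r a; simp

open Classical in
theorem coeffMatrix_letter (y : A.Letter X) : A.coeffMatrix deg x φ hφ (A.letter deg y) =
    !![(-1 : 𝕜) ^ (A.wt deg y * deg x) • φ (A.letter deg y),
      if y = Sum.inr x then 1 else 0; 0, φ (A.letter deg y)] :=
  A.freeLift_letter deg _ _ y

theorem coeffMatrix_word (L : List (A.Letter X)) :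
    A.coeffMatrix deg x φ hφ (A.word deg L) 0 0 =
      (-1 : 𝕜) ^ (A.wordWt deg L * deg x) • φ (A.word deg L) ∧
    A.coeffMatrix deg x φ hφ (A.word deg L) 1 1 = φ (A.word deg L) ∧
    A.coeffMatrix deg x φ hφ (A.word deg L) 1 0 = 0 := by
  induction L with
  | nil => simp
  | cons y L ih =>
    obtain ⟨h1, h2, h3⟩ := ih
    rw [word_cons, map_mul, coeffMatrix_letter]
    refine ⟨?_, ?_, ?_⟩ <;> rw [Matrix.mul_apply, Fin.sum_univ_two]
    · rw [h1, h3]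
      simp [smul_smul, pow_add, add_mul]
      rw [mul_comm]
    · rw [h2]
      simp
    · rw [h3]
      simp

theorem coeffMatrix_of_mem {i : ℕ} {a : A.FreeExt deg} (ha : a ∈ A.freeGr deg i) :
    A.coeffMatrix deg x φ hφ a 0 0 = (-1 : 𝕜) ^ (i * deg x) • φ a ∧
    A.coeffMatrix deg x φ hφ a 1 1 = φ a := by
  induction ha using Submodule.span_induction with
  | mem x h =>
    obtain ⟨L, rfl, rfl⟩ := h
    exact ⟨(A.coeffMatrix_word deg _ _ _ L).1, (A.coeffMatrix_word deg _ _ _ L).2.1⟩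
  | zero => simp
  | add x y _ _ hx hy => simp [hx.1, hx.2, hy.1, hy.2]
  | smul r x _ hx =>
    rw [map_smul, Matrix.smul_apply, Matrix.smul_apply, hx.1, hx.2, smul_comm, map_smul]
    exact ⟨rfl, rfl⟩

theorem coeffMatrix_one_one (a : A.FreeExt deg) : A.coeffMatrix deg x φ hφ a 1 1 = φ a := by
  refine DirectSum.Decomposition.inductionOn (A.freeGr deg) (by simp) ?_ ?_ a
  · intro i m
    exact (A.coeffMatrix_of_mem deg _ _ _ m.2).2
  · intro x y hx hy
    rw [map_add, Matrix.add_apply, hx, hy, map_add]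

/-- The upper right entry of a product of upper triangular matrices is a twisted Leibniz rule. As
`φ` kills `x`, the map reads off the part linear in `x`. -/
theorem coeffOne_mul {i : ℕ} {a : A.FreeExt deg} (ha : a ∈ A.freeGr deg i) (b : A.FreeExt deg) :
    A.coeffOne deg x φ hφ (a * b) = A.coeffOne deg x φ hφ a * φ b +
      (-1 : 𝕜) ^ (i * deg x) • (φ a * A.coeffOne deg x φ hφ b) := by
  change A.coeffMatrix deg x φ hφ (a * b) 0 1 = A.coeffMatrix deg x φ hφ a 0 1 * φ b +
    (-1 : 𝕜) ^ (i * deg x) • (φ a * A.coeffMatrix deg x φ hφ b 0 1)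
  rw [map_mul, Matrix.mul_apply, Fin.sum_univ_two, (A.coeffMatrix_of_mem deg _ _ _ ha).1,
    A.coeffMatrix_one_one, smul_mul_assoc, add_comm]

theorem coeffOne_incl (a : A.carrier) : A.coeffOne deg x φ hφ (A.incl deg a) = 0 := by
  refine A.mem_induction (P := fun a => A.coeffOne deg x φ hφ (A.incl deg a) = 0) a (by simp) ?_ ?_
  · intro i y hy
    rw [A.incl_of_mem deg hy]
    change A.coeffMatrix deg x φ hφ _ 0 1 = 0
    rw [coeffMatrix_letter]
    simp
  · intro x y hx hy
    simp only [map_add, hx, hy, add_zero]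

theorem coeffOne_gen_self : A.coeffOne deg x φ hφ (A.gen deg x) = 1 := by
  change A.coeffMatrix deg x φ hφ (A.letter deg _) 0 1 = 1
  rw [coeffMatrix_letter]
  simp

theorem coeffOne_gen_of_ne {y : X} (h : y ≠ x) : A.coeffOne deg x φ hφ (A.gen deg y) = 0 := by
  change A.coeffMatrix deg x φ hφ (A.letter deg _) 0 1 = 0
  rw [coeffMatrix_letter]
  simp [h]

theorem coeffOne_gen_self_mul (b : A.FreeExt deg) :
    A.coeffOne deg x φ hφ (A.gen deg x * b) = φ b := by
  rw [A.coeffOne_mul deg x φ hφ (A.gen_mem deg x), A.coeffOne_gen_self, hφ]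
  simp

end Coeff

/-! ### The Taylor expansion in a generator of even degree -/

section Taylor

open Polynomial

variable (x : X) (hx : Even (deg x)) {z : A.FreeExt deg} (hz : z ∈ A.freeGr deg (deg x))

theorem free_even_comm {i : ℕ} (hi : Even i) {z : A.FreeExt deg} (hz : z ∈ A.freeGr deg i)
    (a : A.FreeExt deg) : z * a = a * z := by
  refine DirectSum.Decomposition.inductionOn (A.freeGr deg) (by simp) ?_ ?_ a
  · intro j m
    rw [A.free_mul_comm deg hz m.2, (hi.mul_right j).neg_one_pow, one_smul]
  · intro x y hx hy
    rw [mul_add, add_mul, hx, hy]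

open Classical in
/-- The algebra homomorphism `A ⊗ ⋀X → (A ⊗ ⋀X)[T]` that sends a generator `x` of even degree to
`T + z`, and is the identity on `A` and on the other generators. -/
noncomputable def taylor : A.FreeExt deg →ₐ[𝕜] (A.FreeExt deg)[X] :=
  A.liftGen deg (CAlgHom.comp (A.incl deg))
    (fun y => if y = x then Polynomial.X + C z else C (A.gen deg y))
    (by
      intro i a y ha
      split_ifs with h
      · subst h
        rw [(hx.mul_left i).neg_one_pow, one_smul]
        simp only [AlgHom.comp_apply, CAlgHom_apply, mul_add, add_mul, ← C_mul, X_mul_C]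
        rw [A.free_even_comm deg hx hz]
      · simp only [AlgHom.comp_apply, CAlgHom_apply, ← C_mul, A.incl_mul_gen deg ha y,
          smul_C])
    (by
      intro y y'
      split_ifs with h h' h'
      · subst h h'
        rw [(hx.mul_left _).neg_one_pow, one_smul]
      · subst h
        rw [(hx.mul_right _).neg_one_pow, one_smul, mul_add, add_mul, X_mul_C, ← C_mul, ← C_mul,
          A.free_even_comm deg hx hz]
      · subst h'
        rw [(hx.mul_left _).neg_one_pow, one_smul, mul_add, add_mul, X_mul_C, ← C_mul, ← C_mul,
          A.free_even_comm deg hx hz]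
      · simp only [← C_mul, A.gen_mul_gen deg y y', smul_C])
    (by
      intro y hy
      split_ifs with h
      · subst h
        exact absurd hx (Nat.not_even_iff_odd.2 hy)
      · rw [← C_mul, A.free_mul_self deg hy (A.gen_mem deg y), C_0])

theorem taylor_gen_self : A.taylor deg x hx hz (A.gen deg x) = Polynomial.X + C z := by
  rw [taylor, liftGen_gen, if_pos rfl]

theorem taylor_gen_of_ne {y : X} (h : y ≠ x) :
    A.taylor deg x hx hz (A.gen deg y) = C (A.gen deg y) := by
  rw [taylor, liftGen_gen, if_neg h]

theorem taylor_incl (a : A.carrier) : A.taylor deg x hx hz (A.incl deg a) = C (A.incl deg a) := by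
  rw [taylor, liftGen_incl]
  rfl

end Taylor

/-! ### Subalgebras generated by some of the generators -/

/-- The subalgebra generated by `A` and the generators in `S`. -/
noncomputable def sub (S : Set X) : Subalgebra 𝕜 (A.FreeExt deg) :=
  Algebra.adjoin 𝕜 (Set.range (A.incl deg) ∪ A.gen deg '' S)

theorem incl_mem_sub (S : Set X) (a : A.carrier) : A.incl deg a ∈ A.sub deg S :=
  Algebra.subset_adjoin (Or.inl ⟨a, rfl⟩)

theorem gen_mem_sub {S : Set X} {x : X} (hx : x ∈ S) : A.gen deg x ∈ A.sub deg S :=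
  Algebra.subset_adjoin (Or.inr ⟨x, hx, rfl⟩)

theorem sub_mono {S T : Set X} (h : S ⊆ T) : A.sub deg S ≤ A.sub deg T :=
  Algebra.adjoin_mono (Set.union_subset_union_right _ (Set.image_mono h))

/-- The shift by `z` serves to adjoin the cocycle `cᵢ - γᵢ` in place of `cᵢ`. -/
theorem sub_insert (x : X) (S : Set X) {z : A.FreeExt deg} (hz : z ∈ A.sub deg S) :
    A.sub deg (insert x S) = Algebra.adjoin 𝕜 (insert (A.gen deg x - z) (A.sub deg S)) := by
  apply le_antisymm
  · refine Algebra.adjoin_le ?_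
    rintro _ (⟨a, rfl⟩ | ⟨y, rfl | hy, rfl⟩)
    · exact Algebra.subset_adjoin (Or.inr (A.incl_mem_sub deg S a))
    · have h1 : A.gen deg y - z ∈
          Algebra.adjoin 𝕜 (insert (A.gen deg y - z) (A.sub deg S : Set (A.FreeExt deg))) :=
        Algebra.subset_adjoin (Or.inl rfl)
      have h2 : z ∈ Algebra.adjoin 𝕜
          (insert (A.gen deg y - z) (A.sub deg S : Set (A.FreeExt deg))) :=
        Algebra.subset_adjoin (Or.inr hz)
      have h3 := add_mem h1 h2
      rwa [sub_add_cancel] at h3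
    · exact Algebra.subset_adjoin (Or.inr (A.gen_mem_sub deg hy))
  · refine Algebra.adjoin_le ?_
    rintro _ (rfl | hy)
    · exact sub_mem (A.gen_mem_sub deg (Set.mem_insert x S))
        (A.sub_mono deg (Set.subset_insert x S) hz)
    · exact A.sub_mono deg (Set.subset_insert x S) hy

theorem sub_univ : A.sub deg Set.univ = ⊤ := by
  rw [eq_top_iff]
  intro a _
  refine DirectSum.Decomposition.inductionOn (A.freeGr deg) (zero_mem _) ?_ ?_ a
  · rintro i ⟨m, hm⟩
    change m ∈ _
    induction hm using Submodule.span_induction with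
    | mem x h =>
      obtain ⟨L, rfl, rfl⟩ := h
      induction L with
      | nil => exact one_mem _
      | cons y L ih =>
        rw [word_cons]
        refine mul_mem ?_ ih
        rcases y with ⟨i, a⟩ | x
        · rw [← A.incl_of_mem deg a.2]
          exact A.incl_mem_sub deg _ _
        · exact A.gen_mem_sub deg (Set.mem_univ x)
    | zero => exact zero_mem _
    | add x y _ _ hx hy => exact add_mem hx hy
    | smul r x _ hx => exact Subalgebra.smul_mem _ hx r
  · intro x y hx hy
    exact add_mem hx hy

/-- An element of the subalgebra generated by a directed union of sets of generators lies in
the subalgebra generated by one of them. -/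
theorem exists_mem_sub_of_iUnion {S : ℕ → Set X} (hS : Monotone S) {a : A.FreeExt deg}
    (ha : a ∈ A.sub deg (⋃ j, S j)) : ∃ j, a ∈ A.sub deg (S j) := by
  induction ha using Algebra.adjoin_induction with
  | mem x hx =>
    rcases hx with ⟨a, rfl⟩ | ⟨y, hy, rfl⟩
    · exact ⟨0, A.incl_mem_sub deg _ a⟩
    · obtain ⟨j, hj⟩ := Set.mem_iUnion.1 hy
      exact ⟨j, A.gen_mem_sub deg hj⟩
  | algebraMap r => exact ⟨0, Subalgebra.algebraMap_mem _ r⟩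
  | add x y _ _ hx hy =>
    obtain ⟨i, hi⟩ := hx
    obtain ⟨j, hj⟩ := hy
    exact ⟨max i j, add_mem (A.sub_mono deg (hS (le_max_left i j)) hi)
      (A.sub_mono deg (hS (le_max_right i j)) hj)⟩
  | mul x y _ _ hx hy =>
    obtain ⟨i, hi⟩ := hx
    obtain ⟨j, hj⟩ := hy
    exact ⟨max i j, mul_mem (A.sub_mono deg (hS (le_max_left i j)) hi)
      (A.sub_mono deg (hS (le_max_right i j)) hj)⟩

theorem coeffMatrix_sub {S : Set X} {x : X} (hx : x ∉ S) {R : Type*} [Ring R] [Algebra 𝕜 R]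
    (φ : A.FreeExt deg →ₐ[𝕜] R) (hφ : φ (A.gen deg x) = 0) {b : A.FreeExt deg}
    (hb : b ∈ A.sub deg S) : A.coeffOne deg x φ hφ b = 0 := by
  induction hb using Algebra.adjoin_induction with
  | mem y hy =>
    rcases hy with ⟨a, rfl⟩ | ⟨y, hy, rfl⟩
    · exact A.coeffOne_incl deg x φ hφ a
    · exact A.coeffOne_gen_of_ne deg x φ hφ (fun h => hx (h ▸ hy))
  | algebraMap r =>
    change A.coeffMatrix deg x φ hφ _ 0 1 = 0
    rw [AlgHom.commutes, Matrix.algebraMap_matrix_apply]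
    simp
  | add x y _ _ hx hy => rw [map_add, hx, hy, add_zero]
  | mul y z _ _ hy hz =>
    change A.coeffMatrix deg x φ hφ _ 0 1 = 0
    rw [map_mul, Matrix.mul_apply, Fin.sum_univ_two]
    change A.coeffMatrix deg x φ hφ y 0 1 = 0 at hy
    change A.coeffMatrix deg x φ hφ z 0 1 = 0 at hz
    rw [hy, hz, mul_zero, zero_mul, add_zero]

theorem kill_sub {S T : Set X} (h : Disjoint S T) {b : A.FreeExt deg} (hb : b ∈ A.sub deg S) :
    A.kill deg T b = b := by
  induction hb using Algebra.adjoin_induction with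
  | mem y hy =>
    rcases hy with ⟨a, rfl⟩ | ⟨y, hy, rfl⟩
    · exact A.kill_incl deg T a
    · exact A.kill_gen_of_notMem deg (Set.disjoint_left.1 h hy)
  | algebraMap r => exact AlgHom.commutes _ r
  | add x y _ _ hx hy => rw [map_add, hx, hy]
  | mul x y _ _ hx hy => rw [map_mul, hx, hy]

theorem taylor_sub {S : Set X} {x : X} (hxS : x ∉ S) (hx : Even (deg x)) {z : A.FreeExt deg}
    (hz : z ∈ A.freeGr deg (deg x)) {b : A.FreeExt deg} (hb : b ∈ A.sub deg S) :
    A.taylor deg x hx hz b = Polynomial.C b := by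
  induction hb using Algebra.adjoin_induction with
  | mem y hy =>
    rcases hy with ⟨a, rfl⟩ | ⟨y, hy, rfl⟩
    · exact A.taylor_incl deg x hx hz a
    · exact A.taylor_gen_of_ne deg x hx hz (fun h => hxS (h ▸ hy))
  | algebraMap r => rw [AlgHom.commutes]; rfl
  | add x y _ _ hx hy => rw [map_add, hx, hy, Polynomial.C_add]
  | mul x y _ _ hx hy => rw [map_mul, hx, hy, Polynomial.C_mul]

/-- A generator of odd degree is linearly independent of a subalgebra without it. -/
theorem eq_zero_of_add_gen_mul {S : Set X} {x : X} (hx : x ∉ S) {g h : A.FreeExt deg}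
    (hg : g ∈ A.sub deg S) (hh : h ∈ A.sub deg S) (h0 : g + A.gen deg x * h = 0) : h = 0 := by
  -- The coefficient of `x`, followed by the map that kills `x`, is zero on `g` and sends `x h` to
  -- `h`.
  have hφ := A.kill_gen_of_mem deg (Set.mem_singleton x)
  have h1 := congrArg (A.coeffOne deg x (A.kill deg {x}) hφ) h0
  rw [map_add, map_zero, A.coeffMatrix_sub deg hx _ _ hg, A.coeffOne_gen_self_mul, zero_add,
    A.kill_sub deg (Set.disjoint_singleton_right.2 hx) hh] at h1
  exact h1

/-! ### Generators of the components -/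

/-- The component of degree `N` of `A ⊗ ⋀X` is spanned by the products of generators and an element
of `A`. -/
theorem freeGr_le_span (N : ℕ) : A.freeGr deg N ≤ Submodule.span 𝕜
    {y | ∃ (G : List X) (j : ℕ) (a : A.carrier), a ∈ A.gr j ∧ (G.map deg).sum + j = N ∧
      (G.map (A.gen deg)).prod * A.incl deg a = y} := by
  refine Submodule.span_le.2 ?_
  rintro _ ⟨L, rfl, rfl⟩
  induction L with
  | nil =>
    exact Submodule.subset_span ⟨[], 0, 1, SetLike.GradedOne.one_mem, by simp, by simp⟩
  | cons y L ih =>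
    rw [word_cons, wordWt_cons]
    have key : ∀ z ∈ Submodule.span 𝕜
        {y | ∃ (G : List X) (j : ℕ) (a : A.carrier), a ∈ A.gr j ∧
          (G.map deg).sum + j = A.wordWt deg L ∧
          (G.map (A.gen deg)).prod * A.incl deg a = y},
        A.letter deg y * z ∈ Submodule.span 𝕜
        {z | ∃ (G : List X) (j : ℕ) (a : A.carrier), a ∈ A.gr j ∧
          (G.map deg).sum + j = A.wt deg y + A.wordWt deg L ∧
          (G.map (A.gen deg)).prod * A.incl deg a = z} := by
      intro z hz
      induction hz using Submodule.span_induction with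
      | zero => rw [mul_zero]; exact zero_mem _
      | add x y _ _ hx hy => rw [mul_add]; exact add_mem hx hy
      | smul r x _ hx => rw [mul_smul_comm]; exact Submodule.smul_mem _ r hx
      | mem z hz =>
        obtain ⟨G, j, a, ha, hN, rfl⟩ := hz
        rcases y with ⟨i, b⟩ | x
        -- A letter from `A` moves to the right past all generators, at the cost of a sign, and is
        -- absorbed by `a`.
        · have hG : (G.map (A.gen deg)).prod ∈ A.freeGr deg (G.map deg).sum := by
            have := A.word_mem deg (G.map (Sum.inr : X → A.Letter X))
            rw [word, wordWt, List.map_map, List.map_map] at this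
            exact this
          rw [← mul_assoc, A.free_mul_comm deg (A.letter_mem deg _) hG, smul_mul_assoc, mul_assoc,
            ← A.incl_of_mem deg b.2, ← map_mul]
          refine Submodule.smul_mem _ _ (Submodule.subset_span
            ⟨G, i + j, b * a, SetLike.mul_mem_graded b.2 ha, ?_, rfl⟩)
          simp only [wt]
          omega
        · refine Submodule.subset_span ⟨x :: G, j, a, ha, ?_, ?_⟩
          · simp only [List.map_cons, List.sum_cons, wt]
            omega
          · simp only [List.map_cons, List.prod_cons, mul_assoc]
            rfl
    exact key _ ih

end FreeTools

end CDGA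

/-! ### Filtration by powers of an even element, and the cohomology of one extension step. -/

namespace CDGA

section Acyclic

variable {𝕜 : Type u} [Field 𝕜] (E : CDGA.{u, v} 𝕜)

/-- The sum `∑_{m < M} vᵐ B`. -/
noncomputable def powSum (v : E.carrier) (B : Submodule 𝕜 E.carrier) : ℕ → Submodule 𝕜 E.carrier
  | 0 => ⊥
  | M + 1 => powSum v B M ⊔ B.map (LinearMap.mulLeft 𝕜 (v ^ M))

variable {E} {v : E.carrier} {B : Submodule 𝕜 E.carrier}

theorem powSum_mono : Monotone (E.powSum v B) := monotone_nat_of_le_succ fun _ => le_sup_left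

theorem pow_mul_mem_powSum {M : ℕ} {b : E.carrier} (hb : b ∈ B) :
    v ^ M * b ∈ E.powSum v B (M + 1) := Submodule.mem_sup_right ⟨b, hb, rfl⟩

theorem mem_powSum_succ {M : ℕ} {x : E.carrier} : x ∈ E.powSum v B (M + 1) ↔
    ∃ x' ∈ E.powSum v B M, ∃ b ∈ B, x = x' + v ^ M * b := by
  constructor
  · intro h
    obtain ⟨x', hx', _, ⟨b, hb, rfl⟩, rfl⟩ := Submodule.mem_sup.1 h
    exact ⟨x', hx', b, hb, rfl⟩
  · rintro ⟨x', hx', b, hb, rfl⟩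
    exact Submodule.add_mem_sup hx' ⟨b, hb, rfl⟩

theorem powSum_one : E.powSum v B 1 = B := by
  ext x
  rw [mem_powSum_succ]
  simp [powSum]

theorem pow_mul_powSum {p M : ℕ} {x : E.carrier} (hx : x ∈ E.powSum v B M) :
    v ^ p * x ∈ E.powSum v B (p + M) := by
  induction M generalizing x with
  | zero =>
    have : x = 0 := hx
    rw [this, mul_zero]
    exact zero_mem _
  | succ M ih =>
    obtain ⟨x', hx', b, hb, rfl⟩ := mem_powSum_succ.1 hx
    rw [mul_add, ← mul_assoc, ← pow_add]
    exact add_mem (powSum_mono (by omega) (ih hx')) (pow_mul_mem_powSum hb)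

/-- The powers of `v` are linearly independent over `B`. -/
def IsFreeOver (v : E.carrier) (B : Submodule 𝕜 E.carrier) : Prop :=
  ∀ M, ∀ x ∈ E.powSum v B M, ∀ b ∈ B, x + v ^ M * b = 0 → b = 0

/-- The leading coefficient of `g` is the leading coefficient of `w + vᵖ g`, because `w` only
involves powers below `p`; so the coefficients of `g` vanish one after the other from the top. -/
theorem IsFreeOver.eq_zero (hv : IsFreeOver v B) {p M : ℕ} {w g : E.carrier}
    (hw : w ∈ E.powSum v B p) (hg : g ∈ E.powSum v B M) (h : w + v ^ p * g = 0) : g = 0 := by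
  induction M generalizing g with
  | zero => exact hg
  | succ M ih =>
    obtain ⟨g', hg', b, hb, rfl⟩ := mem_powSum_succ.1 hg
    have hb0 : b = 0 := by
      refine hv (p + M) (w + v ^ p * g') (add_mem (powSum_mono (by omega) hw)
        (pow_mul_powSum hg')) b hb ?_
      rw [← h, pow_add]
      noncomm_ring
    subst hb0
    rw [mul_zero, add_zero] at h ⊢
    exact ih hg' h

/-- `D ⊗ ⟨1, y⟩ → B` is a quasi-isomorphism. -/
def IsQuasiFree (D B : Submodule 𝕜 E.carrier) (y : E.carrier) : Prop :=
  (∀ x ∈ B, E.d x = 0 → ∃ e ∈ D, ∃ f ∈ D, ∃ g ∈ B, E.d e = 0 ∧ E.d f = 0 ∧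
    x = e + y * f + E.d g) ∧
  (∀ e ∈ D, E.d e = 0 → ∀ x ∈ B, E.d x = y * e → ∃ e' ∈ D, E.d e' = e)

section Power

variable {D : Submodule 𝕜 E.carrier} {y : E.carrier}

/-- The integer factor here is the only source of the dependence on the characteristic. -/
theorem d_pow_mul (hv : ∀ b, E.d (v * b) = y * b + v * E.d b) (hvy : v * y = y * v) (M : ℕ)
    (b : E.carrier) : E.d (v ^ (M + 1) * b) =
      v ^ (M + 1) * E.d b + ((M + 1 : ℕ) : 𝕜) • (v ^ M * (y * b)) := by
  induction M with
  | zero => simp [hv, add_comm]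
  | succ M ih =>
    have h1 : y * v ^ (M + 1) = v ^ (M + 1) * y :=
      (show Commute y v from hvy.symm).pow_right (M + 1)
    rw [pow_succ' v (M + 1), mul_assoc, hv, ih, ← mul_assoc y, h1, mul_add, Nat.cast_succ (M + 1),
      add_smul, one_smul, mul_smul_comm, ← mul_assoc v (v ^ M), ← pow_succ', mul_assoc, mul_assoc]
    abel

theorem d_mem_powSum (hv : ∀ b, E.d (v * b) = y * b + v * E.d b) (hvy : v * y = y * v)
    (hBd : ∀ b ∈ B, E.d b ∈ B) (hBy : ∀ b ∈ B, y * b ∈ B) (M : ℕ) {x : E.carrier}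
    (hx : x ∈ E.powSum v B M) : E.d x ∈ E.powSum v B M := by
  induction M generalizing x with
  | zero =>
    have : x = 0 := hx
    rw [this, map_zero]
    exact zero_mem _
  | succ M ih =>
    obtain ⟨x', hx', b, hb, rfl⟩ := mem_powSum_succ.1 hx
    rw [map_add]
    refine add_mem (powSum_mono (Nat.le_succ M) (ih hx')) ?_
    cases M with
    | zero =>
      rw [pow_zero, one_mul, powSum_one]
      exact hBd b hb
    | succ M =>
      rw [d_pow_mul hv hvy]
      exact add_mem (pow_mul_mem_powSum (hBd b hb)) (Submodule.smul_mem _ _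
        (powSum_mono (Nat.le_succ _) (pow_mul_mem_powSum (hBy b hb))))

/-- Each further power of `v = ∫ y` moves the surviving class up by one: `v^N y f` becomes exact as
`d (v^(N+1) f) / (N+1)`, and `v^(N+1) y f` is the new one. The second clause of `IsQuasiFree`, the
part of injectivity that concerns `y`, is carried along because it is what forces the term `v^(N+1)
e` of a cocycle to be removable. -/
theorem IsQuasiFree.powSum (h : IsQuasiFree D B y) (hfree : IsFreeOver v B)
    (hDB : D ≤ B) (hBd : ∀ b ∈ B, E.d b ∈ B) (hBy : ∀ b ∈ B, y * b ∈ B)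
    (hv : ∀ b, E.d (v * b) = y * b + v * E.d b) (hvy : v * y = y * v)
    (hy : ∀ b, E.d (y * b) = -(y * E.d b)) (hyy : y * y = 0) (N : ℕ)
    (hN : ∀ m, 1 ≤ m → m ≤ N → (m : 𝕜) ≠ 0) :
    IsQuasiFree D (E.powSum v B (N + 1)) (v ^ N * y) := by
  have hyy' : ∀ b, y * (y * b) = 0 := fun b => by rw [← mul_assoc, hyy, zero_mul]
  induction N with
  | zero =>
    rw [zero_add, powSum_one, pow_zero, one_mul]
    exact h
  | succ N ih =>
    obtain ⟨ih1, ih2⟩ := ih fun m h1 h2 => hN m h1 (h2.trans (Nat.le_succ N))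
    have hc : ((N + 1 : ℕ) : 𝕜) ≠ 0 := hN (N + 1) (by omega) le_rfl
    have hd := d_pow_mul hv hvy N
    set c : 𝕜 := ((N + 1 : ℕ) : 𝕜) with hcdef
    have hmem : ∀ b ∈ B, v ^ N * (y * b) ∈ E.powSum v B (N + 1) := fun b hb =>
      pow_mul_mem_powSum (hBy b hb)
    have hdmem : ∀ x ∈ E.powSum v B (N + 1), E.d x ∈ E.powSum v B (N + 1) := fun x hx =>
      d_mem_powSum hv hvy hBd hBy _ hx
    constructor
    · intro x hx hdx
      obtain ⟨x', hx', a, ha, rfl⟩ := mem_powSum_succ.1 hx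
      -- The coefficient of `v^(N+1)` in the differential of the cocycle is `da`, since
      -- differentiating powers of `v` only lowers them.
      have hda : E.d a = 0 := by
        refine hfree (N + 1) (E.d x' + c • (v ^ N * (y * a)))
          (add_mem (hdmem _ hx') (Submodule.smul_mem _ _ (hmem a ha))) _ (hBd a ha) ?_
        rw [← hdx, map_add, hd]
        abel
      obtain ⟨e, he, f, hf, g, hg, hde, hdf, rfl⟩ := h.1 a ha hda
      have hdyf : E.d (y * f) = 0 := by rw [hy, hdf, mul_zero, neg_zero]
      -- After `v^(N+1) dg` is traded for `d (v^(N+1) g)` and a lower term, closedness says that the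
      -- lower terms bound a multiple of `v^N y e`. The induction hypothesis then makes `e` exact in
      -- `D`.
      have hx2 : E.d (-c⁻¹ • (x' - c • (v ^ N * (y * g)))) = v ^ N * y * e := by
        have h1 := E.d_d (v ^ (N + 1) * g)
        rw [hd, map_add, map_smul] at h1
        have h2 : E.d (v ^ (N + 1) * (e + y * f)) = c • (v ^ N * (y * e)) := by
          rw [hd, map_add, hde, hdyf, mul_add y, hyy', add_zero, add_zero, mul_zero, zero_add]
        rw [mul_add, map_add, map_add, h2] at hdx
        have h3 : E.d x' - c • E.d (v ^ N * (y * g)) = -(c • (v ^ N * (y * e))) := by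
          rw [eq_neg_iff_add_eq_zero, ← hdx, ← sub_eq_zero]
          rw [← neg_eq_zero, ← h1]
          abel
        rw [map_smul, map_sub, map_smul, h3, neg_smul, smul_neg, neg_neg, smul_smul,
          inv_mul_cancel₀ hc, one_smul, mul_assoc]
      obtain ⟨e', he', rfl⟩ := ih2 e he hde _ (Submodule.smul_mem _ _
        (sub_mem hx' (Submodule.smul_mem _ _ (hmem g hg)))) hx2
      -- With `v^(N+1) de'` also traded for a coboundary and a lower term, the collected lower terms
      -- form a cocycle of the previous stage, since `v^(N+1) y f` is itself closed.
      have hx3 : E.d (x' - c • (v ^ N * (y * g)) - c • (v ^ N * (y * e'))) = 0 := by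
        have h1 := E.d_d (v ^ (N + 1) * g)
        have h2 := E.d_d (v ^ (N + 1) * e')
        have h3 : E.d (v ^ (N + 1) * (y * f)) = 0 := by
          rw [hd, hdyf, hyy', mul_zero, mul_zero, smul_zero, add_zero]
        rw [hd, map_add, map_smul] at h1 h2
        rw [mul_add, mul_add, map_add, map_add, map_add, h3, add_zero] at hdx
        rw [map_sub, map_sub, map_smul, map_smul]
        have h4 := congrArg₂ (· - ·) hdx (congrArg₂ (· + ·) h1 h2)
        simp only [add_zero, sub_zero] at h4
        rw [← h4]
        abel
      obtain ⟨e₁, he₁, f₁, hf₁, g₁, hg₁, hde₁, hdf₁, h4⟩ := ih1 _ (sub_mem (sub_mem hx'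
        (Submodule.smul_mem _ _ (hmem g hg))) (Submodule.smul_mem _ _ (hmem e' (hDB he')))) hx3
      have hup : ∀ b ∈ B, v ^ (N + 1) * b ∈ E.powSum v B (N + 1 + 1) := fun b hb =>
        pow_mul_mem_powSum hb
      -- The last summand of the primitive disposes of the class `v^N y f₁` that survived at the
      -- previous stage.
      refine ⟨e₁, he₁, f, hf, g₁ + v ^ (N + 1) * e' + v ^ (N + 1) * g +
        c⁻¹ • (v ^ (N + 1) * f₁), ?_, hde₁, hdf, ?_⟩
      · exact add_mem (add_mem (add_mem (powSum_mono (Nat.le_succ _) hg₁) (hup _ (hDB he')))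
          (hup _ hg)) (Submodule.smul_mem _ _ (hup _ (hDB hf₁)))
      · have h5 : x' = e₁ + v ^ N * y * f₁ + E.d g₁ + c • (v ^ N * (y * e')) +
            c • (v ^ N * (y * g)) := by
          rw [← h4]
          abel
        rw [h5]
        simp only [map_add, map_smul, hd, hdf₁, mul_zero, zero_add, smul_smul,
          inv_mul_cancel₀ hc, one_smul, mul_add, mul_assoc]
        abel
    · intro e he hde x hx hdx
      obtain ⟨x', hx', a, ha, rfl⟩ := mem_powSum_succ.1 hx
      -- Comparing the coefficients of `v^(N+1)` in `dx = v^(N+1) y e` gives `da = y e`, so the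
      -- clause for `B` itself applies.
      refine h.2 e he hde a ha ?_
      rw [← sub_eq_zero]
      refine hfree (N + 1) (E.d x' + c • (v ^ N * (y * a)))
          (add_mem (hdmem _ hx') (Submodule.smul_mem _ _ (hmem a ha))) _
          (sub_mem (hBd a ha) (hBy e (hDB he))) ?_
      rw [map_add, hd, mul_assoc] at hdx
      rw [mul_sub, ← hdx]
      abel

end Power

/-- In `G ⊕ u G` with `G = W ⊕ s G` and `d u = s`, an element with differential in `W` lies in `W`
up to a coboundary. -/
theorem exists_eq_add_d {W G : Submodule 𝕜 E.carrier} {s u : E.carrier}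
    (hWG : W ≤ G) (hWd : ∀ x ∈ W, E.d x ∈ W) (hGd : ∀ x ∈ G, E.d x ∈ G)
    (hGs : ∀ x ∈ G, s * x ∈ G) (hu : ∀ x ∈ G, E.d (u * x) = s * x - u * E.d x)
    (hG : ∀ g ∈ G, ∃ w ∈ W, ∃ g' ∈ G, g = w + s * g')
    (hW0 : ∀ w ∈ W, ∀ g ∈ G, w + s * g = 0 → g = 0)
    (hu0 : ∀ g ∈ G, ∀ h ∈ G, g + u * h = 0 → h = 0)
    {g h : E.carrier} (hg : g ∈ G) (hh : h ∈ G) (hd : E.d (g + u * h) ∈ W) :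
    ∃ w ∈ W, ∃ g' ∈ G, g + u * h = w + E.d (u * g') := by
  obtain ⟨w, hw, g', hg', rfl⟩ := hG g hg
  have hβ : h + E.d g' ∈ G := add_mem hh (hGd g' hg')
  -- Subtracting `d (u g')` removes the part in `s G`. What remains is `w + u β` with `β = h + dg'`;
  -- independence of `u` gives `dβ = 0`, and then independence of `W` and `s G` gives `β = 0`.
  have h1 : w + s * g' + u * h = w + E.d (u * g') + u * (h + E.d g') := by
    rw [hu g' hg', mul_add]
    abel
  rw [h1, map_add, map_add, E.d_d, add_zero, hu _ hβ] at hd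
  have h2 : E.d w - (E.d w + (s * (h + E.d g') - u * E.d (h + E.d g'))) + s * (h + E.d g') +
      u * (-E.d (h + E.d g')) = 0 := by
    rw [mul_neg]
    abel
  have h3 : E.d (h + E.d g') = 0 := by
    have := hu0 _ (add_mem (sub_mem (hWG (hWd w hw)) (hWG hd)) (hGs _ hβ)) _
      (neg_mem (hGd _ hβ)) h2
    exact neg_eq_zero.1 this
  rw [h3, neg_zero, mul_zero, add_zero] at h2
  have h4 := hW0 _ (sub_mem (hWd w hw) (by rw [h3, mul_zero] at hd; exact hd)) _ hβ h2
  refine ⟨w, hw, g', hg', ?_⟩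
  rw [h1, h4, mul_zero, add_zero]

/-! ### Adjoining one element to a subalgebra -/

/-- As `u² = 0` and `u` moves past `B` at the cost of `sgn`, the sum `B + uB` is already closed
under products. -/
theorem exists_of_mem_adjoin_odd {B : Subalgebra 𝕜 E.carrier} (hB : ∀ b ∈ B, E.sgn b ∈ B)
    {i : ℕ} (hi : Odd i) {u : E.carrier} (hu : u ∈ E.gr i) {x : E.carrier}
    (hx : x ∈ Algebra.adjoin 𝕜 (insert u (B : Set E.carrier))) :
    ∃ g ∈ B, ∃ h ∈ B, x = g + u * h := by
  induction hx using Algebra.adjoin_induction with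
  | mem x hx =>
    rcases hx with rfl | hx
    · exact ⟨0, zero_mem _, 1, one_mem _, by simp⟩
    · exact ⟨x, hx, 0, zero_mem _, by simp⟩
  | algebraMap r => exact ⟨_, B.algebraMap_mem r, 0, zero_mem _, by simp⟩
  | add x y _ _ hx hy =>
    obtain ⟨g, hg, h, hh, rfl⟩ := hx
    obtain ⟨g', hg', h', hh', rfl⟩ := hy
    exact ⟨g + g', add_mem hg hg', h + h', add_mem hh hh', by rw [mul_add]; abel⟩
  | mul x y _ _ hx hy =>
    obtain ⟨g, hg, h, hh, rfl⟩ := hx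
    obtain ⟨g', hg', h', hh', rfl⟩ := hy
    refine ⟨g * g', mul_mem hg hg', E.sgn g * h' + h * g',
      add_mem (mul_mem (hB g hg) hh') (mul_mem hh hg'), ?_⟩
    have h1 : g * u = u * E.sgn g := by rw [E.odd_mul_comm hi hu, E.sgn_sgn]
    have h2 : u * h * (u * h') = 0 := by
      rw [mul_assoc, ← mul_assoc h, show h * u = u * E.sgn h by
        rw [E.odd_mul_comm hi hu, E.sgn_sgn], mul_assoc u, ← mul_assoc u u,
        E.mul_self_of_odd hi hu, zero_mul]
    rw [add_mul, mul_add, mul_add, h2, ← mul_assoc g, h1]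
    noncomm_ring

/-- Division by the central element `z` with remainder in `B`. -/
theorem exists_of_mem_adjoin_even {B : Subalgebra 𝕜 E.carrier}
    {i : ℕ} (hi : Even i) {z : E.carrier} (hz : z ∈ E.gr i) {x : E.carrier}
    (hx : x ∈ Algebra.adjoin 𝕜 (insert z (B : Set E.carrier))) :
    ∃ b ∈ B, ∃ g ∈ Algebra.adjoin 𝕜 (insert z (B : Set E.carrier)), x = b + z * g := by
  have hBle : ∀ b ∈ B, b ∈ Algebra.adjoin 𝕜 (insert z (B : Set E.carrier)) :=
    fun b hb => Algebra.subset_adjoin (Or.inr hb)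
  have hzm : z ∈ Algebra.adjoin 𝕜 (insert z (B : Set E.carrier)) :=
    Algebra.subset_adjoin (Or.inl rfl)
  induction hx using Algebra.adjoin_induction with
  | mem x hx =>
    rcases hx with rfl | hx
    · exact ⟨0, zero_mem _, 1, one_mem _, by simp⟩
    · exact ⟨x, hx, 0, zero_mem _, by simp⟩
  | algebraMap r => exact ⟨_, B.algebraMap_mem r, 0, zero_mem _, by simp⟩
  | add x y _ _ hx hy =>
    obtain ⟨b, hb, g, hg, rfl⟩ := hx
    obtain ⟨b', hb', g', hg', rfl⟩ := hy
    exact ⟨b + b', add_mem hb hb', g + g', add_mem hg hg', by rw [mul_add]; abel⟩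
  | mul x y _ _ hx hy =>
    obtain ⟨b, hb, g, hg, rfl⟩ := hx
    obtain ⟨b', hb', g', hg', rfl⟩ := hy
    refine ⟨b * b', mul_mem hb hb', b * g' + g * (b' + z * g'),
      add_mem (mul_mem (hBle b hb) hg') (mul_mem hg (add_mem (hBle b' hb') (mul_mem hzm hg'))), ?_⟩
    rw [add_mul, mul_add, ← mul_assoc b z, ← E.even_mul_comm hi hz b]
    noncomm_ring

theorem exists_powSum_add {B : Subalgebra 𝕜 E.carrier}
    {i : ℕ} (hi : Even i) {z : E.carrier} (hz : z ∈ E.gr i) (M : ℕ) {x : E.carrier}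
    (hx : x ∈ Algebra.adjoin 𝕜 (insert z (B : Set E.carrier))) :
    ∃ w ∈ E.powSum z B.toSubmodule M,
      ∃ g ∈ Algebra.adjoin 𝕜 (insert z (B : Set E.carrier)), x = w + z ^ M * g := by
  induction M with
  | zero => exact ⟨0, zero_mem _, x, hx, by simp⟩
  | succ M ih =>
    obtain ⟨w, hw, g, hg, rfl⟩ := ih
    obtain ⟨b, hb, g', hg', rfl⟩ := exists_of_mem_adjoin_even hi hz hg
    exact ⟨w + z ^ M * b, mem_powSum_succ.2 ⟨w, hw, b, hb, rfl⟩, g', hg', by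
      rw [pow_succ]; noncomm_ring⟩

theorem powSum_le_adjoin {B : Subalgebra 𝕜 E.carrier} {z : E.carrier} (M : ℕ) :
    E.powSum z B.toSubmodule M ≤
      Subalgebra.toSubmodule (Algebra.adjoin 𝕜 (insert z (B : Set E.carrier))) := by
  induction M with
  | zero => exact bot_le
  | succ M ih =>
    refine sup_le ih ?_
    rintro _ ⟨b, hb, rfl⟩
    change z ^ M * b ∈ Algebra.adjoin 𝕜 (insert z (B : Set E.carrier))
    exact mul_mem (pow_mem (Algebra.subset_adjoin (Set.mem_insert _ _)) M)
      (Algebra.subset_adjoin (Set.mem_insert_of_mem _ hb))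

/-- The stages `M` and `N` of the filtration multiply into stage `M + N`, so their union is a
subalgebra that contains `z` and `B`. -/
theorem exists_mem_powSum {B : Subalgebra 𝕜 E.carrier}
    {i : ℕ} (hi : Even i) {z : E.carrier} (hz : z ∈ E.gr i) {x : E.carrier}
    (hx : x ∈ Algebra.adjoin 𝕜 (insert z (B : Set E.carrier))) :
    ∃ M, x ∈ E.powSum z B.toSubmodule M := by
  have key : ∀ {N : ℕ} {y : E.carrier}, y ∈ E.powSum z B.toSubmodule N → ∀ {M : ℕ} {x : E.carrier},
      x ∈ E.powSum z B.toSubmodule M → x * y ∈ E.powSum z B.toSubmodule (M + N) := by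
    have hb : ∀ b ∈ B, ∀ {M : ℕ} {x : E.carrier}, x ∈ E.powSum z B.toSubmodule M →
        x * b ∈ E.powSum z B.toSubmodule M := by
      intro b hb M
      induction M with
      | zero =>
        intro x hx
        have : x = 0 := hx
        rw [this, zero_mul]
        exact zero_mem _
      | succ M ih =>
        intro x hx
        obtain ⟨x', hx', b', hb', rfl⟩ := mem_powSum_succ.1 hx
        rw [add_mul, mul_assoc]
        exact mem_powSum_succ.2 ⟨_, ih hx', _, B.mul_mem hb' hb, rfl⟩
    intro N
    induction N with
    | zero =>
      intro y hy M x hx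
      have : y = 0 := hy
      rw [this, mul_zero]
      exact zero_mem _
    | succ N ih =>
      intro y hy M x hx
      obtain ⟨y', hy', b, hb', rfl⟩ := mem_powSum_succ.1 hy
      have hc : x * z ^ N = z ^ N * x :=
        ((show Commute z x from E.even_mul_comm hi hz x).pow_left N).symm
      rw [mul_add, ← mul_assoc, hc, mul_assoc]
      exact add_mem (powSum_mono (by omega) (ih hy' hx))
        (powSum_mono (by omega) (pow_mul_powSum (hb b hb' hx)))
  induction hx using Algebra.adjoin_induction with
  | mem x hx =>
    rcases hx with rfl | hx
    · exact ⟨2, mem_powSum_succ.2 ⟨0, zero_mem _, 1, one_mem B, by simp⟩⟩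
    · exact ⟨1, by rw [powSum_one]; exact hx⟩
  | algebraMap r => exact ⟨1, by rw [powSum_one]; exact B.algebraMap_mem r⟩
  | add x y _ _ hx hy =>
    obtain ⟨M, hM⟩ := hx
    obtain ⟨N, hN⟩ := hy
    exact ⟨max M N, add_mem (powSum_mono (le_max_left _ _) hM) (powSum_mono (le_max_right _ _) hN)⟩
  | mul x y _ _ hx hy =>
    obtain ⟨M, hM⟩ := hx
    obtain ⟨N, hN⟩ := hy
    exact ⟨M + N, key hN hM⟩

end Acyclic

end CDGA

/-! ### Adjoining an odd cocycle, an even primitive, or a pair `z`, `t` with `d t = zᵖ`. -/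

namespace CDGA

section Steps

variable {𝕜 : Type u} [Field 𝕜] {E : CDGA.{u, v} 𝕜}

theorem d_even_mul {i : ℕ} (hi : Even i) {z : E.carrier} (hz : z ∈ E.gr i) (b : E.carrier) :
    E.d (z * b) = E.d z * b + z * E.d b := by
  rw [E.d_mul, E.sgn_of_mem hz, hi.neg_one_pow, one_smul]

theorem d_odd_mul {i : ℕ} (hi : Odd i) {z : E.carrier} (hz : z ∈ E.gr i) (b : E.carrier) :
    E.d (z * b) = E.d z * b - z * E.d b := by
  rw [E.d_mul, E.sgn_of_mem hz, hi.neg_one_pow, neg_one_smul, neg_mul, sub_eq_add_neg]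

/-- Adjoining an odd cocycle. -/
theorem isQuasiFree_adjoin_odd {D : Subalgebra 𝕜 E.carrier} (hDs : ∀ b ∈ D, E.sgn b ∈ D)
    (hDd : ∀ b ∈ D, E.d b ∈ D) {i : ℕ} (hi : Odd i) {y : E.carrier} (hy : y ∈ E.gr i)
    (hdy : E.d y = 0) (hfree : ∀ g ∈ D, ∀ h ∈ D, g + y * h = 0 → h = 0) :
    IsQuasiFree D.toSubmodule
      (Subalgebra.toSubmodule (Algebra.adjoin 𝕜 (insert y (D : Set E.carrier)))) y := by
  have hd : ∀ b, E.d (y * b) = -(y * E.d b) := fun b => by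
    rw [d_odd_mul hi hy, hdy, zero_mul, zero_sub]
  constructor
  · intro x hx hdx
    obtain ⟨g, hg, h, hh, rfl⟩ := exists_of_mem_adjoin_odd hDs hi hy hx
    rw [map_add, hd, ← mul_neg] at hdx
    have h1 := hfree _ (hDd g hg) _ (neg_mem (hDd h hh)) hdx
    rw [h1, mul_zero, add_zero] at hdx
    exact ⟨g, hg, h, hh, 0, zero_mem _, hdx, neg_eq_zero.1 h1, by simp⟩
  · intro e he hde x hx hdx
    obtain ⟨g, hg, h, hh, rfl⟩ := exists_of_mem_adjoin_odd hDs hi hy hx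
    rw [map_add, hd] at hdx
    have h1 := hfree _ (hDd g hg) (-E.d h - e) (sub_mem (neg_mem (hDd h hh)) he) (by
      rw [mul_sub, ← hdx, mul_neg]
      abel)
    exact ⟨-h, neg_mem hh, by rw [map_neg]; exact sub_eq_zero.1 h1⟩

section EvenStep

variable {B : Subalgebra 𝕜 E.carrier} {i : ℕ} (hi : Even i) {z : E.carrier} (hz : z ∈ E.gr i)

include hi hz in
theorem d_mem_powSum_of_even (hBd : ∀ b ∈ B, E.d b ∈ B) (hdz : E.d z ∈ B) (M : ℕ) {x : E.carrier}
    (hx : x ∈ E.powSum z B.toSubmodule M) : E.d x ∈ E.powSum z B.toSubmodule M :=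
  d_mem_powSum (d_even_mul hi hz) (E.even_mul_comm hi hz _) hBd (fun _ hb => B.mul_mem hdz hb) M hx

include hi hz in
theorem d_mem_adjoin_even (hBd : ∀ b ∈ B, E.d b ∈ B) (hdz : E.d z ∈ B) {x : E.carrier}
    (hx : x ∈ Algebra.adjoin 𝕜 (insert z (B : Set E.carrier))) :
    E.d x ∈ Algebra.adjoin 𝕜 (insert z (B : Set E.carrier)) := by
  obtain ⟨M, hM⟩ := exists_mem_powSum hi hz hx
  exact powSum_le_adjoin M (d_mem_powSum_of_even hi hz hBd hdz M hM)

-- Adjoining `t` with `d t = zᵖ` truncates the powers of `z`: the sum of `zᵐ B` over `m < p` is a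
-- complement of the multiples of `zᵖ`, and `exists_eq_add_d` applies with `s = zᵖ`.
include hi hz in
theorem exists_eq_add_d_of_mem_adjoin (hBd : ∀ b ∈ B, E.d b ∈ B) (hdz : E.d z ∈ B)
    (hBs : ∀ b ∈ Algebra.adjoin 𝕜 (insert z (B : Set E.carrier)),
      E.sgn b ∈ Algebra.adjoin 𝕜 (insert z (B : Set E.carrier)))
    (hfree : IsFreeOver z B.toSubmodule) {p j : ℕ} (hj : Odd j) {t : E.carrier} (ht : t ∈ E.gr j)
    (hdt : E.d t = z ^ p)
    (hfree' : ∀ g ∈ Algebra.adjoin 𝕜 (insert z (B : Set E.carrier)),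
      ∀ h ∈ Algebra.adjoin 𝕜 (insert z (B : Set E.carrier)), g + t * h = 0 → h = 0)
    {x : E.carrier} (hx : x ∈ Algebra.adjoin 𝕜
      (insert t (Algebra.adjoin 𝕜 (insert z (B : Set E.carrier)) : Set E.carrier)))
    (hdx : E.d x ∈ E.powSum z B.toSubmodule p) :
    ∃ w ∈ E.powSum z B.toSubmodule p, ∃ g ∈ Algebra.adjoin 𝕜 (insert z (B : Set E.carrier)),
      x = w + E.d (t * g) := by
  obtain ⟨g, hg, h, hh, rfl⟩ := exists_of_mem_adjoin_odd hBs hj ht hx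
  refine exists_eq_add_d (s := z ^ p) (G := Subalgebra.toSubmodule
    (Algebra.adjoin 𝕜 (insert z (B : Set E.carrier)))) (powSum_le_adjoin p)
    (fun x hx => d_mem_powSum_of_even hi hz hBd hdz p hx)
    (fun x hx => d_mem_adjoin_even hi hz hBd hdz hx)
    (fun x hx => (Algebra.adjoin 𝕜 (insert z (B : Set E.carrier))).mul_mem
      (pow_mem (Algebra.subset_adjoin (Set.mem_insert _ _)) p) hx)
    (fun x _ => by rw [d_odd_mul hj ht, hdt])
    (fun x hx => exists_powSum_add hi hz p hx) ?_ hfree' hg hh hdx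
  intro w hw g hg h0
  obtain ⟨M, hM⟩ := exists_mem_powSum hi hz hg
  exact hfree.eq_zero hw hM h0

include hi hz in
theorem IsQuasiFree.powSum_of_even {D : Submodule 𝕜 E.carrier} (hD : D ≤ B.toSubmodule)
    (h : IsQuasiFree D B.toSubmodule (E.d z)) (hBd : ∀ b ∈ B, E.d b ∈ B) (hdz : E.d z ∈ B)
    (hfree : IsFreeOver z B.toSubmodule) (N : ℕ) (hN : ∀ m, 1 ≤ m → m ≤ N → (m : 𝕜) ≠ 0) :
    IsQuasiFree D (E.powSum z B.toSubmodule (N + 1)) (z ^ N * E.d z) := by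
  refine h.powSum hfree hD hBd (fun _ hb => B.mul_mem hdz hb) (d_even_mul hi hz)
    (E.even_mul_comm hi hz _) (fun b => ?_) (E.mul_self_of_odd hi.add_one (E.d_mem hz)) N hN
  rw [d_odd_mul hi.add_one (E.d_mem hz), E.d_d, zero_mul, zero_sub]

include hi hz in
/-- In characteristic zero, adjoining `z` with `d z = y` to a quasi-free extension on `1, y` gives
an acyclic extension. -/
theorem IsQuasiFree.exists_of_charZero {D : Submodule 𝕜 E.carrier} (hD : D ≤ B.toSubmodule)
    (h : IsQuasiFree D B.toSubmodule (E.d z)) (hBd : ∀ b ∈ B, E.d b ∈ B) (hdz : E.d z ∈ B)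
    (hfree : IsFreeOver z B.toSubmodule) (hN : ∀ m : ℕ, 1 ≤ m → (m : 𝕜) ≠ 0) {x : E.carrier}
    (hx : x ∈ Algebra.adjoin 𝕜 (insert z (B : Set E.carrier))) (hdx : E.d x = 0) :
    ∃ e ∈ D, ∃ g, x = e + E.d g := by
  obtain ⟨M, hM⟩ := exists_mem_powSum hi hz hx
  obtain ⟨e, he, f, hf, g, -, -, hdf, rfl⟩ := (h.powSum_of_even hi hz hD hBd hdz hfree M
    (fun m h1 _ => hN m h1)).1 x (powSum_mono (Nat.le_succ M) hM) hdx
  have hc : ((M + 1 : ℕ) : 𝕜) ≠ 0 := hN (M + 1) (by omega)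
  -- The surviving class `z^M y f` bounds in the next stage of the filtration, since `M + 1` is
  -- invertible and `f` is closed.
  refine ⟨e, he, (((M + 1 : ℕ) : 𝕜))⁻¹ • (z ^ (M + 1) * f) + g, ?_⟩
  rw [map_add, map_smul, d_pow_mul (d_even_mul hi hz) (E.even_mul_comm hi hz _), hdf, mul_zero,
    zero_add, smul_smul, inv_mul_cancel₀ hc, one_smul, mul_assoc, add_assoc]

include hi hz in
/-- In characteristic `p`, adjoining `z` and `t` with `d z = y` and `d t = zᵖ` to a quasi-free
extension on `1, y` gives a quasi-free extension on `1, zᵖ⁻¹ y`. -/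
theorem IsQuasiFree.adjoin_pair {D : Submodule 𝕜 E.carrier} (hD : D ≤ B.toSubmodule)
    (h : IsQuasiFree D B.toSubmodule (E.d z)) (hBd : ∀ b ∈ B, E.d b ∈ B) (hdz : E.d z ∈ B)
    (hBs : ∀ b ∈ Algebra.adjoin 𝕜 (insert z (B : Set E.carrier)),
      E.sgn b ∈ Algebra.adjoin 𝕜 (insert z (B : Set E.carrier)))
    (hfree : IsFreeOver z B.toSubmodule) {p j : ℕ} (hp : p ≠ 0)
    (hN : ∀ m, 1 ≤ m → m ≤ p - 1 → (m : 𝕜) ≠ 0)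
    (hj : Odd j) {t : E.carrier} (ht : t ∈ E.gr j) (hdt : E.d t = z ^ p)
    (hfree' : ∀ g ∈ Algebra.adjoin 𝕜 (insert z (B : Set E.carrier)),
      ∀ h ∈ Algebra.adjoin 𝕜 (insert z (B : Set E.carrier)), g + t * h = 0 → h = 0) :
    IsQuasiFree D (Subalgebra.toSubmodule (Algebra.adjoin 𝕜
      (insert t (Algebra.adjoin 𝕜 (insert z (B : Set E.carrier)) : Set E.carrier))))
      (z ^ (p - 1) * E.d z) := by
  obtain ⟨q, rfl⟩ := Nat.exists_eq_succ_of_ne_zero hp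
  have hW := h.powSum_of_even hi hz hD hBd hdz hfree q hN
  have hle : ∀ x ∈ E.powSum z B.toSubmodule (q + 1), x ∈ Algebra.adjoin 𝕜
      (insert t (Algebra.adjoin 𝕜 (insert z (B : Set E.carrier)) : Set E.carrier)) :=
    fun x hx => Algebra.subset_adjoin (Set.mem_insert_of_mem _ (powSum_le_adjoin _ hx))
  have hmem : ∀ g ∈ Algebra.adjoin 𝕜 (insert z (B : Set E.carrier)), t * g ∈ Algebra.adjoin 𝕜
      (insert t (Algebra.adjoin 𝕜 (insert z (B : Set E.carrier)) : Set E.carrier)) :=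
    fun g hg => mul_mem (Algebra.subset_adjoin (Set.mem_insert _ _))
      (Algebra.subset_adjoin (Set.mem_insert_of_mem _ hg))
  constructor
  · intro x hx hdx
    -- Up to a coboundary the cocycle lies in the truncated sum, whose cohomology is known from
    -- `powSum_of_even`.
    obtain ⟨w, hw, g, hg, rfl⟩ := exists_eq_add_d_of_mem_adjoin hi hz hBd hdz hBs hfree hj ht hdt
      hfree' hx (by rw [hdx]; exact zero_mem _)
    rw [map_add, E.d_d, add_zero] at hdx
    obtain ⟨e, he, f, hf, g', hg', hde, hdf, rfl⟩ := hW.1 w hw hdx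
    exact ⟨e, he, f, hf, g' + t * g, add_mem (hle _ hg') (hmem g hg), hde, hdf, by
      rw [map_add, add_assoc]
      rfl⟩
  · intro e he hde x hx hdx
    have h1 : z ^ (q + 1 - 1) * E.d z * e ∈ E.powSum z B.toSubmodule (q + 1) := by
      rw [mul_assoc]
      exact pow_mul_mem_powSum (B.mul_mem hdz (hD he))
    obtain ⟨w, hw, g, hg, rfl⟩ := exists_eq_add_d_of_mem_adjoin hi hz hBd hdz hBs hfree hj ht hdt
      hfree' hx (by rw [hdx]; exact h1)
    rw [map_add, E.d_d, add_zero] at hdx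
    exact hW.2 e he hde w hw hdx

include hi hz in
/-- Adjoining an even cocycle `z` and `t` with `d t = z` gives an acyclic extension. -/
theorem exists_of_even_cocycle (hBd : ∀ b ∈ B, E.d b ∈ B) (hdz : E.d z = 0)
    (hBs : ∀ b ∈ Algebra.adjoin 𝕜 (insert z (B : Set E.carrier)),
      E.sgn b ∈ Algebra.adjoin 𝕜 (insert z (B : Set E.carrier)))
    (hfree : IsFreeOver z B.toSubmodule) {j : ℕ}
    (hj : Odd j) {t : E.carrier} (ht : t ∈ E.gr j) (hdt : E.d t = z)
    (hfree' : ∀ g ∈ Algebra.adjoin 𝕜 (insert z (B : Set E.carrier)),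
      ∀ h ∈ Algebra.adjoin 𝕜 (insert z (B : Set E.carrier)), g + t * h = 0 → h = 0)
    {x : E.carrier} (hx : x ∈ Algebra.adjoin 𝕜
      (insert t (Algebra.adjoin 𝕜 (insert z (B : Set E.carrier)) : Set E.carrier)))
    (hdx : E.d x = 0) : ∃ e ∈ B, ∃ g, x = e + E.d g := by
  -- For `p = 1` the truncated sum of powers is `B` itself.
  obtain ⟨w, hw, g, -, h⟩ := exists_eq_add_d_of_mem_adjoin (p := 1) hi hz hBd
    (by rw [hdz]; exact zero_mem _) hBs hfree hj ht (by rw [hdt, pow_one]) hfree' hx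
    (by rw [hdx]; exact zero_mem _)
  rw [powSum_one] at hw
  exact ⟨w, hw, _, h⟩

end EvenStep

end Steps

end CDGA

/-! ### Subalgebras of `(A ⊗ ⋀X, d)`: stability and freeness of the next generator. -/

namespace CDGA

section AdjoinTools

variable {𝕜 : Type u} [Field 𝕜] (A : CDGA.{u, v} 𝕜) {X : Type w} (deg : X → ℕ)
  (δ : X → A.FreeExt deg) (hδ : ∀ x, δ x ∈ A.freeGr deg (deg x + 1))
  (hdd : ∀ x, A.freeD deg δ hδ (δ x) = 0)

/-- A generator as an element of the CDGA `(A ⊗ ⋀X, d)`. -/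
noncomputable def adjGen (x : X) : (A.adjoin deg δ hδ hdd).carrier := A.gen deg x

/-- The inclusion of `A` in the CDGA `(A ⊗ ⋀X, d)`. -/
noncomputable def adjIncl : A.carrier →ₐ[𝕜] (A.adjoin deg δ hδ hdd).carrier := A.incl deg

/-- The subalgebra of `(A ⊗ ⋀X, d)` generated by `A` and the generators in `S`. -/
noncomputable def adjSub (S : Set X) : Subalgebra 𝕜 (A.adjoin deg δ hδ hdd).carrier := A.sub deg S

theorem d_adjIncl (a : A.carrier) : (A.adjoin deg δ hδ hdd).d (A.adjIncl deg δ hδ hdd a) =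
    A.adjIncl deg δ hδ hdd (A.d a) :=
  A.freeD_incl deg δ hδ a

theorem adjGen_mem (x : X) : A.adjGen deg δ hδ hdd x ∈ (A.adjoin deg δ hδ hdd).gr (deg x) :=
  A.gen_mem deg x

theorem adjIncl_mem {i : ℕ} {a : A.carrier} (ha : a ∈ A.gr i) :
    A.adjIncl deg δ hδ hdd a ∈ (A.adjoin deg δ hδ hdd).gr i :=
  A.incl_mem deg ha

theorem adjIncl_mem_adjSub (S : Set X) (a : A.carrier) :
    A.adjIncl deg δ hδ hdd a ∈ A.adjSub deg δ hδ hdd S :=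
  A.incl_mem_sub deg S a

theorem adjGen_mem_adjSub {S : Set X} {x : X} (hx : x ∈ S) :
    A.adjGen deg δ hδ hdd x ∈ A.adjSub deg δ hδ hdd S :=
  A.gen_mem_sub deg hx

theorem adjSub_mono {S T : Set X} (h : S ⊆ T) :
    A.adjSub deg δ hδ hdd S ≤ A.adjSub deg δ hδ hdd T :=
  A.sub_mono deg h

theorem adjSub_insert_sub (x : X) (S : Set X) {z : (A.adjoin deg δ hδ hdd).carrier}
    (hz : z ∈ A.adjSub deg δ hδ hdd S) :
    A.adjSub deg δ hδ hdd (insert x S) =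
      Algebra.adjoin 𝕜 (insert (A.adjGen deg δ hδ hdd x - z) (A.adjSub deg δ hδ hdd S)) :=
  A.sub_insert deg x S hz

theorem adjSub_insert (x : X) (S : Set X) :
    A.adjSub deg δ hδ hdd (insert x S) =
      Algebra.adjoin 𝕜 (insert (A.adjGen deg δ hδ hdd x) (A.adjSub deg δ hδ hdd S)) := by
  have h := A.adjSub_insert_sub deg δ hδ hdd x S (zero_mem _)
  rwa [sub_zero] at h

theorem sgn_mem_adjSub {S : Set X} {b : (A.adjoin deg δ hδ hdd).carrier}
    (hb : b ∈ A.adjSub deg δ hδ hdd S) :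
    (A.adjoin deg δ hδ hdd).sgn b ∈ A.adjSub deg δ hδ hdd S := by
  induction hb using Algebra.adjoin_induction with
  | mem x hx =>
    rcases hx with ⟨a, rfl⟩ | ⟨y, hy, rfl⟩
    · refine A.mem_induction (P := fun a => (A.adjoin deg δ hδ hdd).sgn
        (A.adjIncl deg δ hδ hdd a) ∈ A.adjSub deg δ hδ hdd S) a ?_ ?_ ?_
      · rw [map_zero, map_zero]
        exact zero_mem _
      · intro i x hx
        rw [sgn_of_mem _ (A.adjIncl_mem deg δ hδ hdd hx)]
        exact Subalgebra.smul_mem _ (A.adjIncl_mem_adjSub deg δ hδ hdd S x) _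
      · intro x y hx hy
        rw [map_add, map_add]
        exact add_mem hx hy
    · have h := sgn_of_mem _ (A.adjGen_mem deg δ hδ hdd y)
      change (A.adjoin deg δ hδ hdd).sgn (A.adjGen deg δ hδ hdd y) ∈ _
      rw [h]
      exact Subalgebra.smul_mem _ (A.adjGen_mem_adjSub deg δ hδ hdd hy) _
  | algebraMap r =>
    have h := AlgHom.commutes (A.adjoin deg δ hδ hdd).sgn r
    exact (congrArg (· ∈ A.adjSub deg δ hδ hdd S) h).mpr (Subalgebra.algebraMap_mem _ r)
  | add x y _ _ hx hy =>
    have h := map_add (A.adjoin deg δ hδ hdd).sgn x y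
    exact h ▸ add_mem hx hy
  | mul x y _ _ hx hy =>
    have h := map_mul (A.adjoin deg δ hδ hdd).sgn x y
    exact h ▸ mul_mem hx hy

theorem d_mem_adjSub {S : Set X} (hS : ∀ x ∈ S, (A.adjoin deg δ hδ hdd).d
      (A.adjGen deg δ hδ hdd x) ∈ A.adjSub deg δ hδ hdd S)
    {b : (A.adjoin deg δ hδ hdd).carrier} (hb : b ∈ A.adjSub deg δ hδ hdd S) :
    (A.adjoin deg δ hδ hdd).d b ∈ A.adjSub deg δ hδ hdd S := by
  induction hb using Algebra.adjoin_induction with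
  | mem x hx =>
    rcases hx with ⟨a, rfl⟩ | ⟨y, hy, rfl⟩
    · have h := A.d_adjIncl deg δ hδ hdd a
      exact h ▸ A.adjIncl_mem_adjSub deg δ hδ hdd S _
    · exact hS y hy
  | algebraMap r =>
    have h : (A.adjoin deg δ hδ hdd).d (algebraMap 𝕜 _ r) = 0 := by
      rw [Algebra.algebraMap_eq_smul_one, map_smul, d_one, smul_zero]
    exact h ▸ zero_mem _
  | add x y _ _ hx hy =>
    have h := map_add (A.adjoin deg δ hδ hdd).d x y
    exact h ▸ add_mem hx hy
  | mul x y hx' hy' hx hy =>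
    have h := (A.adjoin deg δ hδ hdd).d_mul x y
    exact h ▸ add_mem (mul_mem hx hy') (mul_mem (A.sgn_mem_adjSub deg δ hδ hdd hx') hy)

/-- The term `z h` belongs to the subalgebra without `x` and is absorbed by `g`. -/
theorem adjGen_free_odd {S : Set X} {x : X} (hx : x ∉ S) {z : (A.adjoin deg δ hδ hdd).carrier}
    (hz : z ∈ A.adjSub deg δ hδ hdd S) :
    ∀ g ∈ A.adjSub deg δ hδ hdd S, ∀ h ∈ A.adjSub deg δ hδ hdd S,
      g + (A.adjGen deg δ hδ hdd x - z) * h = 0 → h = 0 := by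
  intro g hg h hh h0
  refine A.eq_zero_of_add_gen_mul deg hx (g := (g - z * h : (A.adjoin deg δ hδ hdd).carrier))
    (sub_mem hg (mul_mem hz hh)) hh ?_
  have h1 : g - z * h + A.adjGen deg δ hδ hdd x * h = 0 := by
    rw [← h0]
    noncomm_ring
  exact h1

-- The substitution `x ↦ T + z` turns `x - z` into `T` and fixes the subalgebra without `x`, so the
-- coefficients over the powers of `x - z` become coefficients of a polynomial in `T`.
open Polynomial in
theorem adjGen_free_even {S : Set X} {x : X} (hxS : x ∉ S) (hx : Even (deg x))
    {z : (A.adjoin deg δ hδ hdd).carrier} (hz : z ∈ A.adjSub deg δ hδ hdd S)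
    (hzd : z ∈ (A.adjoin deg δ hδ hdd).gr (deg x)) :
    IsFreeOver (A.adjGen deg δ hδ hdd x - z)
      (Subalgebra.toSubmodule (A.adjSub deg δ hδ hdd S)) := by
  let E := A.adjoin deg δ hδ hdd
  let τ : E.carrier →ₐ[𝕜] E.carrier[X] := A.taylor deg x hx hzd
  have hτ : ∀ b ∈ A.adjSub deg δ hδ hdd S, τ b = C b := fun b hb => A.taylor_sub deg hxS hx hzd hb
  have hτx : τ (A.adjGen deg δ hδ hdd x - z) = Polynomial.X := by
    have h1 : τ (A.adjGen deg δ hδ hdd x) = Polynomial.X + C z :=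
      A.taylor_gen_self deg x hx hzd
    rw [map_sub, h1, hτ z hz, add_sub_cancel_right]
  have hpow : ∀ M : ℕ, ∀ b ∈ A.adjSub deg δ hδ hdd S,
      τ ((A.adjGen deg δ hδ hdd x - z) ^ M * b) = Polynomial.X ^ M * C b := by
    intro M b hb
    rw [map_mul, map_pow, hτx, hτ b hb]
  have hco : ∀ M, ∀ y ∈ E.powSum (A.adjGen deg δ hδ hdd x - z)
      (Subalgebra.toSubmodule (A.adjSub deg δ hδ hdd S)) M, ∀ m, M ≤ m → (τ y).coeff m = 0 := by
    intro M
    induction M with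
    | zero =>
      intro y hy m _
      have : y = 0 := hy
      rw [this, map_zero, coeff_zero]
    | succ M ih =>
      intro y hy m hm
      obtain ⟨y', hy', b, hb, rfl⟩ := mem_powSum_succ.1 hy
      rw [map_add, coeff_add, ih y' hy' m (by omega), hpow M b hb, coeff_X_pow_mul', zero_add]
      split_ifs
      · exact coeff_C_of_ne_zero (by omega)
      · rfl
  intro M y hy b hb h0
  have h1 := congrArg (fun q => (τ q).coeff M) h0
  simp only [map_add, coeff_add, hco M y hy M le_rfl, hpow M b hb, coeff_X_pow_mul', map_zero,
    coeff_zero, le_refl, if_true, Nat.sub_self, coeff_C_zero, zero_add] at h1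
  exact h1

end AdjoinTools

end CDGA

/-! ### Every cocycle of `Â` is cohomologous to one of `A`: removal of the generators index by
index. -/

namespace CDGA

section Tower

variable {𝕜 : Type u} [Field 𝕜] {A : CDGA.{u, v} 𝕜} {n : ℕ} {ε : A.carrier →ₗ[𝕜] 𝕜} {k : ℕ}

/-- The index `i` of the generators `cᵢ`, `wᵢ`, `uᵢⱼ` and `vᵢⱼ`. -/
def ExtGen.idx {l : ℕ} {P : Prop} : ExtGen l P → Fin l
  | .c i => i
  | .w i => i
  | .u _ i _ => i
  | .v _ i _ => i

/-- The generators with index less than `i`. -/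
def ExtGen.lt (l : ℕ) (P : Prop) (i : ℕ) : Set (ExtGen l P) := {x | (x.idx : ℕ) < i}

/-- The generators `wᵢ, vᵢ₀, vᵢ₁, …`. -/
def ExtGen.wv {l : ℕ} {P : Prop} (hP : P) (i : Fin l) : ℕ → ExtGen l P
  | 0 => .w i
  | j + 1 => .v hP i j

/-- The sets of generators that come up one pair after the other with a given index. -/
def ExtGen.tower {l : ℕ} {P : Prop} (hP : P) (i : Fin l) : ℕ → Set (ExtGen l P)
  | 0 => insert (.c i) (ExtGen.lt l P i)
  | j + 1 => insert (.u hP i j) (insert (ExtGen.wv hP i j) (ExtGen.tower hP i j))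

namespace ExtGen

variable {l : ℕ} {P : Prop} (hP : P) (i : Fin l)

theorem idx_wv (j : ℕ) : (wv hP i j).idx = i := by cases j <;> rfl

theorem wv_injective : Function.Injective (wv hP i) := by
  intro a b h
  cases a <;> cases b <;> simp_all [wv]

theorem wv_ne_u (a b : ℕ) : wv hP i a ≠ .u hP i b := by
  cases a <;> simp [wv]

theorem wv_ne_c (a : ℕ) : wv hP i a ≠ .c i := by
  cases a <;> simp [wv]

theorem tower_mono : Monotone (tower hP i) := monotone_nat_of_le_succ fun _ _ hx =>
  Set.mem_insert_of_mem _ (Set.mem_insert_of_mem _ hx)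

theorem lt_of_wv_mem_tower {a j : ℕ} (h : wv hP i a ∈ tower hP i j) : a < j := by
  induction j with
  | zero =>
    rcases h with h | h
    · exact absurd h (wv_ne_c hP i a)
    · simp [lt, idx_wv] at h
  | succ j ih =>
    rcases h with h | h | h
    · exact absurd h (wv_ne_u hP i a j)
    · rw [wv_injective hP i h]
      exact Nat.lt_succ_self j
    · exact (ih h).trans (Nat.lt_succ_self j)

theorem lt_of_u_mem_tower {a j : ℕ} (h : .u hP i a ∈ tower hP i j) : a < j := by
  induction j with
  | zero =>
    rcases h with h | h
    · cases h
    · simp [lt, idx] at h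
  | succ j ih =>
    rcases h with h | h | h
    · cases h
      exact Nat.lt_succ_self _
    · exact absurd h.symm (wv_ne_u hP i j a)
    · exact (ih h).trans (Nat.lt_succ_self j)

theorem lt_succ_subset_iUnion_tower : lt l P (i + 1) ⊆ ⋃ j, tower hP i j := by
  intro x hx
  rw [Set.mem_iUnion]
  rcases (Nat.lt_succ_iff_lt_or_eq.1 hx) with h | h
  · exact ⟨0, Set.mem_insert_of_mem _ h⟩
  · have hi : x.idx = i := Fin.ext h
    -- `wᵢ` enters at stage `1`; since `vᵢⱼ` is entry `j + 1` of the sequence `wv`, it enters at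
    -- stage `j + 2`.
    cases x with
    | c i' => exact ⟨0, Or.inl (by rw [← hi]; rfl)⟩
    | w i' => exact ⟨1, Or.inr (Or.inl (by rw [← hi]; rfl))⟩
    | u _ i' j => exact ⟨j + 1, Or.inl (by rw [← hi]; rfl)⟩
    | v _ i' j => exact ⟨j + 2, Or.inr (Or.inl (by rw [← hi]; rfl))⟩

theorem lt_succ_subset_of_not (hP : ¬ P) : lt l P (i + 1) ⊆ insert (.w i) (insert (.c i) (lt l P i)) := by
  intro x hx
  rcases (Nat.lt_succ_iff_lt_or_eq.1 hx) with h | h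
  · exact Or.inr (Or.inr h)
  · have hi : x.idx = i := Fin.ext h
    cases x with
    | c i' => exact Or.inr (Or.inl (by rw [← hi]; rfl))
    | w i' => exact Or.inl (by rw [← hi]; rfl)
    | u h' i' j => exact absurd h' hP
    | v h' i' j => exact absurd h' hP

end ExtGen

namespace ObstructionChoice

variable (C : ObstructionChoice A n ε k)
  (hδ : ∀ x, C.dGen x ∈ A.freeGr C.genDeg (C.genDeg x + 1))
  (hdd : ∀ x, A.freeD C.genDeg C.dGen hδ (C.dGen x) = 0)

/-- The CDGA `Â`. -/
local notation "𝔼" => A.adjoin C.genDeg C.dGen hδ hdd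
local notation "𝔤" => A.adjGen C.genDeg C.dGen hδ hdd
local notation "𝔦" => A.adjIncl C.genDeg C.dGen hδ hdd
local notation "𝔹" => A.adjSub C.genDeg C.dGen hδ hdd

theorem d_gen_c (i : Fin C.l) : (𝔼).d (𝔤 (.c i)) = 𝔦 (C.α i) := A.freeD_gen _ _ _ _

theorem d_gen_w (i : Fin C.l) : (𝔼).d (𝔤 (.w i)) = 𝔤 (.c i) - 𝔦 (C.γ i) := A.freeD_gen _ _ _ _

theorem d_gen_u (hP : NeedsUV 𝕜 k) (i : Fin C.l) (j : ℕ) :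
    (𝔼).d (𝔤 (.u hP i j)) = 𝔤 (ExtGen.wv hP i j) ^ ringChar 𝕜 := by
  cases j <;> exact A.freeD_gen _ _ _ _

theorem d_gen_v (hP : NeedsUV 𝕜 k) (i : Fin C.l) (j : ℕ) :
    (𝔼).d (𝔤 (.v hP i j)) = C.dv hP i j := A.freeD_gen _ _ _ _

theorem d_gen_c_sub (i : Fin C.l) : (𝔼).d (𝔤 (.c i) - 𝔦 (C.γ i)) = 0 := by
  rw [← C.d_gen_w, d_d]

theorem even_wv_deg (hP : NeedsUV 𝕜 k) (i : Fin C.l) (j : ℕ) :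
    Even (C.genDeg (ExtGen.wv hP i j)) := by
  have heven : Even (k - 2) := by
    obtain ⟨r, hr⟩ := hP.2
    exact ⟨r - 1, by omega⟩
  cases j with
  | zero => exact heven
  | succ j => exact heven.mul_left _

theorem odd_u_deg (hk : 3 ≤ k) (hP : NeedsUV 𝕜 k) (i : Fin C.l) (j : ℕ) :
    Odd (C.genDeg (ExtGen.u hP i j)) := by
  have hpos : 0 < ringChar 𝕜 ^ (j + 1) * (k - 2) :=
    Nat.mul_pos (Nat.pow_pos (Nat.pos_of_ne_zero hP.1)) (by omega)
  have heven : Even (ringChar 𝕜 ^ (j + 1) * (k - 2)) := by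
    obtain ⟨r, hr⟩ := hP.2
    exact Even.mul_left ⟨r - 1, by omega⟩ _
  exact Nat.Even.sub_odd hpos heven odd_one

/-- This uniform recursion makes `wᵢ` the zeroth of the `v`'s: the differential of each entry is the
class left over by the previous one. For `j = 0` it uses that `wᵢ` has even degree and so commutes
with `cᵢ - γᵢ`. -/
theorem d_gen_wv_succ (hP : NeedsUV 𝕜 k) (i : Fin C.l) (j : ℕ) :
    (𝔼).d (𝔤 (ExtGen.wv hP i (j + 1))) =
      𝔤 (ExtGen.wv hP i j) ^ (ringChar 𝕜 - 1) * (𝔼).d (𝔤 (ExtGen.wv hP i j)) := by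
  cases j with
  | zero =>
    have h : (𝔼).d (𝔤 (ExtGen.wv hP i 1)) = (𝔤 (.c i) - 𝔦 (C.γ i)) *
        𝔤 (.w i) ^ (ringChar 𝕜 - 1) := C.d_gen_v hδ hdd hP i 0
    rw [h]
    simp only [ExtGen.wv]
    rw [d_gen_w]
    have hc : Commute (𝔤 (.w i)) (𝔤 (.c i) - 𝔦 (C.γ i)) :=
      (𝔼).even_mul_comm (C.even_wv_deg hP i 0) (A.adjGen_mem _ _ hδ hdd (.w i)) _
    exact (hc.pow_left _).eq.symm
  | succ j =>
    have h1 : (𝔼).d (𝔤 (ExtGen.wv hP i (j + 1 + 1))) = C.dv hP i (j + 1) := C.d_gen_v hδ hdd hP i _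
    have h2 : (𝔼).d (𝔤 (ExtGen.wv hP i (j + 1))) = C.dv hP i j := C.d_gen_v hδ hdd hP i _
    rw [h1, h2]
    rfl

/-- The subalgebra generated by `A` and `S` is closed under the differential. -/
def IsStable (S : Set C.Gens) : Prop := ∀ x ∈ S, (𝔼).d (𝔤 x) ∈ 𝔹 S

variable {C hδ hdd} in
theorem IsStable.insert {S : Set C.Gens} (hS : C.IsStable hδ hdd S) {x : C.Gens}
    (hx : (𝔼).d (𝔤 x) ∈ 𝔹 S) : C.IsStable hδ hdd (insert x S) := by
  rintro y (rfl | hy)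
  · exact A.adjSub_mono _ _ _ _ (Set.subset_insert _ _) hx
  · exact A.adjSub_mono _ _ _ _ (Set.subset_insert _ _) (hS y hy)

/-- The differential of a generator involves, besides `A`, only generators with the same index. -/
theorem isStable_lt (i : ℕ) : C.IsStable hδ hdd (ExtGen.lt _ _ i) := by
  have hv : ∀ (hP : NeedsUV 𝕜 k) (i' : Fin C.l), (i' : ℕ) < i → ∀ j,
      (𝔼).d (𝔤 (ExtGen.wv hP i' j)) ∈ 𝔹 (ExtGen.lt _ _ i) := by
    intro hP i' hi j
    induction j with
    | zero =>
      simp only [ExtGen.wv]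
      rw [d_gen_w]
      exact sub_mem (A.adjGen_mem_adjSub _ _ _ _ hi) (A.adjIncl_mem_adjSub _ _ _ _ _ _)
    | succ j ih =>
      rw [d_gen_wv_succ]
      refine mul_mem (pow_mem (A.adjGen_mem_adjSub _ _ _ _ ?_) _) ih
      change ((ExtGen.wv hP i' j).idx : ℕ) < i
      rwa [ExtGen.idx_wv]
  rintro (i' | i' | ⟨hP, i', j⟩ | ⟨hP, i', j⟩) hi
  · rw [d_gen_c]
    exact A.adjIncl_mem_adjSub _ _ _ _ _ _
  · rw [d_gen_w]
    exact sub_mem (A.adjGen_mem_adjSub _ _ _ _ hi) (A.adjIncl_mem_adjSub _ _ _ _ _ _)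
  · rw [d_gen_u]
    refine pow_mem (A.adjGen_mem_adjSub _ _ _ _ ?_) _
    change ((ExtGen.wv hP i' j).idx : ℕ) < i
    rw [ExtGen.idx_wv]
    exact hi
  · exact hv hP i' hi (j + 1)

theorem d_wv_mem_tower (hP : NeedsUV 𝕜 k) (i : Fin C.l) (j : ℕ) :
    (𝔼).d (𝔤 (ExtGen.wv hP i j)) ∈ 𝔹 (ExtGen.tower hP i j) := by
  induction j with
  | zero =>
    simp only [ExtGen.wv]
    rw [d_gen_w]
    exact sub_mem (A.adjGen_mem_adjSub _ _ _ _ (Set.mem_insert _ _))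
      (A.adjIncl_mem_adjSub _ _ _ _ _ _)
  | succ j ih =>
    rw [d_gen_wv_succ]
    exact mul_mem (pow_mem (A.adjGen_mem_adjSub _ _ _ _
      (Set.mem_insert_of_mem _ (Set.mem_insert _ _))) _)
      (A.adjSub_mono _ _ _ _ (ExtGen.tower_mono hP i (Nat.le_succ j)) ih)

theorem isStable_insert_c (i : Fin C.l) :
    C.IsStable hδ hdd (insert (.c i) (ExtGen.lt _ _ i)) := by
  refine (C.isStable_lt hδ hdd i).insert ?_
  rw [d_gen_c]
  exact A.adjIncl_mem_adjSub _ _ _ _ _ _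

theorem isStable_tower (hP : NeedsUV 𝕜 k) (i : Fin C.l) (j : ℕ) :
    C.IsStable hδ hdd (ExtGen.tower hP i j) := by
  induction j with
  | zero => exact C.isStable_insert_c hδ hdd i
  | succ j ih =>
    refine (ih.insert (C.d_wv_mem_tower hδ hdd hP i j)).insert ?_
    rw [d_gen_u]
    exact pow_mem (A.adjGen_mem_adjSub _ _ _ _ (Set.mem_insert _ _)) _

theorem c_notMem_lt (i : Fin C.l) : (.c i : C.Gens) ∉ ExtGen.lt C.l (NeedsUV 𝕜 k) i :=
  lt_irrefl (i : ℕ)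

/-- Replacing `cᵢ` by `cᵢ - γᵢ = d wᵢ`, one adjoins an odd cocycle. This starts the tower. -/
theorem isQuasiFree_insert_c (hγ : ∀ i, C.γ i ∈ A.gr (k - 1)) (hk : Odd (k - 1)) (i : Fin C.l) :
    IsQuasiFree (Subalgebra.toSubmodule (𝔹 (ExtGen.lt _ _ i)))
      (Subalgebra.toSubmodule (𝔹 (insert (.c i) (ExtGen.lt _ _ i)))) ((𝔼).d (𝔤 (.w i))) := by
  have hγm := A.adjIncl_mem_adjSub C.genDeg C.dGen hδ hdd (ExtGen.lt _ _ i) (C.γ i)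
  rw [d_gen_w, A.adjSub_insert_sub _ _ _ _ _ _ hγm]
  exact isQuasiFree_adjoin_odd (fun b hb => A.sgn_mem_adjSub _ _ _ _ hb)
    (fun b hb => A.d_mem_adjSub _ _ _ _ (C.isStable_lt hδ hdd i) hb) hk
    (sub_mem (A.adjGen_mem _ _ hδ hdd (.c i)) (A.adjIncl_mem _ _ hδ hdd (hγ i)))
    (C.d_gen_c_sub hδ hdd i) (A.adjGen_free_odd _ _ _ _ (C.c_notMem_lt i) hγm)

theorem lt_subset_tower (hP : NeedsUV 𝕜 k) (i : Fin C.l) (j : ℕ) :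
    ExtGen.lt _ _ i ⊆ ExtGen.tower hP i j :=
  (Set.subset_insert _ _).trans (ExtGen.tower_mono hP i (Nat.zero_le j))

theorem adjGen_free_even' {S : Set C.Gens} {x : C.Gens} (hxS : x ∉ S) (hx : Even (C.genDeg x)) :
    IsFreeOver (𝔤 x) (Subalgebra.toSubmodule (𝔹 S)) := by
  have h := A.adjGen_free_even C.genDeg C.dGen hδ hdd hxS hx (zero_mem _) (zero_mem _)
  rwa [sub_zero] at h

theorem adjGen_free_odd' {S : Set C.Gens} {x : C.Gens} (hxS : x ∉ S) :
    ∀ g ∈ 𝔹 S, ∀ h ∈ 𝔹 S, g + 𝔤 x * h = 0 → h = 0 := by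
  have h := A.adjGen_free_odd C.genDeg C.dGen hδ hdd hxS (zero_mem _)
  simpa only [sub_zero] using h

/-- A pair consisting of an entry of `wv` and its `u` replaces the surviving class `y` by `zᵖ⁻¹ y`,
where `z` is that entry and `y = d z`; by `d_gen_wv_succ` this is the differential of the next
entry, so the statement reproduces itself. -/
theorem isQuasiFree_tower (hγ : ∀ i, C.γ i ∈ A.gr (k - 1)) (hk : 3 ≤ k) (hP : NeedsUV 𝕜 k)
    (i : Fin C.l) (j : ℕ) :
    IsQuasiFree (Subalgebra.toSubmodule (𝔹 (ExtGen.lt _ _ i)))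
      (Subalgebra.toSubmodule (𝔹 (ExtGen.tower hP i j))) ((𝔼).d (𝔤 (ExtGen.wv hP i j))) := by
  have hodd : Odd (k - 1) := by
    obtain ⟨r, hr⟩ := hP.2
    exact ⟨r - 1, by omega⟩
  induction j with
  | zero => exact C.isQuasiFree_insert_c hδ hdd hγ hodd i
  | succ j ih =>
    have hwv : ExtGen.wv hP i j ∉ ExtGen.tower hP i j := fun h =>
      lt_irrefl _ (ExtGen.lt_of_wv_mem_tower hP i h)
    have hu : ExtGen.u hP i j ∉ insert (ExtGen.wv hP i j) (ExtGen.tower hP i j) := by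
      rintro (h | h)
      · exact ExtGen.wv_ne_u hP i j j h.symm
      · exact lt_irrefl _ (ExtGen.lt_of_u_mem_tower hP i h)
    have hins := A.adjSub_insert C.genDeg C.dGen hδ hdd (ExtGen.wv hP i j) (ExtGen.tower hP i j)
    have hp : (ringChar 𝕜).Prime :=
      (CharP.char_is_prime_or_zero 𝕜 (ringChar 𝕜)).resolve_right hP.1
    rw [d_gen_wv_succ]
    simp only [ExtGen.tower]
    rw [A.adjSub_insert, hins]
    refine ih.adjoin_pair (C.even_wv_deg hP i j) (A.adjGen_mem _ _ _ _ _)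
      (fun x hx => A.adjSub_mono _ _ _ _ (C.lt_subset_tower hP i j) hx)
      (fun b hb => A.d_mem_adjSub _ _ _ _ (C.isStable_tower hδ hdd hP i j) hb)
      (C.d_wv_mem_tower hδ hdd hP i j)
      (by rw [← hins]; exact fun b hb => A.sgn_mem_adjSub _ _ _ _ hb)
      (C.adjGen_free_even' hδ hdd hwv (C.even_wv_deg hP i j)) hp.ne_zero ?_
      (C.odd_u_deg hk hP i j) (A.adjGen_mem _ _ _ _ _) (C.d_gen_u hδ hdd hP i j) ?_
    -- The integers `1, …, p - 1` are invertible because they are not divisible by the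
    -- characteristic.
    · intro m h1 h2 h0
      rw [ringChar.spec] at h0
      have := Nat.le_of_dvd h1 h0
      have := hp.pos
      omega
    · rw [← hins]
      exact C.adjGen_free_odd' hδ hdd hu

/-- Up to coboundaries, the cocycles that involve the generators with index at most `i` do not
involve those with index `i`. -/
theorem exists_eq_add_d_of_mem_lt_succ (hγ : ∀ i, C.γ i ∈ A.gr (k - 1)) (hk : 3 ≤ k)
    (i : Fin C.l) {x : (𝔼).carrier} (hx : x ∈ 𝔹 (ExtGen.lt _ _ (i + 1))) (hdx : (𝔼).d x = 0) :
    ∃ e ∈ 𝔹 (ExtGen.lt _ _ i), ∃ g, x = e + (𝔼).d g := by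
  by_cases hP : NeedsUV 𝕜 k
  · have hx' := A.adjSub_mono _ _ hδ hdd (ExtGen.lt_succ_subset_iUnion_tower hP i) hx
    -- A single element involves only finitely many generators, hence lies in a finite stage of the
    -- tower.
    obtain ⟨j, hj⟩ := A.exists_mem_sub_of_iUnion C.genDeg (ExtGen.tower_mono hP i) hx'
    obtain ⟨e, he, f, hf, g, -, -, hdf, rfl⟩ :=
      (C.isQuasiFree_tower hδ hdd hγ hk hP i j).1 x hj hdx
    -- The surviving term `d z · f` of stage `j` bounds `z f` once the next entry `z` of `wv` is
    -- available.
    refine ⟨e, he, 𝔤 (ExtGen.wv hP i j) * f + g, ?_⟩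
    rw [map_add, d_even_mul (C.even_wv_deg hP i j) (A.adjGen_mem _ _ _ _ _), hdf, mul_zero,
      add_zero, add_assoc]
  · have hx' := A.adjSub_mono _ _ hδ hdd (ExtGen.lt_succ_subset_of_not i hP) hx
    have hw : (ExtGen.w i : C.Gens) ∉ insert (.c i) (ExtGen.lt _ _ i) := by
      rintro (h | h)
      · cases h
      · exact lt_irrefl (i : ℕ) h
    rw [A.adjSub_insert] at hx'
    -- Without `u` and `v` there are two cases: for even `k` the characteristic is zero and all
    -- powers of `wᵢ` can be integrated; for odd `k`, `cᵢ - γᵢ` is an even cocycle with odd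
    -- primitive `wᵢ`.
    rcases Nat.even_or_odd k with hke | hko
    · have h0 : ringChar 𝕜 = 0 := by
        by_contra h0
        exact hP ⟨h0, hke⟩
      have hodd : Odd (k - 1) := Nat.Even.sub_odd (by omega) hke odd_one
      have heven : Even (C.genDeg (.w i)) :=
        (Nat.even_sub (show 2 ≤ k by omega)).2 (by simp [hke])
      have hwm := A.adjGen_mem C.genDeg C.dGen hδ hdd (.w i)
      have hfree := C.adjGen_free_even' hδ hdd hw heven
      refine (C.isQuasiFree_insert_c hδ hdd hγ hodd i).exists_of_charZero heven hwm
        (A.adjSub_mono _ _ _ _ (Set.subset_insert _ _))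
        (fun b hb => A.d_mem_adjSub _ _ _ _ (C.isStable_insert_c hδ hdd i) hb) ?_
        hfree ?_ hx' hdx
      · rw [d_gen_w]
        exact sub_mem (A.adjGen_mem_adjSub _ _ _ _ (Set.mem_insert _ _))
          (A.adjIncl_mem_adjSub _ _ _ _ _ _)
      · intro m hm h
        rw [ringChar.spec, h0, zero_dvd_iff] at h
        omega
    · have heven : Even (k - 1) := Nat.Odd.sub_odd hko odd_one
      have hodd : Odd (C.genDeg (.w i)) := Nat.Odd.sub_even (show 2 ≤ k by omega) hko even_two
      have hwm := A.adjGen_mem C.genDeg C.dGen hδ hdd (.w i)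
      have hcm := A.adjGen_mem C.genDeg C.dGen hδ hdd (.c i)
      have hγm := A.adjIncl_mem_adjSub C.genDeg C.dGen hδ hdd (ExtGen.lt _ _ i) (C.γ i)
      have hins := A.adjSub_insert_sub C.genDeg C.dGen hδ hdd (.c i) (ExtGen.lt _ _ i) hγm
      have hγd := A.adjIncl_mem C.genDeg C.dGen hδ hdd (hγ i)
      have hfree := A.adjGen_free_even C.genDeg C.dGen hδ hdd (C.c_notMem_lt i) heven hγm hγd
      rw [hins] at hx'
      refine exists_of_even_cocycle heven (sub_mem hcm hγd)
        (fun b hb => A.d_mem_adjSub _ _ _ _ (C.isStable_lt hδ hdd i) hb)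
        (C.d_gen_c_sub hδ hdd i)
        (by rw [← hins]; exact fun b hb => A.sgn_mem_adjSub _ _ _ _ hb)
        hfree hodd hwm (C.d_gen_w hδ hdd i) ?_ hx' hdx
      rw [← hins]
      exact C.adjGen_free_odd' hδ hdd hw

/-- Every cocycle of `Â` is cohomologous to a cocycle of `A`. -/
theorem exists_eq_incl_add_d (hγ : ∀ i, C.γ i ∈ A.gr (k - 1)) (hk : 3 ≤ k) {x : (𝔼).carrier}
    (hdx : (𝔼).d x = 0) : ∃ a, ∃ g, x = 𝔦 a + (𝔼).d g := by
  have key : ∀ i ≤ C.l, ∀ x ∈ 𝔹 (ExtGen.lt _ _ i), (𝔼).d x = 0 → ∃ a, ∃ g, x = 𝔦 a + (𝔼).d g := by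
    intro i
    induction i with
    | zero =>
      intro _ x hx _
      have h0 : ExtGen.lt C.l (NeedsUV 𝕜 k) 0 = ∅ := by
        ext y
        simp [ExtGen.lt]
      have hle : 𝔹 (ExtGen.lt _ _ 0) ≤ AlgHom.range 𝔦 := by
        rw [h0]
        refine Algebra.adjoin_le ?_
        rintro _ (⟨a, rfl⟩ | ⟨y, hy, rfl⟩)
        · exact ⟨a, rfl⟩
        · exact absurd hy (Set.notMem_empty y)
      obtain ⟨a, rfl⟩ := hle hx
      exact ⟨a, 0, by simp⟩
    | succ i ih =>
      intro hi x hx hdx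
      obtain ⟨e, he, g, rfl⟩ := C.exists_eq_add_d_of_mem_lt_succ hδ hdd hγ hk ⟨i, hi⟩ hx hdx
      rw [map_add, d_d, add_zero] at hdx
      obtain ⟨a, g', rfl⟩ := ih (by omega) e he hdx
      exact ⟨a, g' + g, by rw [map_add, add_assoc]⟩
  refine key C.l le_rfl x ?_ hdx
  have h1 : ExtGen.lt C.l (NeedsUV 𝕜 k) C.l = Set.univ := by
    ext y
    simp [ExtGen.lt]
  rw [h1]
  have h2 : x ∈ A.sub C.genDeg Set.univ := by
    rw [A.sub_univ]
    trivial
  exact h2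

end ObstructionChoice

end Tower

end CDGA

/-! ### Consequences of Poincaré duality, and existence of the choices. -/

namespace CDGA

section Cohomology

variable {𝕜 : Type u} [Field 𝕜] (A : CDGA.{u, v} 𝕜)

theorem cls_eq_zero_iff (z : A.cocycles) : A.cls z = 0 ↔ ∃ x, A.d x = z :=
  Ideal.Quotient.eq_zero_iff_mem

theorem cls_mem {i : ℕ} {z : A.cocycles} (hz : (z : A.carrier) ∈ A.gr i) :
    A.cls z ∈ A.cohomologyGr i := ⟨z, hz, rfl⟩

theorem exists_of_mem_cohomologyGr {i : ℕ} {x : A.Cohomology} (hx : x ∈ A.cohomologyGr i) :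
    ∃ z : A.cocycles, (z : A.carrier) ∈ A.gr i ∧ A.cls z = x := by
  obtain ⟨z, hz, rfl⟩ := hx
  exact ⟨z, hz, rfl⟩

theorem cls_surjective : Function.Surjective A.cls := Ideal.Quotient.mk_surjective

/-- The homogeneous components of a cocycle are cocycles. -/
theorem d_proj_of_cocycle {a : A.carrier} (ha : A.d a = 0) (i : ℕ) :
    A.d (GradedRing.proj A.gr i a) = 0 := by
  rw [← A.proj_d, ha, map_zero]

theorem mem_of_forall_cohomologyGr_le {V : Submodule 𝕜 A.Cohomology}
    (hV : ∀ i, A.cohomologyGr i ≤ V) (x : A.Cohomology) : x ∈ V := by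
  obtain ⟨z, rfl⟩ := A.cls_surjective x
  obtain ⟨s, hs⟩ := A.exists_sum_proj (z : A.carrier)
  have hz : z = ∑ i ∈ s, ⟨GradedRing.proj A.gr i z, A.d_proj_of_cocycle z.2 i⟩ := by
    exact Subtype.ext (hs.symm.trans (map_sum A.cocycles.val
      (fun i => (⟨GradedRing.proj A.gr i z, A.d_proj_of_cocycle z.2 i⟩ : A.cocycles)) s).symm)
  rw [hz, map_sum]
  exact sum_mem fun i _ => hV i (A.cls_mem (A.proj_mem i _))

end Cohomology

/-- In the dual of a finite-dimensional space, a subspace with trivial common kernel is everything,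
because it equals its double annihilator. -/
theorem surjective_of_separating {𝕜 V W : Type*} [Field 𝕜] [AddCommGroup V] [Module 𝕜 V]
    [Module.Finite 𝕜 V] [AddCommGroup W] [Module 𝕜 W] (Φ : W →ₗ[𝕜] Module.Dual 𝕜 V)
    (h : ∀ x, (∀ y, Φ y x = 0) → x = 0) : Function.Surjective Φ := by
  rw [← LinearMap.range_eq_top,
    ← Subspace.dualCoannihilator_dualAnnihilator_eq (W := LinearMap.range Φ),
    ← Submodule.dualAnnihilator_bot]
  congr 1
  rw [eq_bot_iff]
  intro x hx
  rw [Submodule.mem_dualCoannihilator] at hx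
  exact h x fun y => hx (Φ y) ⟨y, rfl⟩

section Reduced

variable {𝕜 : Type u} [Field 𝕜] {A : CDGA.{u, v} 𝕜} {n : ℕ} {ε : A.carrier →ₗ[𝕜] 𝕜}

/-- The functional of Poincaré duality is a non-zero multiple of the one induced by `ε`. -/
theorem IsReduced.exists_functional (hA : A.IsReduced n ε) :
    ∃ (e : A.Cohomology →ₗ[𝕜] 𝕜) (r : 𝕜), r ≠ 0 ∧
    (∀ z : A.cocycles, (z : A.carrier) ∈ A.gr n → e (A.cls z) = r * ε z) ∧
    (∀ i, ∀ x ∈ A.cohomologyGr i, (∀ j, i + j = n → ∀ y ∈ A.cohomologyGr j, e (x * y) = 0) →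
      x = 0) ∧
    (∀ j, ∀ y ∈ A.cohomologyGr j, (∀ i, i + j = n → ∀ x ∈ A.cohomologyGr i, e (x * y) = 0) →
      y = 0) := by
  obtain ⟨-, h0, e, -, h1, h2⟩ := hA.poincare
  obtain ⟨μ, hμ, hdμ, hεμ⟩ := hA.orientation.exists_cocycle
  -- The degree complementary to `n` is `0`, where the cohomology consists of scalars; so the top
  -- cohomology embeds in `𝕜` through `e`.
  have hn : ∀ y ∈ A.cohomologyGr n, e y = 0 → y = 0 := by
    intro y hy hey
    refine h2 n y hy fun i hi x hx => ?_
    have hi0 : i = 0 := by omega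
    subst hi0
    rw [h0, Submodule.mem_span_singleton] at hx
    obtain ⟨c, rfl⟩ := hx
    rw [smul_mul_assoc, one_mul, map_smul, hey, smul_zero]
  have hexact : ∀ z : A.cocycles, (z : A.carrier) ∈ A.gr n → e (A.cls z) = 0 → ε z = 0 := by
    intro z hz hez
    obtain ⟨x, hx⟩ := (A.cls_eq_zero_iff z).1 (hn _ (A.cls_mem hz) hez)
    rw [← hx, hA.orientation.map_d]
  have hr : e (A.cls ⟨μ, hdμ⟩) ≠ 0 := by
    intro h
    have := hexact ⟨μ, hdμ⟩ hμ h
    exact _root_.one_ne_zero (hεμ.symm.trans this)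
  refine ⟨e, e (A.cls ⟨μ, hdμ⟩), hr, ?_, h1, h2⟩
  intro z hz
  -- The multiple of `μ` is chosen so that `e` kills the difference, which is then exact and killed
  -- by `ε`. Hence the ratio is `r = e [μ]`.
  have h := hexact (z - (e (A.cls z) * (e (A.cls ⟨μ, hdμ⟩))⁻¹) • ⟨μ, hdμ⟩)
    (sub_mem hz (Submodule.smul_mem _ _ hμ)) (by
      rw [map_sub, map_smul, map_sub, map_smul, smul_eq_mul, mul_assoc, inv_mul_cancel₀ hr,
        mul_one, sub_self])
  have h' : ε (z - (e (A.cls z) * (e (A.cls ⟨μ, hdμ⟩))⁻¹) • μ) = 0 := h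
  rw [map_sub, map_smul, hεμ, sub_eq_zero, smul_eq_mul, mul_one] at h'
  rw [h', mul_comm, mul_assoc, inv_mul_cancel₀ hr, mul_one]

/-- A homogeneous cocycle that is orthogonal to all cocycles is a coboundary. -/
theorem IsReduced.exists_d_eq (hA : A.IsReduced n ε) {i : ℕ} {a : A.carrier}
    (ha : a ∈ A.gr (i + 1)) (hda : A.d a = 0) (h : ∀ b, A.d b = 0 → ε (a * b) = 0) :
    ∃ x ∈ A.gr i, A.d x = a := by
  obtain ⟨e, r, -, he, h1, -⟩ := hA.exists_functional
  have hc : A.cls ⟨a, hda⟩ = 0 := by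
    refine h1 (i + 1) _ (A.cls_mem ha) fun j hj y hy => ?_
    obtain ⟨b, hb, rfl⟩ := A.exists_of_mem_cohomologyGr hy
    have hab : a * b ∈ A.gr n := hj ▸ SetLike.mul_mem_graded ha hb
    rw [← map_mul, he _ hab]
    change r * ε (a * b) = 0
    rw [h _ b.2, mul_zero]
  obtain ⟨x, hx⟩ := (A.cls_eq_zero_iff _).1 hc
  exact A.exists_homogeneous_d ha hx

theorem finite_cohomologyGr (hA : A.IsReduced n ε) (i : ℕ) :
    Module.Finite 𝕜 (A.cohomologyGr i) := by
  have := hA.finite_type i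
  have hle : A.cohomologyGr i ≤ A.cohomologyGr i := le_rfl
  have hfin : Module.Finite 𝕜 ((A.gr i).comap A.cocycles.val.toLinearMap) := by
    let f : (A.gr i).comap A.cocycles.val.toLinearMap →ₗ[𝕜] A.gr i :=
      { toFun := fun z => ⟨(z : A.cocycles), z.2⟩
        map_add' := fun _ _ => rfl
        map_smul' := fun _ _ => rfl }
    refine Module.Finite.of_injective f fun x y hxy => ?_
    have h := congrArg Subtype.val hxy
    exact Subtype.ext (Subtype.ext h)
  exact Module.Finite.map _ _

/-- A functional on a component of the cohomology is the product with a cocycle. -/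
theorem IsReduced.exists_cocycle_of_functional (hA : A.IsReduced n ε) {i j : ℕ} (hij : i + j = n)
    (φ : A.cohomologyGr j →ₗ[𝕜] 𝕜) : ∃ z : A.cocycles, (z : A.carrier) ∈ A.gr i ∧
      ∀ b : A.cocycles, ∀ hb : (b : A.carrier) ∈ A.gr j,
        ε ((z : A.carrier) * b) = φ ⟨A.cls b, A.cls_mem hb⟩ := by
  obtain ⟨e, r, hr, he, -, h2⟩ := hA.exists_functional
  have := finite_cohomologyGr hA j
  let Φ : A.cohomologyGr i →ₗ[𝕜] Module.Dual 𝕜 (A.cohomologyGr j) :=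
    LinearMap.mk₂ 𝕜 (fun y x => e ((y : A.Cohomology) * x))
      (fun y y' x => by rw [Submodule.coe_add, add_mul, map_add])
      (fun c y x => by rw [Submodule.coe_smul, smul_mul_assoc, map_smul])
      (fun y x x' => by rw [Submodule.coe_add, mul_add, map_add])
      (fun c y x => by rw [Submodule.coe_smul, mul_smul_comm, map_smul])
  have hΦ : Function.Surjective Φ := by
    refine surjective_of_separating Φ fun x hx => ?_
    rw [← Submodule.coe_eq_zero]
    refine h2 j x x.2 fun i' hi' y hy => ?_
    have hii : i' = i := by omega
    subst hii
    exact hx ⟨y, hy⟩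
  -- The factor `r` compensates for `e = r ε` on classes of degree `n`.
  obtain ⟨y, hy⟩ := hΦ (r • φ)
  obtain ⟨z, hz, hzy⟩ := A.exists_of_mem_cohomologyGr y.2
  refine ⟨z, hz, fun b hb => ?_⟩
  have h3 := LinearMap.congr_fun hy ⟨A.cls b, A.cls_mem hb⟩
  change e ((y : A.Cohomology) * A.cls b) = r * φ _ at h3
  have hzb : ((z * b : A.cocycles) : A.carrier) ∈ A.gr n :=
    hij ▸ SetLike.mul_mem_graded hz hb
  rw [← hzy, ← map_mul, he _ hzb] at h3
  exact mul_left_cancel₀ hr h3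

/-- An orphan is in particular orthogonal to all cocycles. This supplies the primitives `γ'`. -/
theorem orphan_cocycle_exists_d (hA : A.IsReduced n ε) {i : ℕ} (hi : i ≠ 0) {a : A.carrier}
    (ha : a ∈ A.gr i) (hda : A.d a = 0) (ho : a ∈ A.orphans ε) : ∃ x ∈ A.gr (i - 1), A.d x = a := by
  obtain ⟨j, rfl⟩ := Nat.exists_eq_succ_of_ne_zero hi
  exact hA.exists_d_eq ha hda fun b _ => ho b

/-- Above degree `n` there is no complementary degree, so every class satisfies the orthogonality
condition vacuously. -/
theorem cohomologyGr_eq_bot (hA : A.IsReduced n ε) {i : ℕ} (hi : n < i) : A.cohomologyGr i = ⊥ := by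
  obtain ⟨e, r, -, -, h1, -⟩ := hA.exists_functional
  rw [eq_bot_iff]
  intro x hx
  exact h1 i x hx fun j hj => by omega

/-- The dual cocycles represent, through the pairing, the coordinate functionals of bases of the
components of the cohomology. -/
theorem exists_dual_bases (hA : A.IsReduced n ε) : ∃ (m : ℕ) (hdeg : Fin m → ℕ)
    (h hstar : Fin m → A.cocycles), (∀ j, (h j : A.carrier) ∈ A.gr (hdeg j)) ∧
    (LinearIndependent 𝕜 fun j => A.cls (h j)) ∧
    Submodule.span 𝕜 (Set.range fun j => A.cls (h j)) = ⊤ ∧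
    (∀ j, ∃ e, e + hdeg j = n ∧ (hstar j : A.carrier) ∈ A.gr e) ∧
    ∀ i j, ε ((hstar j : A.carrier) * (h i : A.carrier)) = if i = j then 1 else 0 := by
  classical
  have := finite_cohomologyGr hA
  have : ∀ i, Module.Free 𝕜 (A.cohomologyGr i) := fun i => Module.Free.of_divisionRing 𝕜 _
  -- Only the degrees up to `n` carry cohomology, so the index set is finite.
  let ι := Σ i : Fin (n + 1), Fin (Module.finrank 𝕜 (A.cohomologyGr i))
  let b (i : ℕ) := Module.finBasis 𝕜 (A.cohomologyGr i)
  have hz : ∀ x : ι, ∃ z : A.cocycles, (z : A.carrier) ∈ A.gr x.1 ∧ A.cls z = b x.1 x.2 :=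
    fun x => A.exists_of_mem_cohomologyGr (b x.1 x.2).2
  choose z hz1 hz2 using hz
  have hs : ∀ x : ι, ∃ s : A.cocycles, (s : A.carrier) ∈ A.gr (n - x.1) ∧
      ∀ c : A.cocycles, ∀ hc : (c : A.carrier) ∈ A.gr x.1,
        ε ((s : A.carrier) * c) = (b x.1).coord x.2 ⟨A.cls c, A.cls_mem hc⟩ :=
    fun x => hA.exists_cocycle_of_functional (Nat.sub_add_cancel (Nat.lt_succ_iff.1 x.1.2)) _
  choose s hs1 hs2 using hs
  have hdual : ∀ x y : ι, ε ((s y : A.carrier) * (z x : A.carrier)) = if x = y then 1 else 0 := by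
    rintro ⟨i, p⟩ ⟨j, q⟩
    by_cases hij : i = j
    · subst hij
      rw [hs2 ⟨i, q⟩ (z ⟨i, p⟩) (hz1 ⟨i, p⟩)]
      have h1 : (⟨A.cls (z ⟨i, p⟩), A.cls_mem (hz1 ⟨i, p⟩)⟩ : A.cohomologyGr i) = b i p :=
        Subtype.ext (hz2 ⟨i, p⟩)
      rw [h1, Module.Basis.coord_apply, Module.Basis.repr_self, Finsupp.single_apply]
      congr 1
      simp [ι]
    · rw [if_neg (fun h => hij (congrArg Sigma.fst h))]
      refine hA.orientation.eq_zero_of_ne _ ?_ _ (SetLike.mul_mem_graded (hs1 _) (hz1 _))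
      have h1 : (i : ℕ) ≠ j := fun h => hij (Fin.ext h)
      have h2 := i.2
      have h3 := j.2
      dsimp only
      omega
  let eq := Fintype.equivFin ι
  refine ⟨Fintype.card ι, fun j => (eq.symm j).1, fun j => z (eq.symm j), fun j => s (eq.symm j),
    fun j => hz1 _, ?_, ?_, fun j => ⟨n - (eq.symm j).1,
      Nat.sub_add_cancel (Nat.lt_succ_iff.1 (eq.symm j).1.2), hs1 _⟩, fun i j => ?_⟩
  · rw [Fintype.linearIndependent_iff]
    intro g hg j
    -- Pairing a linear relation with the `j`-th dual cocycle isolates the `j`-th coefficient, as a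
    -- cocycle times a coboundary is exact.
    have h1 : A.cls (∑ i, g i • z (eq.symm i)) = 0 := by
      rw [map_sum, ← hg]
      exact Finset.sum_congr rfl fun i _ => map_smul _ _ _
    obtain ⟨x, hx⟩ := (A.cls_eq_zero_iff _).1 h1
    have h2 : ε ((s (eq.symm j) : A.carrier) * A.d x) = 0 := by
      obtain ⟨y, hy⟩ := A.exists_d_eq_cocycle_mul (s (eq.symm j)) x (s (eq.symm j)).2
      rw [← hy, hA.orientation.map_d]
    have h3 : ((∑ i, g i • z (eq.symm i) : A.cocycles) : A.carrier) =
        ∑ i, g i • (z (eq.symm i) : A.carrier) := by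
      simp
    rw [hx, h3, Finset.mul_sum, map_sum, Finset.sum_eq_single j] at h2
    · rw [mul_smul_comm, map_smul, hdual, if_pos rfl, smul_eq_mul, mul_one] at h2
      exact h2
    · intro i _ hij
      rw [mul_smul_comm, map_smul, hdual, if_neg (fun h => hij (eq.symm.injective h)), smul_zero]
    · intro h
      exact absurd (Finset.mem_univ j) h
  · rw [eq_top_iff]
    intro x _
    refine A.mem_of_forall_cohomologyGr_le (fun i => ?_) x
    by_cases hi : n < i
    · rw [cohomologyGr_eq_bot hA hi]
      exact bot_le
    · intro y hy
      have h1 := (b i).sum_repr ⟨y, hy⟩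
      have h2 := congrArg Subtype.val h1
      rw [Submodule.coe_sum] at h2
      change _ = y at h2
      rw [← h2]
      refine sum_mem fun p _ => ?_
      rw [Submodule.coe_smul]
      refine Submodule.smul_mem _ _ (Submodule.subset_span
        ⟨eq ⟨⟨i, by omega⟩, p⟩, ?_⟩)
      change A.cls (z (eq.symm (eq _))) = _
      rw [Equiv.symm_apply_apply, hz2]
  · rw [hdual]
    congr 1
    simp

theorem nonempty_obstructionChoice (hA : A.IsReduced n ε) {k : ℕ} (hk : 3 ≤ k) :
    Nonempty (ObstructionChoice A n ε k) := by
  have hle : (A.orphans ε ⊓ A.gr (k - 1)).map A.d ≤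
      A.orphans ε ⊓ A.gr k ⊓ LinearMap.ker A.d := by
    rintro _ ⟨a, ⟨ha, hak⟩, rfl⟩
    refine ⟨⟨d_mem_orphans hA.orientation ha, ?_⟩, A.d_d a⟩
    have := A.d_mem hak
    rwa [Nat.sub_add_cancel (by omega)] at this
  obtain ⟨W, hW1, hW2⟩ := A.exists_relative_complement hle
  have hWle : W ≤ A.orphans ε ⊓ A.gr k ⊓ LinearMap.ker A.d := le_sup_left.trans hW2.le
  have hfin : Module.Finite 𝕜 W := by
    have := hA.finite_type k
    exact Submodule.finiteDimensional_of_le (hWle.trans (inf_le_left.trans inf_le_right))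
  let b := Module.finBasis 𝕜 W
  have hspan : Submodule.span 𝕜 (Set.range fun i => (b i : A.carrier)) = W := by
    have h1 : (Set.range fun i => (b i : A.carrier)) = W.subtype '' Set.range b := by
      rw [← Set.range_comp]
      rfl
    rw [h1, Submodule.span_image, b.span_eq, Submodule.map_top, Submodule.range_subtype]
  have hγ : ∀ i, ∃ x ∈ A.gr (k - 1), A.d x = b i := by
    intro i
    obtain ⟨⟨h1, h2⟩, h3⟩ := hWle (b i).2
    exact orphan_cocycle_exists_d hA (by omega) h2 h3 h1
  choose γ' hγ1 hγ2 using hγ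
  obtain ⟨m, hdeg, h, hstar, h1, h2, h3, h4, h5⟩ := exists_dual_bases hA
  exact ⟨{
    l := _
    α := fun i => b i
    linearIndependent_α := b.linearIndependent.map' W.subtype (Submodule.ker_subtype W)
    disjoint_α := by rw [hspan]; exact hW1.symm
    sup_α := by rw [hspan, sup_comm]; exact hW2
    γ' := γ'
    γ'_mem := hγ1
    d_γ' := hγ2
    m := m
    hdeg := hdeg
    h := h
    h_mem := h1
    linearIndependent_h := h2
    span_h := h3
    hstar := hstar
    hstar_mem := h4
    dual := h5 }⟩

theorem nonempty_extensionChoice (hA : A.IsReduced n ε) {k : ℕ} (hk : 3 ≤ k) :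
    Nonempty (ExtensionChoice A n ε k) := by
  obtain ⟨C⟩ := nonempty_obstructionChoice hA hk
  obtain ⟨Z, hZ1, hZ2, hZ3⟩ := A.exists_graded_complement
    (IsGradedSubspace.inf A (isGradedSubspace_orphans hA.orientation) A.isGradedSubspace_range_d)
    (isGradedSubspace_orphans hA.orientation) inf_le_left
  obtain ⟨U, hU1, hU2, hU3⟩ := A.exists_graded_complement
    (IsGradedSubspace.sup A (IsGradedSubspace.sup A hZ1
      (A.isGradedSubspace_span (C.γ_mem hA.orientation))) A.isGradedSubspace_range_d)
    (W₂ := ⊤) (fun _ _ _ => trivial) le_top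
  exact ⟨{
    toObstructionChoice := C
    Z := Z
    graded_Z := hZ1
    disjoint_Z := hZ2
    sup_Z := hZ3
    U := U
    graded_U := hU1
    isCompl_U := ⟨hU2.symm, by rw [codisjoint_iff, sup_comm]; exact hU3⟩ }⟩

end Reduced

end CDGA

/-! ### The monomials of `Â` in degrees up to `n`. -/

namespace CDGA

section Monomials

variable {𝕜 : Type u} [Field 𝕜] {A : CDGA.{u, v} 𝕜} {n : ℕ} {ε : A.carrier →ₗ[𝕜] 𝕜} {k : ℕ}

theorem IsReduced.exists_smul_one (hA : A.IsReduced n ε) {a : A.carrier} (ha : a ∈ A.gr 0) :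
    ∃ r : 𝕜, a = r • (1 : A.carrier) := by
  rw [hA.gr_zero, Submodule.mem_span_singleton] at ha
  obtain ⟨r, hr⟩ := ha
  exact ⟨r, hr.symm⟩

theorem IsReduced.d_gr_zero (hA : A.IsReduced n ε) {a : A.carrier} (ha : a ∈ A.gr 0) :
    A.d a = 0 := by
  obtain ⟨r, rfl⟩ := hA.exists_smul_one ha
  rw [map_smul, A.d_one, smul_zero]

theorem IsReduced.eq_zero_of_mem_gr_one (hA : A.IsReduced n ε) {a : A.carrier} (ha : a ∈ A.gr 1) :
    a = 0 := by
  rwa [hA.gr_one] at ha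

theorem IsReduced.d_eq_zero_of_le_two (hA : A.IsReduced n ε) {i : ℕ} (hi : i ≤ 2) {a : A.carrier}
    (ha : a ∈ A.gr i) : A.d a = 0 := by
  interval_cases i
  · exact hA.d_gr_zero ha
  · rw [hA.eq_zero_of_mem_gr_one ha, map_zero]
  · exact hA.gr_two a ha

theorem proj_zero_add_positive (a : A.carrier) :
    ∃ ξ ∈ A.positive, ∃ a₀ ∈ A.gr 0, a = ξ + a₀ := by
  refine A.mem_induction (P := fun a => ∃ ξ ∈ A.positive, ∃ a₀ ∈ A.gr 0, a = ξ + a₀) a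
    ⟨0, zero_mem _, 0, zero_mem _, by simp⟩ ?_ ?_
  · intro i x hx
    by_cases hi : i = 0
    · subst hi
      exact ⟨0, zero_mem _, x, hx, by simp⟩
    · exact ⟨x, A.positive_of_mem hi hx, 0, zero_mem _, by simp⟩
  · rintro x y ⟨ξ, hξ, a, ha, rfl⟩ ⟨ξ', hξ', a', ha', rfl⟩
    exact ⟨ξ + ξ', add_mem hξ hξ', a + a', add_mem ha ha', by abel⟩

namespace ObstructionChoice

variable (C : ObstructionChoice A n ε k) (hA : A.IsReduced n ε) (hk : n + 2 ≤ 2 * k)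

theorem d_emb (a : A.carrier) :
    (C.extension hA hk).d (C.emb hA hk a) = C.emb hA hk (A.d a) := A.freeD_incl _ _ _ a

theorem d_c (i : Fin C.l) :
    (C.extension hA hk).d (C.c hA hk i) = C.emb hA hk (C.α i) := A.freeD_gen _ _ _ _

theorem d_w (i : Fin C.l) :
    (C.extension hA hk).d (C.w hA hk i) = C.c hA hk i - C.emb hA hk (C.γ i) := A.freeD_gen _ _ _ _

theorem d_u₁ (hP : NeedsUV 𝕜 k) (i : Fin C.l) :
    (C.extension hA hk).d (C.u₁ hA hk hP i) = C.w hA hk i ^ ringChar 𝕜 := A.freeD_gen _ _ _ _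

theorem d_v₁ (hP : NeedsUV 𝕜 k) (i : Fin C.l) : (C.extension hA hk).d (C.v₁ hA hk hP i) =
    (C.c hA hk i - C.emb hA hk (C.γ i)) * C.w hA hk i ^ (ringChar 𝕜 - 1) := A.freeD_gen _ _ _ _

theorem emb_mem {j : ℕ} {a : A.carrier} (ha : a ∈ A.gr j) :
    C.emb hA hk a ∈ (C.extension hA hk).gr j := A.incl_mem _ ha

theorem c_mem (i : Fin C.l) : C.c hA hk i ∈ (C.extension hA hk).gr (k - 1) :=
  A.gen_mem C.genDeg (.c i)

theorem w_mem (i : Fin C.l) : C.w hA hk i ∈ (C.extension hA hk).gr (k - 2) :=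
  A.gen_mem C.genDeg (.w i)

theorem u₁_mem (hP : NeedsUV 𝕜 k) (i : Fin C.l) : C.u₁ hA hk hP i ∈
    (C.extension hA hk).gr (ringChar 𝕜 ^ (0 + 1) * (k - 2) - 1) :=
  A.gen_mem C.genDeg (.u hP i 0)

theorem v₁_mem (hP : NeedsUV 𝕜 k) (i : Fin C.l) : C.v₁ hA hk hP i ∈
    (C.extension hA hk).gr (ringChar 𝕜 ^ (0 + 1) * (k - 2)) :=
  A.gen_mem C.genDeg (.v hP i 0)

theorem emb_injective : Function.Injective (C.emb hA hk) := A.incl_injective C.genDeg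

/-- The products of generators and an element of `A` that may have degree at most `n`. -/
inductive LowMonomial : ℕ → (C.extension hA hk).carrier → Prop
  | emb {j : ℕ} {a : A.carrier} (ha : a ∈ A.gr j) : LowMonomial j (C.emb hA hk a)
  | w (i : Fin C.l) {j : ℕ} {a : A.carrier} (ha : a ∈ A.gr j) :
      LowMonomial (k - 2 + j) (C.w hA hk i * C.emb hA hk a)
  | c (i : Fin C.l) {j : ℕ} {a : A.carrier} (ha : a ∈ A.gr j) :
      LowMonomial (k - 1 + j) (C.c hA hk i * C.emb hA hk a)
  | ww (i i' : Fin C.l) {j : ℕ} {a : A.carrier} (ha : a ∈ A.gr j) :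
      LowMonomial (k - 2 + (k - 2) + j) (C.w hA hk i * C.w hA hk i' * C.emb hA hk a)
  | cw (i i' : Fin C.l) {j : ℕ} {a : A.carrier} (ha : a ∈ A.gr j) :
      LowMonomial (k - 1 + (k - 2) + j) (C.c hA hk i * C.w hA hk i' * C.emb hA hk a)
  | cc (i i' : Fin C.l) {j : ℕ} {a : A.carrier} (ha : a ∈ A.gr j) :
      LowMonomial (k - 1 + (k - 1) + j) (C.c hA hk i * C.c hA hk i' * C.emb hA hk a)
  | u (hP : NeedsUV 𝕜 k) (hp : ringChar 𝕜 = 2) (i : Fin C.l) {j : ℕ} {a : A.carrier}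
      (ha : a ∈ A.gr j) : LowMonomial (2 * (k - 2) - 1 + j) (C.u₁ hA hk hP i * C.emb hA hk a)
  | v (hP : NeedsUV 𝕜 k) (hp : ringChar 𝕜 = 2) (i : Fin C.l) {j : ℕ} {a : A.carrier}
      (ha : a ∈ A.gr j) : LowMonomial (2 * (k - 2) + j) (C.v₁ hA hk hP i * C.emb hA hk a)

/-- From `n ≥ 7` follows `k ≥ 5`, and evenness of `k` raises the bound by one. -/
theorem six_le_of_needsUV (hA : A.IsReduced n ε) (hk : n + 2 ≤ 2 * k) (hP : NeedsUV 𝕜 k) :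
    6 ≤ k := by
  have := hA.seven_le
  obtain ⟨r, hr⟩ := hP.2
  omega

theorem two_le_pow_ringChar (hP : NeedsUV 𝕜 k) (j : ℕ) : 2 ≤ ringChar 𝕜 ^ (j + 1) := by
  have hp : (ringChar 𝕜).Prime :=
      (CharP.char_is_prime_or_zero 𝕜 (ringChar 𝕜)).resolve_right hP.1
  exact hp.two_le.trans (Nat.le_self_pow (Nat.succ_ne_zero j) _)

theorem three_le_pow_ringChar (hP : NeedsUV 𝕜 k) (j : ℕ) (h : ¬ (ringChar 𝕜 = 2 ∧ j = 0)) :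
    3 ≤ ringChar 𝕜 ^ (j + 1) := by
  have hp : (ringChar 𝕜).Prime :=
      (CharP.char_is_prime_or_zero 𝕜 (ringChar 𝕜)).resolve_right hP.1
  by_cases h2 : ringChar 𝕜 = 2
  · obtain ⟨j', rfl⟩ := Nat.exists_eq_succ_of_ne_zero (fun hj => h ⟨h2, hj⟩)
    rw [h2]
    have : 2 ^ (0 + 2) ≤ 2 ^ (j' + 1 + 1) := Nat.pow_le_pow_right (by omega) (by omega)
    omega
  · have := hp.two_le
    have h3 : 3 ≤ ringChar 𝕜 := by omega
    exact h3.trans (Nat.le_self_pow (Nat.succ_ne_zero j) _)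

include hA hk in
theorem le_genDeg (x : C.Gens) : k - 2 ≤ C.genDeg x := by
  have h3 := hA.three_le hk
  cases x with
  | c i => exact Nat.sub_le_sub_left (by omega) k
  | w i => exact le_rfl
  | u hP i j =>
    have h1 := Nat.mul_le_mul_right (k - 2) (two_le_pow_ringChar hP j)
    simp only [ExtGen.deg]
    omega
  | v hP i j =>
    have h1 := Nat.mul_le_mul_right (k - 2) (two_le_pow_ringChar hP j)
    simp only [ExtGen.deg]
    omega

theorem span_congr_degree {N M : ℕ} (h : N = M) {x : (C.extension hA hk).carrier}
    (hx : C.LowMonomial hA hk N x) : x ∈ Submodule.span 𝕜 {x | C.LowMonomial hA hk M x} := by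
  subst h
  exact Submodule.subset_span hx

/-- Every generator has degree at least `k - 2 ≥ n/2 - 1`, so three of them exceed `n`; this needs
`n ≥ 7`. A generator `u` or `v` has degree at least `p^(j+1) (k - 2) - 1`, which is too large unless
`p = 2` and the generator is the first of its kind, and next to another generator it is always too
large. -/
theorem gr_le_span_lowMonomial {N : ℕ} (hN : N ≤ n) :
    (C.extension hA hk).gr N ≤ Submodule.span 𝕜 {x | C.LowMonomial hA hk N x} := by
  have h7 := hA.seven_le
  refine (A.freeGr_le_span C.genDeg N).trans (Submodule.span_le.2 ?_)
  rintro _ ⟨G, j, a, ha, hw, rfl⟩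
  rcases G with _ | ⟨x, _ | ⟨y, _ | ⟨z, G⟩⟩⟩
  · have h1 := C.span_congr_degree hA hk (M := N) (by simpa using hw) (LowMonomial.emb ha)
    rw [List.map_nil, List.prod_nil, one_mul]
    exact h1
  · simp only [List.map_cons, List.map_nil, List.sum_cons, List.sum_nil, add_zero] at hw
    simp only [List.map_cons, List.map_nil, List.prod_cons, List.prod_nil, mul_one]
    cases x with
    | c i => exact C.span_congr_degree hA hk hw (LowMonomial.c i ha)
    | w i => exact C.span_congr_degree hA hk hw (LowMonomial.w i ha)
    | u hP i t =>
      have h6 := six_le_of_needsUV hA hk hP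
      by_cases ht : ringChar 𝕜 = 2 ∧ t = 0
      · obtain ⟨h2, rfl⟩ := ht
        refine C.span_congr_degree hA hk ?_ (LowMonomial.u hP h2 i ha)
        rw [← hw]
        simp [ExtGen.deg, h2]
      · have h1 := Nat.mul_le_mul_right (k - 2) (three_le_pow_ringChar hP t ht)
        simp only [ExtGen.deg] at hw
        omega
    | v hP i t =>
      have h6 := six_le_of_needsUV hA hk hP
      by_cases ht : ringChar 𝕜 = 2 ∧ t = 0
      · obtain ⟨h2, rfl⟩ := ht
        refine C.span_congr_degree hA hk ?_ (LowMonomial.v hP h2 i ha)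
        rw [← hw]
        simp [ExtGen.deg, h2]
      · have h1 := Nat.mul_le_mul_right (k - 2) (three_le_pow_ringChar hP t ht)
        simp only [ExtGen.deg] at hw
        omega
  · simp only [List.map_cons, List.map_nil, List.sum_cons, List.sum_nil, add_zero] at hw
    simp only [List.map_cons, List.map_nil, List.prod_cons, List.prod_nil, mul_one]
    have hbig : ∀ (hP : NeedsUV 𝕜 k) (i : Fin C.l) (t : ℕ),
        n < C.genDeg (.u hP i t) + (k - 2) ∧ n < C.genDeg (.v hP i t) + (k - 2) := by
      intro hP i t
      have h6 := six_le_of_needsUV hA hk hP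
      have h1 := Nat.mul_le_mul_right (k - 2) (two_le_pow_ringChar hP t)
      simp only [ExtGen.deg]
      omega
    have hx := C.le_genDeg hA hk x
    have hy := C.le_genDeg hA hk y
    cases x with
    | c i =>
      cases y with
      | c i' => exact C.span_congr_degree hA hk hw (LowMonomial.cc i i' ha)
      | w i' => exact C.span_congr_degree hA hk hw (LowMonomial.cw i i' ha)
      | u hP i' t => have := (hbig hP i' t).1; omega
      | v hP i' t => have := (hbig hP i' t).2; omega
    | w i =>
      cases y with
      | c i' =>
        have h1 := A.gen_mul_gen C.genDeg (.w i) (.c i')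
        have h2 := C.span_congr_degree hA hk (M := N) (by rw [← hw, add_comm (C.genDeg (.w i))]; rfl)
          (LowMonomial.cw i' i ha)
        rw [h1, smul_mul_assoc]
        exact Submodule.smul_mem _ _ h2
      | w i' => exact C.span_congr_degree hA hk hw (LowMonomial.ww i i' ha)
      | u hP i' t => have := (hbig hP i' t).1; omega
      | v hP i' t => have := (hbig hP i' t).2; omega
    | u hP i t => have := (hbig hP i t).1; omega
    | v hP i t => have := (hbig hP i t).2; omega
  · have hx := C.le_genDeg hA hk x
    have hy := C.le_genDeg hA hk y
    have hz := C.le_genDeg hA hk z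
    simp only [List.map_cons, List.sum_cons] at hw
    omega

end ObstructionChoice

end Monomials

end CDGA

/-! ### The extended orientation: orthogonality of the `γᵢ`, uniqueness, vanishing on coboundaries.
-/

namespace CDGA

section ExtendedOrientation

variable {𝕜 : Type u} [Field 𝕜] {A : CDGA.{u, v} 𝕜} {n : ℕ} {ε : A.carrier →ₗ[𝕜] 𝕜} {k : ℕ}

/-- Integration by parts. -/
theorem ε_mul_d (hε : A.IsOrientation n ε) {i : ℕ} {a : A.carrier} (ha : a ∈ A.gr i)
    (b : A.carrier) : ε (a * A.d b) = -(-1 : 𝕜) ^ i * ε (A.d a * b) := by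
  have h := hε.map_d (a * b)
  rw [A.leibniz b ha, map_add, map_smul, smul_eq_mul] at h
  have h2 := congrArg (fun t => (-1 : 𝕜) ^ i * t) h
  simp only [mul_add, mul_zero, ← mul_assoc, neg_one_pow_mul_self, one_mul] at h2
  rw [eq_neg_of_add_eq_zero_right h2]
  ring

namespace ObstructionChoice

variable (C : ObstructionChoice A n ε k)

theorem α_mem_orphans (i : Fin C.l) : C.α i ∈ A.orphans ε := (C.α_mem_inf i).1.1

/-- The elements `γᵢ` are orthogonal to all cocycles. -/
theorem ε_γ_mul_cocycle (hε : A.IsOrientation n ε) (i : Fin C.l) {z : A.carrier}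
    (hz : A.d z = 0) : ε (C.γ i * z) = 0 := by
  -- Integration by parts moves the differential to `γᵢ`, and `d γᵢ = αᵢ` is an orphan.
  have hd : ∀ x, ε (C.γ i * A.d x) = 0 := by
    intro x
    rw [ε_mul_d hε (C.γ_mem hε i), C.d_γ, C.α_mem_orphans i x, mul_zero]
  -- This is the purpose of the correction term in `γᵢ`. Cocycles are combinations of the `hⱼ` up to
  -- coboundaries, so `hd` and `hh` suffice.
  have hh : ∀ j, ε (C.γ i * C.h j) = 0 := by
    intro j
    rw [γ, sub_mul, map_sub, Finset.sum_mul, map_sum, Finset.sum_eq_single j]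
    · rw [smul_mul_assoc, map_smul, C.dual, if_pos rfl, smul_eq_mul, mul_one, sub_self]
    · intro b _ hb
      rw [smul_mul_assoc, map_smul, C.dual, if_neg hb.symm, smul_zero]
    · intro h
      exact absurd (Finset.mem_univ j) h
  have hcls : A.cls ⟨z, hz⟩ ∈ Submodule.span 𝕜 (Set.range fun j => A.cls (C.h j)) := by
    rw [C.span_h]
    trivial
  obtain ⟨r, hr⟩ := (Submodule.mem_span_range_iff_exists_fun 𝕜).1 hcls
  have h0 : A.cls (⟨z, hz⟩ - ∑ j, r j • C.h j) = 0 := by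
    rw [map_sub, ← hr, map_sum, sub_eq_zero]
    exact Finset.sum_congr rfl fun j _ => (map_smul _ _ _).symm
  obtain ⟨x, hx⟩ := (A.cls_eq_zero_iff _).1 h0
  have hz' : z = A.d x + ∑ j, r j • (C.h j : A.carrier) := by
    rw [hx]
    simp
  rw [hz', mul_add, map_add, hd, zero_add, Finset.mul_sum, map_sum]
  exact Finset.sum_eq_zero fun j _ => by rw [mul_smul_comm, map_smul, hh, smul_zero]

/-- The combinations of the `αᵢ` that are differentials of orphans are trivial. -/
theorem eq_zero_of_sum_α (r : Fin C.l → 𝕜) {o : A.carrier} (ho : o ∈ A.orphans ε)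
    (hok : o ∈ A.gr (k - 1)) (h : A.d o + ∑ i, r i • C.α i = 0) (i : Fin C.l) : r i = 0 := by
  have h1 : ∑ i, r i • C.α i ∈ Submodule.span 𝕜 (Set.range C.α) :=
    sum_mem fun i _ => Submodule.smul_mem _ _ (Submodule.subset_span ⟨i, rfl⟩)
  have h2 : ∑ i, r i • C.α i ∈ (A.orphans ε ⊓ A.gr (k - 1)).map A.d := by
    rw [← neg_eq_of_add_eq_zero_right h, ← map_neg]
    exact ⟨-o, ⟨neg_mem ho, neg_mem hok⟩, rfl⟩
  exact Fintype.linearIndependent_iff.1 C.linearIndependent_α r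
    (Submodule.disjoint_def.1 C.disjoint_α _ h2 h1) i

end ObstructionChoice

namespace ExtensionChoice

variable (C : ExtensionChoice A n ε k)

theorem γ_mem_T (i : Fin C.l) : C.γ i ∈ C.T :=
  Submodule.mem_sup_left (Submodule.mem_sup_right (Submodule.subset_span ⟨i, rfl⟩))

theorem Z_le_T : C.Z ≤ C.T := le_sup_left.trans le_sup_left

theorem Z_le_orphans : C.Z ≤ A.orphans ε := le_sup_left.trans C.sup_Z.le

theorem isGradedSubspace_T (hε : A.IsOrientation n ε) : A.IsGradedSubspace C.T :=
  IsGradedSubspace.sup A (IsGradedSubspace.sup A C.graded_Z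
    (A.isGradedSubspace_span (C.γ_mem hε))) C.graded_U

theorem T_sup_range_d : C.T ⊔ LinearMap.range A.d = ⊤ := by
  rw [← C.isCompl_U.sup_eq_top, T, sup_right_comm]

/-- Differentiating `z + ∑ rᵢ γᵢ = dx` gives a relation between the `αᵢ` and the differential of an
orphan, so all `rᵢ` vanish. Then `z` lies in `𝒪 ∩ dA`, to which `Z` is complementary. -/
theorem disjoint_Z_Γ_range_d (hε : A.IsOrientation n ε) :
    Disjoint (C.Z ⊔ C.Γ) (LinearMap.range A.d) := by
  rw [Submodule.disjoint_def]
  rintro _ hx ⟨x, rfl⟩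
  obtain ⟨z, hz, g, hg, hzg⟩ := Submodule.mem_sup.1 hx
  obtain ⟨r, rfl⟩ := (Submodule.mem_span_range_iff_exists_fun 𝕜).1 hg
  have hγm : ∑ i, r i • C.γ i ∈ A.gr (k - 1) :=
    sum_mem fun i _ => Submodule.smul_mem _ _ (C.γ_mem hε i)
  have h1 := congrArg A.d hzg
  -- `z` need not be homogeneous; only its component of degree `k - 1` matters for the relation.
  have h2 := congrArg (GradedRing.proj A.gr (k - 1 + 1)) h1
  rw [A.proj_d, A.d_d, map_zero, map_add, A.proj_of_mem hγm, map_add, map_sum] at h2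
  have hr : ∀ i, r i = 0 := C.eq_zero_of_sum_α r
    (isGradedSubspace_orphans hε z (C.Z_le_orphans hz) (k - 1)) (A.proj_mem _ _) (by
      rw [← h2]
      congr 1
      exact Finset.sum_congr rfl fun i _ => by rw [map_smul, C.d_γ])
  have h3 : ∑ i, r i • C.γ i = 0 := Finset.sum_eq_zero fun i _ => by rw [hr i, zero_smul]
  rw [h3, add_zero] at hzg
  rw [← hzg]
  exact Submodule.disjoint_def.1 C.disjoint_Z z hz ⟨C.Z_le_orphans hz, ⟨x, hzg.symm⟩⟩

theorem disjoint_T_range_d (hε : A.IsOrientation n ε) : Disjoint C.T (LinearMap.range A.d) := by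
  rw [Submodule.disjoint_def]
  intro x hx hxd
  obtain ⟨y, hy, z, hz, rfl⟩ := Submodule.mem_sup.1 hx
  have h1 := Submodule.disjoint_def.1 C.isCompl_U.disjoint z (by
    have : z = -y + (y + z) := by abel
    rw [this]
    exact Submodule.add_mem_sup (neg_mem hy) hxd) hz
  rw [h1, add_zero] at hxd ⊢
  exact Submodule.disjoint_def.1 (C.disjoint_Z_Γ_range_d hε) y hy hxd

variable (hA : A.IsReduced n ε) (hk : n + 2 ≤ 2 * k)

/-- `A⁰` consists of scalars, so the separate conditions at `1` and on `A⁺` combine to one on all of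
`A`. -/
theorem apply_mul_emb_eq_zero (hA : A.IsReduced n ε) (hk : n + 2 ≤ 2 * k)
    (e : (C.extension hA hk).carrier →ₗ[𝕜] 𝕜) {x : (C.extension hA hk).carrier} (hx : e x = 0)
    (h : ∀ ξ ∈ A.positive, e (x * C.emb hA hk ξ) = 0) (a : A.carrier) :
    e (x * C.emb hA hk a) = 0 := by
  obtain ⟨ξ, hξ, a₀, ha₀, rfl⟩ := proj_zero_add_positive a
  obtain ⟨r, rfl⟩ := hA.exists_smul_one ha₀
  rw [map_add, mul_add, map_add, h ξ hξ, map_smul, map_one, mul_smul_comm, mul_one, map_smul, hx,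
    smul_zero, add_zero]

theorem apply_comm_eq_zero {E : CDGA.{u, w} 𝕜} {e : E.carrier →ₗ[𝕜] 𝕜} {i j : ℕ} {x y : E.carrier}
    (hx : x ∈ E.gr i) (hy : y ∈ E.gr j) (h : e (x * y) = 0) : e (y * x) = 0 := by
  rw [E.mul_comm_of_mem hy hx, map_smul, h, smul_zero]

namespace IsExtendedOrientation

variable {C hA hk} {e : (C.extension hA hk).carrier →ₗ[𝕜] 𝕜} (he : C.IsExtendedOrientation hA hk e)
include he

theorem apply_emb (a : A.carrier) : e (C.emb hA hk a) = ε a := by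
  have h7 := hA.seven_le
  obtain ⟨ξ, hξ, a₀, ha₀, rfl⟩ := proj_zero_add_positive a
  rw [map_add, map_add, map_add, he.emb ξ hξ,
    he.eq_zero_of_ne 0 (by omega) _ (C.emb_mem hA hk ha₀),
    hA.orientation.eq_zero_of_ne 0 (by omega) _ ha₀]

theorem apply_w_d (i : Fin C.l) (a : A.carrier) :
    e (C.w hA hk i * C.emb hA hk (A.d a)) = (-1 : 𝕜) ^ k * ε (C.γ i * a) := by
  obtain ⟨ξ, hξ, a₀, ha₀, rfl⟩ := proj_zero_add_positive a
  have h0 := hA.d_gr_zero ha₀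
  rw [map_add, h0, add_zero, he.w_d i ξ hξ, mul_add, map_add,
    C.ε_γ_mul_cocycle hA.orientation i h0, add_zero]

theorem apply_c (i : Fin C.l) (a : A.carrier) : e (C.c hA hk i * C.emb hA hk a) = 0 :=
  C.apply_mul_emb_eq_zero hA hk e (he.c i) (he.c_ξ i) a

theorem apply_c_w (i j : Fin C.l) (a : A.carrier) :
    e (C.c hA hk i * C.w hA hk j * C.emb hA hk a) = 0 :=
  C.apply_mul_emb_eq_zero hA hk e (he.c_w i j) (he.c_w_ξ i j) a

theorem apply_w_w (i j : Fin C.l) (a : A.carrier) :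
    e (C.w hA hk i * C.w hA hk j * C.emb hA hk a) = 0 :=
  C.apply_mul_emb_eq_zero hA hk e (he.w_w i j) (he.w_w_ξ i j) a

theorem apply_u (hP : NeedsUV 𝕜 k) (i : Fin C.l) (a : A.carrier) :
    e (C.u₁ hA hk hP i * C.emb hA hk a) = 0 :=
  C.apply_mul_emb_eq_zero hA hk e (he.u hP i) (he.u_ξ hP i) a

theorem apply_v (hP : NeedsUV 𝕜 k) (i : Fin C.l) (a : A.carrier) :
    e (C.v₁ hA hk hP i * C.emb hA hk a) = 0 :=
  C.apply_mul_emb_eq_zero hA hk e (he.v hP i) (he.v_ξ hP i) a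

theorem apply_w_c (i j : Fin C.l) : e (C.w hA hk i * C.c hA hk j) = 0 :=
  apply_comm_eq_zero (C.c_mem hA hk j) (C.w_mem hA hk i) (he.c_w j i)

theorem apply_γ_w (i j : Fin C.l) : e (C.emb hA hk (C.γ i) * C.w hA hk j) = 0 :=
  apply_comm_eq_zero (C.w_mem hA hk j) (C.emb_mem hA hk (C.γ_mem hA.orientation i))
    (he.w_t j _ (C.γ_mem_T i))

/-- The conditions determine the functional. -/
theorem unique {e' : (C.extension hA hk).carrier →ₗ[𝕜] 𝕜} (he' : C.IsExtendedOrientation hA hk e') :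
    e' = e := by
  have key : ∀ N, ∀ x ∈ (C.extension hA hk).gr N, e' x = e x := by
    intro N x hx
    by_cases hN : N = n
    · have hx' := C.gr_le_span_lowMonomial hA hk hN.le hx
      have hle : Submodule.span 𝕜 {x | C.LowMonomial hA hk N x} ≤ LinearMap.eqLocus e' e := by
        rw [Submodule.span_le]
        intro y hy
        rw [SetLike.mem_coe, LinearMap.mem_eqLocus]
        cases hy with
        | emb ha => rw [he.apply_emb, he'.apply_emb]
        | @w i j a ha =>
          -- Split `a = t + dξ`: one condition fixes the value on `wᵢ t`, another the value on `wᵢ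
          -- dξ`.
          have hT : a ∈ C.T ⊔ LinearMap.range A.d := by
            rw [C.T_sup_range_d]
            trivial
          obtain ⟨t, ht, _, ⟨ξ, rfl⟩, rfl⟩ := Submodule.mem_sup.1 hT
          simp only [map_add, mul_add, he.w_t i t ht, he'.w_t i t ht, he.apply_w_d, he'.apply_w_d]
        | c i ha => rw [he.apply_c, he'.apply_c]
        | ww i i' ha => rw [he.apply_w_w, he'.apply_w_w]
        | cw i i' ha => rw [he.apply_c_w, he'.apply_c_w]
        | @cc i i' j a ha =>
          obtain ⟨ξ, hξ, a₀, ha₀, rfl⟩ := proj_zero_add_positive a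
          obtain ⟨r, rfl⟩ := hA.exists_smul_one ha₀
          simp only [map_add, mul_add, he.c_c_ξ i i' ξ hξ, he'.c_c_ξ i i' ξ hξ, map_smul, map_one,
            mul_smul_comm, mul_one, he.c_c, he'.c_c]
        | u hP hp i ha => rw [he.apply_u, he'.apply_u]
        | v hP hp i ha => rw [he.apply_v, he'.apply_v]
      exact hle hx'
    · rw [he.eq_zero_of_ne N hN x hx, he'.eq_zero_of_ne N hN x hx]
  ext x
  refine (C.extension hA hk).mem_induction (P := fun x => e' x = e x) x (by simp) key ?_
  intro x y hx hy
  rw [map_add, map_add, hx, hy]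

/-- The functional vanishes on coboundaries. -/
theorem apply_d (x : (C.extension hA hk).carrier) : e ((C.extension hA hk).d x) = 0 := by
  have h7 := hA.seven_le
  have hd1 : ∀ a₀ ∈ A.gr 0, ∃ r : 𝕜, C.emb hA hk a₀ = r • 1 := by
    intro a₀ ha₀
    obtain ⟨r, rfl⟩ := hA.exists_smul_one ha₀
    exact ⟨r, by rw [map_smul, map_one]⟩
  refine (C.extension hA hk).mem_induction (P := fun x => e ((C.extension hA hk).d x) = 0) x
    (by simp) ?_ (fun x y hx hy => by rw [map_add, map_add, hx, hy, add_zero])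
  intro N x hx
  by_cases hN : N + 1 = n
  swap
  · exact he.eq_zero_of_ne _ hN _ ((C.extension hA hk).d_mem hx)
  have hx' := C.gr_le_span_lowMonomial hA hk (by omega : N ≤ n) hx
  have hle : Submodule.span 𝕜 {x | C.LowMonomial hA hk N x} ≤
      LinearMap.ker (e.comp (C.extension hA hk).d) := by
    rw [Submodule.span_le]
    intro y hy
    rw [SetLike.mem_coe, LinearMap.mem_ker, LinearMap.comp_apply]
    cases hy with
    | emb ha => rw [C.d_emb, he.apply_emb, hA.orientation.map_d]
    | @w i j a ha =>
      -- The terms `-ε (γᵢ a)` and `(-1)^(k-2) (-1)^k ε (γᵢ a)` cancel. This dictates the sign in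
      -- the condition on `wᵢ dξ`.
      rw [(C.extension hA hk).leibniz _ (C.w_mem hA hk i), C.d_w, C.d_emb, sub_mul, map_add,
        map_sub, he.apply_c, ← map_mul, he.apply_emb, map_smul, he.apply_w_d, smul_eq_mul,
        ← mul_assoc, ← pow_add, Even.neg_one_pow ⟨k - 1, by omega⟩]
      ring
    | @c i j a ha =>
      rw [(C.extension hA hk).leibniz _ (C.c_mem hA hk i), C.d_c, C.d_emb, map_add, map_smul,
        he.apply_c, ← map_mul, he.apply_emb, C.α_mem_orphans i a, smul_zero, add_zero]
    | @ww i i' j a ha =>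
      -- Degree `n - 1 ≤ 2k - 3` leaves `a` in degree `0` or `1`; in degree `0` all terms vanish,
      -- the ones with `γ` because `Γ ⊆ T`.
      have hj : j ≤ 1 := by omega
      rw [(C.extension hA hk).d_mul_cocycle _
        (by rw [C.d_emb, hA.d_eq_zero_of_le_two (by omega) ha, map_zero])]
      interval_cases j
      · obtain ⟨r, hr⟩ := hd1 a ha
        have h1 := he.apply_γ_w i i'
        have h2 := he.w_t i _ (C.γ_mem_T i')
        rw [hr, mul_smul_comm, mul_one, (C.extension hA hk).leibniz _ (C.w_mem hA hk i), C.d_w,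
          C.d_w, sub_mul, mul_sub, map_smul, map_add, map_sub, map_smul, map_sub, he.c_w,
          he.apply_w_c, h1, h2]
        simp
      · rw [hA.eq_zero_of_mem_gr_one ha]
        simp
    | @cw i i' j a ha =>
      -- This monomial occurs only for `n = 2k - 2`, with `a` a scalar. The term `αᵢ wⱼ` gives `ε
      -- (γⱼ γᵢ)`, which cancels the value prescribed on `cᵢ cⱼ`; the signs agree as `(k - 1)²` and
      -- `k - 1` have the same parity.
      have hj : j = 0 := by omega
      have hn : n = 2 * k - 2 := by omega
      subst hj
      obtain ⟨r, hr⟩ := hd1 a ha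
      have h1 := he.apply_c i (C.γ i')
      have h2 : e (C.emb hA hk (C.α i) * C.w hA hk i') = ε (C.γ i' * C.γ i) := by
        rw [(C.extension hA hk).mul_comm_of_mem (C.emb_mem hA hk (C.α_mem i)) (C.w_mem hA hk i'),
          map_smul, ← C.d_γ, he.apply_w_d, smul_eq_mul, ← mul_assoc, ← pow_add,
          Even.neg_one_pow, one_mul]
        obtain ⟨t, rfl⟩ : ∃ t, k = t + 2 := ⟨k - 2, by omega⟩
        have ht : (t + 2) * (t + 2 - 2) + (t + 2) = (t + 1) * (t + 1 + 1) := by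
          rw [Nat.add_sub_cancel]
          ring
        rw [ht]
        exact Nat.even_mul_succ_self (t + 1)
      have h3 : C.γ i' * C.γ i = (-1 : 𝕜) ^ (k - 1) • (C.γ i * C.γ i') := by
        rw [A.mul_comm_of_mem (C.γ_mem hA.orientation i') (C.γ_mem hA.orientation i)]
        congr 1
        rcases Nat.even_or_odd (k - 1) with h | h
        · rw [h.neg_one_pow, (h.mul_left _).neg_one_pow]
        · rw [h.neg_one_pow, (h.mul h).neg_one_pow]
      rw [(C.extension hA hk).d_mul_cocycle _
        (by rw [C.d_emb, hA.d_eq_zero_of_le_two (by omega) ha, map_zero]), hr, mul_smul_comm,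
        mul_one, (C.extension hA hk).leibniz _ (C.c_mem hA hk i), C.d_c, C.d_w, mul_sub, map_smul,
        map_add, h2, map_smul, map_sub, h1, he.c_c, h3, map_smul]
      simp
    -- The degree is at least `2k - 2 ≥ n`, so it is never `n - 1`.
    | @cc i i' j a ha => omega
    | @u hP hp i j a ha =>
      rw [(C.extension hA hk).leibniz _ (C.u₁_mem hA hk hP i), C.d_u₁, C.d_emb, map_add, map_smul,
        he.apply_u, hp, pow_two, he.apply_w_w, smul_zero, add_zero]
    | @v hP hp i j a ha =>
      have hj : j ≤ 1 := by omega
      rw [(C.extension hA hk).leibniz _ (C.v₁_mem hA hk hP i), C.d_v₁, C.d_emb, map_add, map_smul,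
        he.apply_v, hp, Nat.add_one_sub_one, pow_one, sub_mul, sub_mul, map_sub, he.apply_c_w]
      interval_cases j
      · obtain ⟨r, hr⟩ := hd1 a ha
        rw [hr, mul_smul_comm, mul_one, map_smul, he.apply_γ_w]
        simp
      · rw [hA.eq_zero_of_mem_gr_one ha]
        simp
  exact hle hx'

end IsExtendedOrientation

end ExtensionChoice

end ExtendedOrientation

end CDGA

/-! ### Existence of the extended orientation. -/

namespace CDGA

section Existence

variable {𝕜 : Type u} [Field 𝕜] {A : CDGA.{u, v} 𝕜} {n : ℕ} {ε : A.carrier →ₗ[𝕜] 𝕜} {k : ℕ}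

namespace ObstructionChoice

variable (C : ObstructionChoice A n ε k) (hA : A.IsReduced n ε) (hk : n + 2 ≤ 2 * k)

/-- The augmentation `Â → A` that vanishes on the generators. -/
noncomputable def augExt : (C.extension hA hk).carrier →ₐ[𝕜] A.carrier := A.aug C.genDeg

/-- The coefficient in `A` of a generator. -/
noncomputable def coeffGen (x : C.Gens) : (C.extension hA hk).carrier →ₗ[𝕜] A.carrier :=
  A.coeffOne C.genDeg x (A.aug C.genDeg) (A.aug_gen C.genDeg x)

theorem augExt_emb (a : A.carrier) : C.augExt hA hk (C.emb hA hk a) = a := A.aug_incl _ a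

theorem augExt_c (i : Fin C.l) : C.augExt hA hk (C.c hA hk i) = 0 := A.aug_gen C.genDeg _

theorem augExt_w (i : Fin C.l) : C.augExt hA hk (C.w hA hk i) = 0 := A.aug_gen C.genDeg _

theorem augExt_u₁ (hP : NeedsUV 𝕜 k) (i : Fin C.l) : C.augExt hA hk (C.u₁ hA hk hP i) = 0 :=
  A.aug_gen C.genDeg _

theorem augExt_v₁ (hP : NeedsUV 𝕜 k) (i : Fin C.l) : C.augExt hA hk (C.v₁ hA hk hP i) = 0 :=
  A.aug_gen C.genDeg _

theorem coeffGen_emb (x : C.Gens) (a : A.carrier) : C.coeffGen hA hk x (C.emb hA hk a) = 0 :=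
  A.coeffOne_incl C.genDeg x _ _ a

/-- The hypothesis on `y` removes the second Leibniz term. Hence products of two generators have
coefficient zero, and `wᵢ a` has `wᵢ`-coefficient `a`. -/
theorem coeffGen_mul (x : C.Gens) {i : ℕ} {y : (C.extension hA hk).carrier}
    (hy : y ∈ (C.extension hA hk).gr i) (hy0 : C.augExt hA hk y = 0)
    (z : (C.extension hA hk).carrier) :
    C.coeffGen hA hk x (y * z) = C.coeffGen hA hk x y * C.augExt hA hk z := by
  have h := A.coeffOne_mul C.genDeg x (A.aug C.genDeg) (A.aug_gen C.genDeg x) hy z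
  have h0 : A.aug C.genDeg y = 0 := hy0
  rw [h0, zero_mul, smul_zero, add_zero] at h
  exact h

theorem coeffGen_w_w (i : Fin C.l) : C.coeffGen hA hk (.w i) (C.w hA hk i) = 1 :=
  A.coeffOne_gen_self _ _ _ _

theorem coeffGen_c_c (i : Fin C.l) : C.coeffGen hA hk (.c i) (C.c hA hk i) = 1 :=
  A.coeffOne_gen_self _ _ _ _

theorem coeffGen_w {x : C.Gens} {i : Fin C.l} (h : .w i ≠ x) :
    C.coeffGen hA hk x (C.w hA hk i) = 0 :=
  A.coeffOne_gen_of_ne _ _ _ _ h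

theorem coeffGen_c {x : C.Gens} {i : Fin C.l} (h : .c i ≠ x) :
    C.coeffGen hA hk x (C.c hA hk i) = 0 :=
  A.coeffOne_gen_of_ne _ _ _ _ h

theorem coeffGen_u₁ (j : Fin C.l) (hP : NeedsUV 𝕜 k) (i : Fin C.l) :
    C.coeffGen hA hk (.w j) (C.u₁ hA hk hP i) = 0 :=
  A.coeffOne_gen_of_ne _ _ _ _ (by simp)

theorem coeffGen_v₁ (j : Fin C.l) (hP : NeedsUV 𝕜 k) (i : Fin C.l) :
    C.coeffGen hA hk (.w j) (C.v₁ hA hk hP i) = 0 :=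
  A.coeffOne_gen_of_ne _ _ _ _ (by simp)

section Psi

open Polynomial

theorem C_mul_X_mul_C_mul_X {R : Type*} [Ring R] (a b : R) :
    Polynomial.C a * X * (Polynomial.C b * X) = Polynomial.C (a * b) * X ^ 2 := by
  rw [mul_assoc, ← mul_assoc X, X_mul_C, mul_assoc, ← mul_assoc, ← C_mul, ← pow_two]

/-- The values on generators of the homomorphism `Â → A[T]` with `cᵢ ↦ γᵢ T` and the other generators
sent to zero. -/
noncomputable def polyGen : C.Gens → A.carrier[X]
  | .c i => Polynomial.C (C.γ i) * Polynomial.X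
  | _ => 0

/-- The algebra homomorphism `Â → A[T]` with `cᵢ ↦ γᵢ T` that sends the other generators to zero. -/
noncomputable def polyHom : (C.extension hA hk).carrier →ₐ[𝕜] A.carrier[X] :=
  A.liftGen C.genDeg CAlgHom C.polyGen
    (by
      rintro i a (i' | i' | ⟨_, i', j⟩ | ⟨_, i', j⟩) ha
      · simp only [polyGen, CAlgHom_apply]
        rw [mul_assoc, X_mul_C, ← mul_assoc, ← mul_assoc, ← C_mul, ← C_mul,
          A.mul_comm_of_mem ha (C.γ_mem hA.orientation i'), ← smul_C, smul_mul_assoc]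
        rfl
      all_goals simp [polyGen])
    (by
      rintro (i | i | ⟨_, i, j⟩ | ⟨_, i, j⟩) (i' | i' | ⟨_, i', j'⟩ | ⟨_, i', j'⟩)
      · simp only [polyGen]
        rw [C_mul_X_mul_C_mul_X, C_mul_X_mul_C_mul_X,
          A.mul_comm_of_mem (C.γ_mem hA.orientation i) (C.γ_mem hA.orientation i'), ← smul_C,
          smul_mul_assoc]
        rfl
      all_goals simp [polyGen])
    (by
      rintro (i | i | ⟨_, i, j⟩ | ⟨_, i, j⟩) hi
      · simp only [polyGen]
        rw [C_mul_X_mul_C_mul_X, A.mul_self_of_odd hi (C.γ_mem hA.orientation i), C_0, zero_mul]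
      all_goals simp [polyGen])

theorem polyHom_emb (a : A.carrier) : C.polyHom hA hk (C.emb hA hk a) = Polynomial.C a :=
  A.liftGen_incl _ _ _ _ _ _ a

theorem polyHom_c (i : Fin C.l) :
    C.polyHom hA hk (C.c hA hk i) = Polynomial.C (C.γ i) * Polynomial.X :=
  A.liftGen_gen _ _ _ _ _ _ _

theorem polyHom_w (i : Fin C.l) : C.polyHom hA hk (C.w hA hk i) = 0 :=
  A.liftGen_gen _ _ _ _ _ _ _

theorem polyHom_u₁ (hP : NeedsUV 𝕜 k) (i : Fin C.l) : C.polyHom hA hk (C.u₁ hA hk hP i) = 0 :=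
  A.liftGen_gen _ _ _ _ _ _ _

theorem polyHom_v₁ (hP : NeedsUV 𝕜 k) (i : Fin C.l) : C.polyHom hA hk (C.v₁ hA hk hP i) = 0 :=
  A.liftGen_gen _ _ _ _ _ _ _

/-- The coefficient of `Tᵐ` in the image in `A[T]`. -/
noncomputable def polyCoeff (m : ℕ) : (C.extension hA hk).carrier →ₗ[𝕜] A.carrier where
  toFun x := (C.polyHom hA hk x).coeff m
  map_add' x y := by rw [map_add, coeff_add]
  map_smul' r x := by rw [map_smul, coeff_smul]; rfl

end Psi

end ObstructionChoice

namespace ExtensionChoice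

variable (C : ExtensionChoice A n ε k)

/-- The functional `dξ ↦ ± ε (γᵢ ξ)` on `d A`, extended by zero on `T`. -/
theorem exists_functional_w (hε : A.IsOrientation n ε) (i : Fin C.l) : ∃ φ : A.carrier →ₗ[𝕜] 𝕜,
    (∀ ξ, φ (A.d ξ) = (-1 : 𝕜) ^ k * ε (C.γ i * ξ)) ∧ ∀ t ∈ C.T, φ t = 0 := by
  obtain ⟨s, hs⟩ := A.d.rangeRestrict.exists_rightInverse_of_surjective
    (LinearMap.range_rangeRestrict _)
  have hc : IsCompl C.T (LinearMap.range A.d) :=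
    ⟨C.disjoint_T_range_d hε, codisjoint_iff.2 C.T_sup_range_d⟩
  let f : A.carrier →ₗ[𝕜] 𝕜 := (-1 : 𝕜) ^ k • ε.comp (LinearMap.mulLeft 𝕜 (C.γ i))
  refine ⟨LinearMap.ofIsCompl hc 0 (f.comp s), fun ξ => ?_, fun t ht => ?_⟩
  · have h1 := LinearMap.ofIsCompl_apply_right hc (φ := 0) (ψ := f.comp s) ⟨A.d ξ, ξ, rfl⟩
    rw [h1]
    have h2 : A.d (s ⟨A.d ξ, ξ, rfl⟩) = A.d ξ :=
      congrArg Subtype.val (LinearMap.congr_fun hs ⟨A.d ξ, ξ, rfl⟩)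
    -- The value does not depend on the chosen primitive: two primitives differ by a cocycle, and
    -- `γᵢ` is orthogonal to cocycles.
    have h3 := C.ε_γ_mul_cocycle hε i (z := s ⟨A.d ξ, ξ, rfl⟩ - ξ) (by rw [map_sub, h2, sub_self])
    rw [mul_sub, map_sub, sub_eq_zero] at h3
    change (-1 : 𝕜) ^ k * ε (C.γ i * s ⟨A.d ξ, ξ, rfl⟩) = _
    rw [h3]
  · exact LinearMap.ofIsCompl_apply_left hc (φ := 0) (ψ := f.comp s) ⟨t, ht⟩

/-- There are no coboundaries in degree `0`, and `T` is graded. So the vanishing on `wᵢ` is the case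
`t = 1` of the vanishing on `wᵢ t`. -/
theorem one_mem_T (hε : A.IsOrientation n ε) : (1 : A.carrier) ∈ C.T := by
  obtain ⟨t, ht, _, ⟨x, rfl⟩, h⟩ := Submodule.mem_sup.1
    (C.T_sup_range_d.ge (Submodule.mem_top (x := (1 : A.carrier))))
  have h0 := congrArg (GradedRing.proj A.gr 0) h
  rw [map_add, A.proj_zero_d, add_zero,
    A.proj_of_mem (SetLike.GradedOne.one_mem (A := A.gr))] at h0
  rw [← h0]
  exact C.isGradedSubspace_T hε t ht 0

variable (hA : A.IsReduced n ε) (hk : n + 2 ≤ 2 * k)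

theorem proj_emb (j : ℕ) (a : A.carrier) : GradedRing.proj (C.extension hA hk).gr j
    (C.emb hA hk a) = C.emb hA hk (GradedRing.proj A.gr j a) := by
  refine A.mem_induction (P := fun a => GradedRing.proj (C.extension hA hk).gr j
    (C.emb hA hk a) = C.emb hA hk (GradedRing.proj A.gr j a)) a (by simp) ?_ ?_
  · intro i x hx
    by_cases h : i = j
    · subst h
      rw [A.proj_of_mem hx, proj_of_mem _ (C.emb_mem hA hk hx)]
    · rw [A.proj_of_mem_ne hx h, proj_of_mem_ne _ (C.emb_mem hA hk hx) h, map_zero]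
  · intro x y hx hy
    simp only [map_add, hx, hy]

theorem exists_isExtendedOrientation : ∃ e, C.IsExtendedOrientation hA hk e := by
  choose φ hφ1 hφ2 using C.exists_functional_w hA.orientation
  set E := C.extension hA hk with hE
  -- The coefficient of `T⁰` gives `ε` on `A`, that of `T²` gives `-ε (γᵢ γⱼ)` on `cᵢ cⱼ`, and the
  -- coefficients of the `wᵢ` give the values on `wᵢ A`. Projecting to degree `n` afterwards
  -- enforces the degree condition.
  let e₀ : E.carrier →ₗ[𝕜] 𝕜 := ε.comp (C.polyCoeff hA hk 0) - ε.comp (C.polyCoeff hA hk 2) +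
    ∑ i, (φ i).comp (C.coeffGen hA hk (.w i))
  have he₀ : ∀ x, e₀ x = ε ((C.polyHom hA hk x).coeff 0) - ε ((C.polyHom hA hk x).coeff 2) +
      ∑ i, φ i (C.coeffGen hA hk (.w i) x) := by
    intro x
    simp only [e₀, LinearMap.add_apply, LinearMap.sub_apply, LinearMap.sum_apply,
      LinearMap.comp_apply]
    rfl
  let e : E.carrier →ₗ[𝕜] 𝕜 := e₀.comp (E.projₗ n)
  have he_eq : ∀ x ∈ E.gr n, e x = e₀ x := fun x hx => congrArg e₀ (E.proj_of_mem hx)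
  have he_ne : ∀ i, i ≠ n → ∀ x ∈ E.gr i, e x = 0 := fun i hi x hx => by
    change e₀ (GradedRing.proj E.gr n x) = 0
    rw [E.proj_of_mem_ne hx hi, map_zero]
  have he_zero : ∀ {i : ℕ} {x : E.carrier}, x ∈ E.gr i → e₀ x = 0 → e x = 0 := by
    intro i x hx h0
    by_cases h : i = n
    · subst h
      rw [he_eq x hx, h0]
    · exact he_ne i h x hx
  have hmul : ∀ {i : ℕ} {x : E.carrier}, x ∈ E.gr i → (∀ a, e₀ (x * C.emb hA hk a) = 0) →
      ∀ a, e (x * C.emb hA hk a) = 0 := by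
    intro i x hx h0 a
    refine A.mem_induction (P := fun a => e (x * C.emb hA hk a) = 0) a (by simp) ?_ ?_
    · intro j y hy
      exact he_zero (SetLike.mul_mem_graded hx (C.emb_mem hA hk hy)) (h0 y)
    · intro y z hy hz
      rw [map_add, mul_add, map_add, hy, hz, add_zero]
  have hone : ∀ {x : E.carrier}, (∀ a, e (x * C.emb hA hk a) = 0) → e x = 0 := by
    intro x h
    have := h 1
    rwa [map_one, mul_one] at this
  have hw₀ : ∀ i a, e₀ (C.w hA hk i * C.emb hA hk a) = φ i a := by
    intro i a
    rw [he₀, map_mul, C.polyHom_w, zero_mul, Polynomial.coeff_zero, Polynomial.coeff_zero, map_zero,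
      sub_zero, zero_add, Finset.sum_eq_single i]
    · rw [C.coeffGen_mul hA hk _ (C.w_mem hA hk i) (C.augExt_w hA hk i), C.coeffGen_w_w,
        C.augExt_emb, one_mul]
    · intro j _ hj
      rw [C.coeffGen_mul hA hk _ (C.w_mem hA hk i) (C.augExt_w hA hk i), C.coeffGen_w, zero_mul,
        map_zero]
      intro h
      cases h
      exact hj rfl
    · intro h
      exact absurd (Finset.mem_univ i) h
  have hzero : ∀ x, C.polyHom hA hk x = 0 → (∀ i, C.coeffGen hA hk (.w i) x = 0) → e₀ x = 0 := by
    intro x h1 h2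
    rw [he₀, h1]
    simp [h2]
  have hc : ∀ i a, e (C.c hA hk i * C.emb hA hk a) = 0 := fun i => hmul (C.c_mem hA hk i) fun a => by
    rw [he₀, map_mul, C.polyHom_c, C.polyHom_emb, mul_assoc, Polynomial.X_mul_C, ← mul_assoc,
      ← Polynomial.C_mul, Polynomial.coeff_C_mul_X, Polynomial.coeff_C_mul_X]
    simp only [C.coeffGen_mul hA hk _ (C.c_mem hA hk i) (C.augExt_c hA hk i),
      C.coeffGen_c hA hk (by simp : (.c i : C.Gens) ≠ .w _)]
    simp
  have hcw : ∀ i j a, e (C.c hA hk i * C.w hA hk j * C.emb hA hk a) = 0 := fun i j =>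
    hmul (SetLike.mul_mem_graded (C.c_mem hA hk i) (C.w_mem hA hk j)) fun a => by
      refine hzero _ (by simp [C.polyHom_w]) fun j' => ?_
      rw [mul_assoc, C.coeffGen_mul hA hk _ (C.c_mem hA hk i) (C.augExt_c hA hk i), map_mul,
        C.augExt_w, zero_mul, mul_zero]
  have hww : ∀ i j a, e (C.w hA hk i * C.w hA hk j * C.emb hA hk a) = 0 := fun i j =>
    hmul (SetLike.mul_mem_graded (C.w_mem hA hk i) (C.w_mem hA hk j)) fun a => by
      refine hzero _ (by simp [C.polyHom_w]) fun j' => ?_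
      rw [mul_assoc, C.coeffGen_mul hA hk _ (C.w_mem hA hk i) (C.augExt_w hA hk i), map_mul,
        C.augExt_w, zero_mul, mul_zero]
  have hu : ∀ hP i a, e (C.u₁ hA hk hP i * C.emb hA hk a) = 0 := fun hP i =>
    hmul (C.u₁_mem hA hk hP i) fun a => by
      refine hzero _ (by simp [C.polyHom_u₁]) fun j' => ?_
      rw [C.coeffGen_mul hA hk _ (C.u₁_mem hA hk hP i) (C.augExt_u₁ hA hk hP i), C.coeffGen_u₁,
        zero_mul]
  have hv : ∀ hP i a, e (C.v₁ hA hk hP i * C.emb hA hk a) = 0 := fun hP i =>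
    hmul (C.v₁_mem hA hk hP i) fun a => by
      refine hzero _ (by simp [C.polyHom_v₁]) fun j' => ?_
      rw [C.coeffGen_mul hA hk _ (C.v₁_mem hA hk hP i) (C.augExt_v₁ hA hk hP i), C.coeffGen_v₁,
        zero_mul]
  have hcc₀ : ∀ i j a, e₀ (C.c hA hk i * C.c hA hk j * C.emb hA hk a) =
      -ε (C.γ i * C.γ j * a) := by
    intro i j a
    have h1 : C.polyHom hA hk (C.c hA hk i * C.c hA hk j * C.emb hA hk a) =
        Polynomial.C (C.γ i * C.γ j * a) * Polynomial.X ^ 2 := by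
      rw [map_mul, map_mul, C.polyHom_c, C.polyHom_c, C.polyHom_emb,
        ObstructionChoice.C_mul_X_mul_C_mul_X, mul_assoc, Polynomial.X_pow_mul_C, ← mul_assoc,
        ← Polynomial.C_mul]
    have h2 : ∀ j', C.coeffGen hA hk (.w j') (C.c hA hk i * C.c hA hk j * C.emb hA hk a) = 0 := by
      intro j'
      rw [mul_assoc, C.coeffGen_mul hA hk _ (C.c_mem hA hk i) (C.augExt_c hA hk i), map_mul,
        C.augExt_c, zero_mul, mul_zero]
    rw [he₀, h1, Polynomial.coeff_C_mul_X_pow, Polynomial.coeff_C_mul_X_pow]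
    simp [h2]
  have hcc : ∀ i j {m : ℕ} {a : A.carrier}, a ∈ A.gr m →
      e (C.c hA hk i * C.c hA hk j * C.emb hA hk a) = -ε (C.γ i * C.γ j * a) := by
    intro i j m a ha
    have hm := SetLike.mul_mem_graded (SetLike.mul_mem_graded (C.c_mem hA hk i) (C.c_mem hA hk j))
      (C.emb_mem hA hk ha)
    by_cases h : k - 1 + (k - 1) + m = n
    · rw [h] at hm
      rw [he_eq _ hm, hcc₀]
    · rw [he_ne _ h _ hm, hA.orientation.eq_zero_of_ne _ h _ (SetLike.mul_mem_graded
        (SetLike.mul_mem_graded (C.γ_mem hA.orientation i) (C.γ_mem hA.orientation j)) ha),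
        neg_zero]
  have hwt : ∀ i, ∀ t ∈ C.T, e (C.w hA hk i * C.emb hA hk t) = 0 := by
    intro i t ht
    -- Only the component of `t` of degree `n - (k - 2)` contributes, and it lies in the graded
    -- subspace `T`. If `k - 2 > n` there is no such degree.
    by_cases h : k - 2 ≤ n
    · have h1 := proj_mul_left _ (C.w_mem hA hk i) (n - (k - 2)) (C.emb hA hk t)
      rw [Nat.add_sub_cancel' h, proj_emb] at h1
      change e₀ (GradedRing.proj _ n _) = 0
      rw [h1, hw₀]
      exact hφ2 i _ (C.isGradedSubspace_T hA.orientation t ht _)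
    · refine A.mem_induction (P := fun a => e (C.w hA hk i * C.emb hA hk a) = 0) t (by simp) ?_ ?_
      · intro j x hx
        exact he_ne (k - 2 + j) (by omega) _
          (SetLike.mul_mem_graded (C.w_mem hA hk i) (C.emb_mem hA hk hx))
      · intro x y hx hy
        rw [map_add, mul_add, map_add, hx, hy, add_zero]
  refine ⟨e, ?_⟩
  constructor
  · intro ξ _
    refine A.mem_induction (P := fun a => e (C.emb hA hk a) = ε a) ξ (by simp) ?_ ?_
    · intro i x hx
      by_cases h : i = n
      · subst h
        rw [he_eq _ (C.emb_mem hA hk hx), he₀, C.polyHom_emb]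
        simp [C.coeffGen_emb, Polynomial.coeff_C]
      · rw [he_ne i h _ (C.emb_mem hA hk hx), hA.orientation.eq_zero_of_ne i h x hx]
    · intro x y hx hy
      simp only [map_add, hx, hy]
  · intro i ξ _
    refine A.mem_induction (P := fun ξ => e (C.w hA hk i * C.emb hA hk (A.d ξ)) =
      (-1 : 𝕜) ^ k * ε (C.γ i * ξ)) ξ (by simp) ?_ ?_
    · intro j x hx
      have hm := SetLike.mul_mem_graded (C.w_mem hA hk i) (C.emb_mem hA hk (A.d_mem hx))
      have h3 := hA.three_le hk
      by_cases h : k - 2 + (j + 1) = n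
      · rw [h] at hm
        rw [he_eq _ hm, hw₀, hφ1]
      · rw [he_ne _ h _ hm, hA.orientation.eq_zero_of_ne (k - 1 + j) (by omega) _
          (SetLike.mul_mem_graded (C.γ_mem hA.orientation i) hx), mul_zero]
    · intro x y hx hy
      simp only [map_add, mul_add, hx, hy]
  · intro i j
    have h := hcc i j (SetLike.GradedOne.one_mem (A := A.gr))
    rwa [map_one, mul_one, mul_one] at h
  · intro i
    have h := hwt i 1 (C.one_mem_T hA.orientation)
    rwa [map_one, mul_one] at h
  · exact hwt
  · exact fun i => hone (hc i)
  · exact fun i ξ _ => hc i ξ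
  · intro i j ξ hξ
    have h7 := hA.seven_le
    refine Submodule.iSup_induction (fun m : ℕ => A.gr (m + 1))
      (motive := fun ξ => e (C.c hA hk i * C.c hA hk j * C.emb hA hk ξ) = 0) hξ ?_ (by simp) ?_
    · intro m x hx
      -- The degree exceeds `n` because `2k - 2 ≥ n` and `ξ` has positive degree.
      exact he_ne (k - 1 + (k - 1) + (m + 1)) (by omega) _ (SetLike.mul_mem_graded
        (SetLike.mul_mem_graded (C.c_mem hA hk i) (C.c_mem hA hk j)) (C.emb_mem hA hk hx))
    · intro x y hx hy
      rw [map_add, mul_add, map_add, hx, hy, add_zero]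
  · exact fun i j => hone (hcw i j)
  · exact fun i j ξ _ => hcw i j ξ
  · exact fun i j => hone (hww i j)
  · exact fun i j ξ _ => hww i j ξ
  · exact fun hP i => hone (hu hP i)
  · intro hP i j
    refine he_zero (SetLike.mul_mem_graded (C.w_mem hA hk i) (C.u₁_mem hA hk hP j)) ?_
    refine hzero _ (by simp [C.polyHom_w]) fun j' => ?_
    rw [C.coeffGen_mul hA hk _ (C.w_mem hA hk i) (C.augExt_w hA hk i), C.augExt_u₁, mul_zero]
  · exact fun hP i => hone (hv hP i)
  · exact fun hP i ξ _ => hu hP i ξ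
  · exact fun hP i ξ _ => hv hP i ξ
  · exact he_ne

end ExtensionChoice

end Existence

end CDGA

/-! ### Quasi-isomorphisms and Poincaré duality; chain maps and finite type for free extensions. -/

namespace CDGA

section Transport

variable {𝕜 : Type u} [Field 𝕜]

/-- Poincaré duality is invariant under isomorphisms of graded algebras. -/
theorem IsPoincareDuality.of_algEquiv {H : Type v} [Ring H] [Algebra 𝕜 H] {H' : Type w} [Ring H']
    [Algebra 𝕜 H'] {gr : ℕ → Submodule 𝕜 H} {gr' : ℕ → Submodule 𝕜 H'} {n : ℕ} (f : H ≃ₐ[𝕜] H')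
    (hf : ∀ i, ∀ x, f x ∈ gr' i ↔ x ∈ gr i) (h : IsPoincareDuality gr n) :
    IsPoincareDuality gr' n := by
  obtain ⟨h1, h0, ε, hε, hl, hr⟩ := h
  have hf' : ∀ i y, f.symm y ∈ gr i ↔ y ∈ gr' i := fun i y => by
    rw [← hf, AlgEquiv.apply_symm_apply]
  refine ⟨fun h => h1 (f.injective (by rw [map_one, map_zero, h])), ?_,
    ε.comp f.symm.toLinearMap, ?_, ?_, ?_⟩
  · ext y
    rw [← hf', h0, Submodule.mem_span_singleton, Submodule.mem_span_singleton]
    refine exists_congr fun r => ?_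
    rw [AlgEquiv.eq_symm_apply, map_smul, map_one]
  · exact fun i hi y hy => hε i hi _ ((hf' i y).2 hy)
  · intro i y hy h
    refine f.symm.injective ((hl i _ ((hf' i y).2 hy) fun j hij x hx => ?_).trans (map_zero _).symm)
    have := h j hij (f x) ((hf j x).2 hx)
    change ε (f.symm (y * f x)) = 0 at this
    rwa [map_mul, AlgEquiv.symm_apply_apply] at this
  · intro j y hy h
    refine f.symm.injective ((hr j _ ((hf' j y).2 hy) fun i hij x hx => ?_).trans (map_zero _).symm)
    have := h i hij (f x) ((hf i x).2 hx)
    change ε (f.symm (f x * y)) = 0 at this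
    rwa [map_mul, AlgEquiv.symm_apply_apply] at this

variable {A : CDGA.{u, v} 𝕜} {B : CDGA.{u, w} 𝕜} (f : A.carrier →ₐ[𝕜] B.carrier)
  (hfd : ∀ a, B.d (f a) = f (A.d a))

/-- The map induced in cohomology by a morphism of CDGAs. -/
noncomputable def cohomologyMap : A.Cohomology →ₐ[𝕜] B.Cohomology :=
  Ideal.Quotient.liftₐ A.coboundaries
    (B.cls.comp ((f.comp A.cocycles.val).codRestrict B.cocycles fun z =>
      (hfd z).trans ((congrArg f z.2).trans (map_zero f))))
    (by
      rintro z ⟨x, hx⟩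
      exact (B.cls_eq_zero_iff _).2 ⟨f x, (hfd x).trans (congrArg f hx)⟩)

theorem cohomologyMap_cls (z : A.cocycles) (hz : B.d (f z) = 0) :
    cohomologyMap f hfd (A.cls z) = B.cls ⟨f z, hz⟩ := rfl

/-- A quasi-isomorphism of CDGAs preserves Poincaré duality of the cohomology. -/
theorem IsPoincareDuality.of_quasiIso (hfd : ∀ a, B.d (f a) = f (A.d a))
    (hgr : ∀ i, ∀ a ∈ A.gr i, f a ∈ B.gr i)
    (hinj : ∀ a, A.d a = 0 → ∀ y, B.d y = f a → ∃ x, A.d x = a)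
    (hsurj : ∀ b, B.d b = 0 → ∃ a g, A.d a = 0 ∧ b = f a + B.d g) {n : ℕ}
    (h : IsPoincareDuality A.cohomologyGr n) : IsPoincareDuality B.cohomologyGr n := by
  have hF0 : ∀ z : A.cocycles, B.d (f z) = 0 := fun z =>
    (hfd z).trans ((congrArg f z.2).trans (map_zero f))
  have hbij : Function.Bijective (cohomologyMap f hfd) := by
    constructor
    · rw [injective_iff_map_eq_zero]
      intro x hx
      obtain ⟨z, rfl⟩ := A.cls_surjective x
      rw [cohomologyMap_cls f hfd z (hF0 z), cls_eq_zero_iff] at hx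
      obtain ⟨y, hy⟩ := hx
      exact (A.cls_eq_zero_iff z).2 (hinj z z.2 y hy)
    · intro y
      obtain ⟨⟨b, hb⟩, rfl⟩ := B.cls_surjective y
      obtain ⟨a, g, ha, rfl⟩ := hsurj b hb
      refine ⟨A.cls ⟨a, ha⟩, ?_⟩
      rw [cohomologyMap_cls f hfd _ (hF0 _), ← sub_eq_zero, ← map_sub, cls_eq_zero_iff]
      exact ⟨-g, by rw [map_neg]; simp⟩
  have hmem : ∀ i x, x ∈ A.cohomologyGr i → cohomologyMap f hfd x ∈ B.cohomologyGr i := by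
    intro i x hx
    obtain ⟨z, hz, rfl⟩ := A.exists_of_mem_cohomologyGr hx
    rw [cohomologyMap_cls f hfd z (hF0 z)]
    exact B.cls_mem (hgr i _ hz)
  have hproj : ∀ i a, GradedRing.proj B.gr i (f a) = f (GradedRing.proj A.gr i a) := by
    intro i a
    refine A.mem_induction (P := fun a => GradedRing.proj B.gr i (f a) =
      f (GradedRing.proj A.gr i a)) a (by simp) ?_ ?_
    · intro j x hx
      by_cases hij : j = i
      · subst hij
        rw [A.proj_of_mem hx, B.proj_of_mem (hgr j x hx)]
      · rw [A.proj_of_mem_ne hx hij, B.proj_of_mem_ne (hgr j x hx) hij, map_zero]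
    · intro x y hx hy
      simp only [map_add, hx, hy]
  refine h.of_algEquiv (AlgEquiv.ofBijective (cohomologyMap f hfd) hbij)
    fun i x => ⟨fun hx => ?_, hmem i x⟩
  obtain ⟨⟨b, hb⟩, hbi, hbx⟩ := B.exists_of_mem_cohomologyGr hx
  obtain ⟨a, g, ha, rfl⟩ := hsurj b hb
  -- The preimage class must be homogeneous as well: the degree `i` component of `a` represents the
  -- same class, since the cocycle `f a + dg` is homogeneous of degree `i`.
  have ha' := A.d_proj_of_cocycle ha i
  have hx' : cohomologyMap f hfd x = cohomologyMap f hfd (A.cls ⟨_, ha'⟩) := by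
    refine hbx.symm.trans ?_
    rw [cohomologyMap_cls f hfd _ (hF0 _), ← sub_eq_zero, ← map_sub, cls_eq_zero_iff]
    obtain ⟨g', hg'⟩ := B.isGradedSubspace_range_d (B.d g) ⟨g, rfl⟩ i
    refine ⟨g', hg'.trans ?_⟩
    have h1 := B.proj_of_mem hbi
    change GradedRing.proj B.gr i (f a + B.d g) = f a + B.d g at h1
    rw [map_add, hproj] at h1
    exact eq_sub_of_add_eq' h1
  rw [hbij.1 hx']
  exact A.cls_mem (A.proj_mem i a)

/-- An algebra homomorphism out of `A ⊗ ⋀X` commutes with the differentials if it does so on `A` and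
on the generators. -/
theorem hom_commutes_d {X : Type*} {deg : X → ℕ} {δ : X → A.FreeExt deg}
    (hδ : ∀ x, δ x ∈ A.freeGr deg (deg x + 1)) (r : A.FreeExt deg →ₐ[𝕜] B.carrier)
    (hgr : ∀ i, ∀ a ∈ A.gr i, r (A.incl deg a) ∈ B.gr i) (hgen : ∀ x, r (A.gen deg x) ∈ B.gr (deg x))
    (hd : ∀ a, B.d (r (A.incl deg a)) = r (A.incl deg (A.d a)))
    (hdgen : ∀ x, B.d (r (A.gen deg x)) = r (δ x)) (y : A.FreeExt deg) :
    B.d (r y) = r (A.freeD deg δ hδ y) := by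
  have hl : ∀ y, r (A.letter deg y) ∈ B.gr (A.wt deg y) ∧
      B.d (r (A.letter deg y)) = r (A.freeD deg δ hδ (A.letter deg y)) := by
    rintro (⟨i, a, ha⟩ | x)
    · rw [← A.incl_of_mem deg ha, A.freeD_incl]
      exact ⟨hgr i a ha, hd a⟩
    · refine ⟨hgen x, (hdgen x).trans (congrArg r (A.freeD_gen deg δ hδ x).symm)⟩
  have hw : ∀ L, B.d (r (A.word deg L)) = r (A.freeD deg δ hδ (A.word deg L)) := by
    intro L
    induction L with
    | nil =>
      rw [word_nil, map_one, d_one, ← map_one (A.incl deg), A.freeD_incl, d_one, map_zero, map_zero]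
    | cons y L ih =>
      rw [word_cons, map_mul, B.leibniz _ (hl y).1,
        A.freeD_leibniz deg δ hδ _ (A.letter_mem deg y), (hl y).2, ih, map_add, map_smul, map_mul,
        map_mul]
  refine DirectSum.Decomposition.inductionOn (A.freeGr deg) (motive := fun y => B.d (r y) =
    r (A.freeD deg δ hδ y)) (by simp) ?_ ?_ y
  · rintro i ⟨m, hm⟩
    change B.d (r m) = r (A.freeD deg δ hδ m)
    induction hm using Submodule.span_induction with
    | mem x h =>
      obtain ⟨L, _, rfl⟩ := h
      exact hw L
    | zero => simp
    | add x y _ _ hx hy => simp only [map_add, hx, hy]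
    | smul c x _ hx => simp only [map_smul, hx]
  · intro m m' hm hm'
    simp only [map_add, hm, hm']

/-- The components of `A ⊗ ⋀X` are finite-dimensional if those of `A` are and if there are finitely
many generators in each degree, all of positive degree. -/
theorem finite_freeGr {X : Type*} {deg : X → ℕ} (hA : ∀ i, Module.Finite 𝕜 (A.gr i))
    (hpos : ∀ x, 0 < deg x) (hX : ∀ N, {x | deg x ≤ N}.Finite) (N : ℕ) :
    Module.Finite 𝕜 (A.freeGr deg N) := by
  have hS : {G : List X | (G.map deg).sum ≤ N}.Finite := by
    have := (hX N).to_subtype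
    -- Positive degrees bound the length of a word by its total degree, so finitely many words over
    -- a finite alphabet remain.
    refine ((List.finite_length_le {x | deg x ≤ N} N).image (List.map Subtype.val)).subset ?_
    intro G hG
    have h1 : ∀ G : List X, G.length ≤ (G.map deg).sum := by
      intro G
      induction G with
      | nil => simp
      | cons x G ih =>
        have := hpos x
        simp only [List.length_cons, List.map_cons, List.sum_cons]
        omega
    have h2 : ∀ x ∈ G, deg x ≤ N := fun x hx =>
      (List.le_sum_of_mem (List.mem_map_of_mem hx)).trans hG
    exact ⟨G.attach.map fun x => ⟨x.1, h2 x.1 x.2⟩, by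
      rw [Set.mem_ofPred_eq, List.length_map, List.length_attach]
      exact (h1 G).trans hG, by simp⟩
  have := hS.to_subtype
  let V : {G : List X | (G.map deg).sum ≤ N} × Fin (N + 1) → Submodule 𝕜 (A.FreeExt deg) :=
    fun G => (A.gr G.2).map ((LinearMap.mulLeft 𝕜 (G.1.1.map (A.gen deg)).prod).comp
      (A.incl deg).toLinearMap)
  have hV : ∀ G, Module.Finite 𝕜 (V G) := fun G => inferInstance
  have hle : A.freeGr deg N ≤ ⨆ G, V G := by
    refine (A.freeGr_le_span deg N).trans (Submodule.span_le.2 ?_)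
    rintro _ ⟨G, j, a, ha, hw, rfl⟩
    exact Submodule.mem_iSup_of_mem (⟨⟨G, by rw [Set.mem_ofPred_eq]; omega⟩, ⟨j, by omega⟩⟩ :
      {G : List X | (G.map deg).sum ≤ N} × Fin (N + 1)) ⟨a, ha, rfl⟩
  exact Submodule.finiteDimensional_of_le hle

end Transport

end CDGA

/-! ### The retraction `Â → A`, and the standing hypotheses for `Â`. -/

namespace CDGA

section Reduced

variable {𝕜 : Type u} [Field 𝕜] {A : CDGA.{u, v} 𝕜} {n : ℕ} {ε : A.carrier →ₗ[𝕜] 𝕜} {k : ℕ}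

namespace ObstructionChoice

variable (C : ObstructionChoice A n ε k) (hA : A.IsReduced n ε) (hk : n + 2 ≤ 2 * k)

/-- The values on generators of the retraction `Â → A`. -/
noncomputable def retractGen : C.Gens → A.carrier
  | .c i => C.γ i
  | _ => 0

/-- The retraction `Â → A` with `cᵢ ↦ γᵢ` that sends the other generators to zero. -/
noncomputable def retract (hε : A.IsOrientation n ε) : A.FreeExt C.genDeg →ₐ[𝕜] A.carrier :=
  A.liftGen C.genDeg (AlgHom.id 𝕜 A.carrier) C.retractGen
    (by
      rintro i a (i' | i' | ⟨_, i', j⟩ | ⟨_, i', j⟩) ha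
      · exact A.mul_comm_of_mem ha (C.γ_mem hε i')
      all_goals simp [retractGen])
    (by
      rintro (i | i | ⟨_, i, j⟩ | ⟨_, i, j⟩) (i' | i' | ⟨_, i', j'⟩ | ⟨_, i', j'⟩)
      · exact A.mul_comm_of_mem (C.γ_mem hε i) (C.γ_mem hε i')
      all_goals simp [retractGen])
    (by
      rintro (i | i | ⟨_, i, j⟩ | ⟨_, i, j⟩) hi
      · exact A.mul_self_of_odd hi (C.γ_mem hε i)
      all_goals simp [retractGen])

theorem retract_incl (hε : A.IsOrientation n ε) (a : A.carrier) : C.retract hε (A.incl C.genDeg a) = a :=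
  A.liftGen_incl _ _ _ _ _ _ a

theorem retract_gen (hε : A.IsOrientation n ε) (x : C.Gens) : C.retract hε (A.gen C.genDeg x) = C.retractGen x :=
  A.liftGen_gen _ _ _ _ _ _ _

theorem retract_dv (hε : A.IsOrientation n ε) (hP : NeedsUV 𝕜 k) (i : Fin C.l) (j : ℕ) :
    C.retract hε (C.dv hP i j) = 0 := by
  induction j with
  | zero =>
    refine (map_mul (C.retract hε) _ _).trans ?_
    refine (congrArg (· * _) ((map_sub (C.retract hε) _ _).trans ?_)).trans (zero_mul _)
    rw [retract_gen, retract_incl]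
    exact sub_self _
  | succ j ih =>
    refine (map_mul (C.retract hε) _ _).trans ?_
    rw [ih, mul_zero]

/-- It suffices to look at generators: `d w` and each `d v` have the factor `cᵢ - γᵢ ↦ 0`, each `d
u` is a `p`-th power of a generator sent to zero, and `d γᵢ = αᵢ`. -/
theorem d_retract (hε : A.IsOrientation n ε) (hk : 3 ≤ k) (y : A.FreeExt C.genDeg) :
    A.d (C.retract hε y) = C.retract hε (C.extD hε hk y) := by
  refine A.hom_commutes_d (C.dGen_mem hε hk) (C.retract hε)
    (fun i a ha => ?_) (fun x => ?_) (fun a => ?_) (fun x => ?_) y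
  · rwa [retract_incl]
  · rw [retract_gen]
    cases x with
    | c i => exact C.γ_mem hε i
    | _ => exact zero_mem _
  · rw [retract_incl, retract_incl]
  · have hpow : ∀ (hP : NeedsUV 𝕜 k) (x : C.Gens), C.retractGen x = 0 →
        C.retract hε (A.gen C.genDeg x ^ ringChar 𝕜) = 0 := by
      intro hP x hx
      refine (map_pow (C.retract hε) _ _).trans ?_
      rw [retract_gen, hx, zero_pow hP.1]
    rw [retract_gen]
    match x with
    | .c i => rw [dGen, retract_incl, retractGen, C.d_γ]
    | .w i =>
      refine (map_zero _).trans (Eq.symm ((map_sub (C.retract hε) _ _).trans ?_))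
      rw [retract_gen, retract_incl]
      exact sub_self _
    | .u hP i 0 => exact (map_zero _).trans (hpow hP _ rfl).symm
    | .u hP i (j + 1) => exact (map_zero _).trans (hpow hP _ rfl).symm
    | .v hP i j => exact (map_zero _).trans (C.retract_dv hε hP i j).symm

/-- Injectivity in cohomology comes from the retraction, surjectivity from `exists_eq_incl_add_d`.
-/
theorem isPoincareDuality_extension : IsPoincareDuality (C.extension hA hk).cohomologyGr n := by
  refine IsPoincareDuality.of_quasiIso (C.emb hA hk) (C.d_emb hA hk)
    (fun i a ha => C.emb_mem hA hk ha) (fun a ha y hy => ⟨C.retract hA.orientation y, ?_⟩) (fun b hb => ?_)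
    hA.poincare
  · refine (C.d_retract hA.orientation (hA.three_le hk) y).trans ?_
    exact (congrArg (C.retract hA.orientation) hy).trans (C.retract_incl hA.orientation a)
  · obtain ⟨a, g, h⟩ := C.exists_eq_incl_add_d (C.dGen_mem hA.orientation (hA.three_le hk))
      (C.extD_dGen hA.orientation (hA.three_le hk)) (C.γ_mem hA.orientation) (hA.three_le hk) hb
    obtain ⟨g', h'⟩ : ∃ g', b = C.emb hA hk a + (C.extension hA hk).d g' := ⟨g, h⟩
    refine ⟨a, g', C.emb_injective hA hk ?_, h'⟩
    rw [h', map_add, d_d, add_zero, d_emb] at hb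
    rw [hb, map_zero]

/-- In low degrees, there is nothing new in `Â`. -/
theorem gr_extension_of_lt {N : ℕ} (hN : N < k - 2) (hn : N ≤ n) :
    (C.extension hA hk).gr N = (A.gr N).map (C.emb hA hk).toLinearMap := by
  have h3 := hA.three_le hk
  refine le_antisymm ((C.gr_le_span_lowMonomial hA hk hn).trans (Submodule.span_le.2 ?_)) ?_
  · intro x hx
    cases hx with
    | emb ha => exact ⟨_, ha, rfl⟩
    | _ => omega
  · rintro _ ⟨a, ha, rfl⟩
    exact C.emb_mem hA hk ha

-- Although there are infinitely many `u` and `v`, their degrees grow with `j`, since `p^(j+1) ≥ j +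
-- 2`. This keeps `Â` of finite type.
include hA hk in
theorem finite_genDeg_le (N : ℕ) : {x : C.Gens | C.genDeg x ≤ N}.Finite := by
  have h3 := hA.three_le hk
  have hpow : ∀ (hP : NeedsUV 𝕜 k) (j : ℕ), j + 2 ≤ ringChar 𝕜 ^ (j + 1) := fun hP j => by
    have hp : (ringChar 𝕜).Prime :=
      (CharP.char_is_prime_or_zero 𝕜 (ringChar 𝕜)).resolve_right hP.1
    exact Nat.lt_pow_self hp.one_lt
  have hle : ∀ (hP : NeedsUV 𝕜 k) (j : ℕ), j + 2 ≤ ringChar 𝕜 ^ (j + 1) * (k - 2) := fun hP j =>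
    (hpow hP j).trans (Nat.le_mul_of_pos_right _ (by omega))
  refine (((Set.finite_range fun i : Fin C.l => (.c i : C.Gens)).union
    (Set.finite_range fun i : Fin C.l => (.w i : C.Gens))).union
    ((Set.finite_range fun x : PLift (NeedsUV 𝕜 k) × Fin C.l × Fin (N + 1) =>
      (.u x.1.1 x.2.1 x.2.2 : C.Gens)).union
    (Set.finite_range fun x : PLift (NeedsUV 𝕜 k) × Fin C.l × Fin (N + 1) =>
      (.v x.1.1 x.2.1 x.2.2 : C.Gens)))).subset ?_
  rintro (i | i | ⟨hP, i, j⟩ | ⟨hP, i, j⟩) hx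
  · exact Or.inl (Or.inl ⟨i, rfl⟩)
  · exact Or.inl (Or.inr ⟨i, rfl⟩)
  · have h1 := hle hP j
    have h2 : ringChar 𝕜 ^ (j + 1) * (k - 2) - 1 ≤ N := hx
    exact Or.inr (Or.inl ⟨(⟨hP⟩, i, ⟨j, by omega⟩), rfl⟩)
  · have h1 := hle hP j
    have h2 : ringChar 𝕜 ^ (j + 1) * (k - 2) ≤ N := hx
    exact Or.inr (Or.inr ⟨(⟨hP⟩, i, ⟨j, by omega⟩), rfl⟩)

end ObstructionChoice

/-- As `k ≥ 5`, the generators have degree at least `3`, and the conditions in degrees `0`, `1`, `2`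
are inherited from `A`. -/
theorem ExtensionChoice.IsExtendedOrientation.isReduced {C : ExtensionChoice A n ε k}
    {hA : A.IsReduced n ε} {hk : n + 2 ≤ 2 * k} {e : (C.extension hA hk).carrier →ₗ[𝕜] 𝕜}
    (he : C.IsExtendedOrientation hA hk e) : (C.extension hA hk).IsReduced n e where
  finite_type := finite_freeGr hA.finite_type (fun x => by
    have := C.le_genDeg hA hk x
    have := hA.seven_le
    omega) (C.finite_genDeg_le hA hk)
  one_ne_zero h := hA.one_ne_zero (C.emb_injective hA hk (by rw [map_one, map_zero, h]))
  gr_zero := by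
    have := hA.seven_le
    rw [C.gr_extension_of_lt hA hk (by omega) (by omega), hA.gr_zero, Submodule.map_span,
      Set.image_singleton]
    exact congrArg (fun x => Submodule.span 𝕜 {x}) (map_one (C.emb hA hk))
  gr_one := by
    have := hA.seven_le
    rw [C.gr_extension_of_lt hA hk (by omega) (by omega), hA.gr_one, Submodule.map_bot]
  gr_two := by
    have := hA.seven_le
    rw [C.gr_extension_of_lt hA hk (by omega) (by omega)]
    rintro _ ⟨a, ha, rfl⟩
    exact (C.d_emb hA hk a).trans (by rw [hA.gr_two a ha, map_zero])
  poincare := C.isPoincareDuality_extension hA hk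
  seven_le := hA.seven_le
  orientation :=
    { eq_zero_of_ne := he.eq_zero_of_ne
      map_d := he.apply_d
      exists_cocycle := by
        obtain ⟨μ, hμ, hdμ, h1⟩ := hA.orientation.exists_cocycle
        exact ⟨C.emb hA hk μ, C.emb_mem hA hk hμ, by rw [C.d_emb, hdμ, map_zero],
          (he.apply_emb μ).trans h1⟩ }

end Reduced

end CDGA

/-! ### Half-acyclicity of the orphans of `Â`. -/

namespace CDGA

section HalfAcyclic

variable {𝕜 : Type u} [Field 𝕜] {A : CDGA.{u, v} 𝕜} {n : ℕ} {ε : A.carrier →ₗ[𝕜] 𝕜} {k : ℕ}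

namespace ObstructionChoice

variable (C : ObstructionChoice A n ε k) (hA : A.IsReduced n ε) (hk : n + 2 ≤ 2 * k)

/-- The elements `a + ∑ wᵢ bᵢ + ∑ rᵢ cᵢ` with `a` of degree `N`, cocycles `bᵢ` that are scalars
unless `N = k`, and scalars `rᵢ` that vanish unless `N = k - 1`. -/
noncomputable def linearPart (N : ℕ) : Submodule 𝕜 (C.extension hA hk).carrier where
  carrier := {x | ∃ a ∈ A.gr N, ∃ (b : Fin C.l → A.carrier) (r : Fin C.l → 𝕜),
      (∀ i, A.d (b i) = 0) ∧ (N ≠ k → ∀ i, ∃ s : 𝕜, b i = s • (1 : A.carrier)) ∧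
      (N + 1 ≠ k → ∀ i, r i = 0) ∧
      x = C.emb hA hk a + ∑ i, C.w hA hk i * C.emb hA hk (b i) + ∑ i, r i • C.c hA hk i}
  zero_mem' := ⟨0, zero_mem _, fun _ => 0, fun _ => 0, fun _ => map_zero _,
    fun _ _ => ⟨0, (zero_smul _ _).symm⟩, fun _ _ => rfl, by simp⟩
  add_mem' := by
    rintro _ _ ⟨a, ha, b, r, h1, h2, h3, rfl⟩ ⟨a', ha', b', r', h1', h2', h3', rfl⟩
    refine ⟨a + a', add_mem ha ha', fun i => b i + b' i, fun i => r i + r' i,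
      fun i => by rw [map_add, h1, h1', add_zero], fun hN i => ?_,
      fun hN i => by simp only [h3 hN, h3' hN, add_zero], ?_⟩
    · obtain ⟨s, hs⟩ := h2 hN i
      obtain ⟨s', hs'⟩ := h2' hN i
      exact ⟨s + s', by simp only [hs, hs', add_smul]⟩
    · simp only [map_add, mul_add, add_smul, Finset.sum_add_distrib]
      abel
  smul_mem' := by
    rintro s _ ⟨a, ha, b, r, h1, h2, h3, rfl⟩
    refine ⟨s • a, Submodule.smul_mem _ _ ha, fun i => s • b i, fun i => s * r i,
      fun i => by rw [map_smul, h1, smul_zero], fun hN i => ?_,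
      fun hN i => by simp only [h3 hN, mul_zero], ?_⟩
    · obtain ⟨t, ht⟩ := h2 hN i
      exact ⟨s * t, by simp only [ht, smul_smul]⟩
    · simp only [map_smul, mul_smul_comm, smul_add, Finset.smul_sum, smul_smul]

theorem emb_mem_linearPart {N : ℕ} {a : A.carrier} (ha : a ∈ A.gr N) :
    C.emb hA hk a ∈ C.linearPart hA hk N :=
  ⟨a, ha, fun _ => 0, fun _ => 0, fun _ => map_zero _, fun _ _ => ⟨0, (zero_smul _ _).symm⟩,
    fun _ _ => rfl, by simp⟩

theorem w_mul_mem_linearPart {N : ℕ} (i : Fin C.l) {a : A.carrier} (ha : A.d a = 0)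
    (ha' : N ≠ k → ∃ s : 𝕜, a = s • (1 : A.carrier)) :
    C.w hA hk i * C.emb hA hk a ∈ C.linearPart hA hk N := by
  refine ⟨0, zero_mem _, Pi.single i a, fun _ => 0, fun j => ?_, fun hN j => ?_, fun _ _ => rfl, ?_⟩
  · by_cases hj : j = i
    · subst hj
      rw [Pi.single_eq_same, ha]
    · rw [Pi.single_eq_of_ne hj, map_zero]
  · by_cases hj : j = i
    · subst hj
      rw [Pi.single_eq_same]
      exact ha' hN
    · rw [Pi.single_eq_of_ne hj]
      exact ⟨0, (zero_smul _ _).symm⟩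
  · rw [Finset.sum_eq_single i]
    · simp
    · intro j _ hj
      rw [Pi.single_eq_of_ne hj, map_zero, mul_zero]
    · intro h
      exact absurd (Finset.mem_univ i) h

theorem c_mem_linearPart {N : ℕ} (hN : N + 1 = k) (i : Fin C.l) :
    C.c hA hk i ∈ C.linearPart hA hk N := by
  refine ⟨0, zero_mem _, fun _ => 0, Pi.single i 1, fun _ => map_zero _,
    fun _ _ => ⟨0, (zero_smul _ _).symm⟩, fun h => absurd hN h, ?_⟩
  rw [Finset.sum_eq_single (s := Finset.univ) (f := fun j => (Pi.single i 1 : Fin C.l → 𝕜) j •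
    C.c hA hk j) i]
  · simp
  · intro j _ hj
    rw [Pi.single_eq_of_ne hj, zero_smul]
  · intro h
    exact absurd (Finset.mem_univ i) h

/-- The elements of degree at most `k` are linear in the generators `cᵢ` and `wᵢ`. -/
theorem gr_le_linearPart {N : ℕ} (hN : N ≤ k) :
    (C.extension hA hk).gr N ≤ C.linearPart hA hk N := by
  have h7 := hA.seven_le
  refine (A.freeGr_le_span C.genDeg N).trans (Submodule.span_le.2 ?_)
  rintro _ ⟨G, j, a, ha, hw, rfl⟩
  rcases G with _ | ⟨x, _ | ⟨y, G⟩⟩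
  · rw [List.map_nil, List.prod_nil, one_mul]
    rw [List.map_nil, List.sum_nil, zero_add] at hw
    subst hw
    exact C.emb_mem_linearPart hA hk ha
  · simp only [List.map_cons, List.map_nil, List.sum_cons, List.sum_nil, add_zero] at hw
    simp only [List.map_cons, List.map_nil, List.prod_cons, List.prod_nil, mul_one]
    have hbig : ∀ (hP : NeedsUV 𝕜 k) (i : Fin C.l) (t : ℕ),
        k < C.genDeg (.u hP i t) ∧ k < C.genDeg (.v hP i t) := by
      intro hP i t
      have h6 := six_le_of_needsUV hA hk hP
      have h1 := Nat.mul_le_mul_right (k - 2) (two_le_pow_ringChar hP t)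
      simp only [ExtGen.deg]
      omega
    cases x with
    | c i =>
      simp only [ExtGen.deg] at hw
      have hj : j ≤ 1 := by omega
      interval_cases j
      · obtain ⟨r, rfl⟩ := hA.exists_smul_one ha
        have h1 := Submodule.smul_mem _ r (C.c_mem_linearPart hA hk (N := N) (by omega) i)
        rw [map_smul, map_one, mul_smul_comm, mul_one]
        exact h1
      · rw [hA.eq_zero_of_mem_gr_one ha, map_zero, mul_zero]
        exact zero_mem (C.linearPart hA hk N)
    | w i =>
      simp only [ExtGen.deg] at hw
      -- The coefficient of `wᵢ` has degree at most `2`; it is closed because `A¹ = 0` and `A² ⊆ ker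
      -- d`.
      refine C.w_mul_mem_linearPart hA hk i (hA.d_eq_zero_of_le_two (by omega : j ≤ 2) ha) ?_
      intro hNk
      have hj : j ≤ 1 := by omega
      interval_cases j
      · exact hA.exists_smul_one ha
      · exact ⟨0, by rw [hA.eq_zero_of_mem_gr_one ha, zero_smul]⟩
    | u hP i t => have := (hbig hP i t).1; omega
    | v hP i t => have := (hbig hP i t).2; omega
  -- Two generators have degree at least `2 (k - 2)`, which exceeds `k` because `k ≥ 5`.
  · have hx := C.le_genDeg hA hk x
    have hy := C.le_genDeg hA hk y
    simp only [List.map_cons, List.sum_cons] at hw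
    omega

/-- The cocycles of degree at most `k` have the form `a + ∑ rᵢ cᵢ`. -/
theorem exists_of_cocycle {N : ℕ} (hN : N ≤ k) {x : (C.extension hA hk).carrier}
    (hx : x ∈ (C.extension hA hk).gr N) (hdx : (C.extension hA hk).d x = 0) :
    ∃ a ∈ A.gr N, ∃ r : Fin C.l → 𝕜, (N + 1 ≠ k → ∀ i, r i = 0) ∧
      A.d a + ∑ i, r i • C.α i = 0 ∧ x = C.emb hA hk a + ∑ i, r i • C.c hA hk i := by
  obtain ⟨a, ha, b, r, hb, -, hr, rfl⟩ := C.gr_le_linearPart hA hk hN hx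
  have hw : ∀ i, (C.extension hA hk).d (C.w hA hk i * C.emb hA hk (b i)) =
      C.c hA hk i * C.emb hA hk (b i) - C.emb hA hk (C.γ i * b i) := by
    intro i
    rw [(C.extension hA hk).d_mul_cocycle _ (by rw [C.d_emb, hb, map_zero]), C.d_w, sub_mul,
      map_mul]
  have hdx' : C.emb hA hk (A.d a) + ∑ i, (C.c hA hk i * C.emb hA hk (b i) -
      C.emb hA hk (C.γ i * b i)) + ∑ i, r i • C.emb hA hk (C.α i) = 0 := by
    rw [← hdx, map_add, map_add, map_sum, map_sum, C.d_emb]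
    congr 1
    · congr 1
      exact Finset.sum_congr rfl fun i _ => (hw i).symm
    · exact Finset.sum_congr rfl fun i _ => by rw [map_smul, C.d_c]
  -- The coefficient of `cᵢ` in `dx` is `bᵢ`.
  have hb0 : ∀ i, b i = 0 := by
    intro i
    have h := congrArg (C.coeffGen hA hk (.c i)) hdx'
    rw [map_add, map_add, map_sum, map_sum, C.coeffGen_emb, zero_add, map_zero,
      Finset.sum_eq_zero (s := Finset.univ) (f := fun j => C.coeffGen hA hk (.c i)
        (r j • C.emb hA hk (C.α j))) (fun j _ => by rw [map_smul, C.coeffGen_emb, smul_zero]),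
      add_zero, Finset.sum_eq_single i] at h
    · rwa [map_sub, C.coeffGen_emb, sub_zero,
        C.coeffGen_mul hA hk _ (C.c_mem hA hk i) (C.augExt_c hA hk i), C.coeffGen_c_c,
        C.augExt_emb, one_mul] at h
    · intro j _ hj
      rw [map_sub, C.coeffGen_emb, sub_zero,
        C.coeffGen_mul hA hk _ (C.c_mem hA hk j) (C.augExt_c hA hk j), C.coeffGen_c, zero_mul]
      intro h
      cases h
      exact hj rfl
    · intro h
      exact absurd (Finset.mem_univ i) h
  refine ⟨a, ha, r, hr, C.emb_injective hA hk ?_, ?_⟩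
  · simp only [hb0, map_zero, mul_zero, sub_self, Finset.sum_const_zero, add_zero] at hdx'
    rw [map_add, map_sum, map_zero, ← hdx']
    congr 1
    exact Finset.sum_congr rfl fun i _ => map_smul _ _ _
  · simp [hb0]

end ObstructionChoice

namespace ExtensionChoice

variable {C : ExtensionChoice A n ε k} {hA : A.IsReduced n ε} {hk : n + 2 ≤ 2 * k}

/-- The differentials of orphans are differentials of elements of `Z`. -/
theorem exists_mem_Z_d_eq (C : ExtensionChoice A n ε k) {i : ℕ} {o : A.carrier} (ho : o ∈ A.gr i)
    (ho' : o ∈ A.orphans ε) : ∃ z ∈ C.Z, z ∈ A.gr i ∧ A.d z = A.d o := by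
  rw [← C.sup_Z] at ho'
  obtain ⟨z, hz, _, ⟨_, ξ, rfl⟩, rfl⟩ := Submodule.mem_sup.1 ho'
  refine ⟨GradedRing.proj A.gr i z, C.graded_Z z hz i, A.proj_mem i z, ?_⟩
  have h := A.proj_of_mem (A.d_mem ho)
  rw [A.proj_d] at h
  rw [← A.proj_d, map_add, A.d_d, add_zero, A.proj_d]
  rw [← A.proj_d, map_add, A.d_d, add_zero, A.proj_d] at h
  exact h ▸ rfl

namespace IsExtendedOrientation

variable {e : (C.extension hA hk).carrier →ₗ[𝕜] 𝕜} (he : C.IsExtendedOrientation hA hk e)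
include he

/-- The complementary degree is at most `n/2 < k`, so a test element is linear in the `wᵢ` and `cᵢ`
with scalar coefficients. The products `wᵢ z` give zero because `Z ⊆ T`; this is why `Z` takes the
place of all orphans. -/
theorem emb_mem_orphans {z : A.carrier} (hz : z ∈ C.Z) {i : ℕ} (hzi : z ∈ A.gr i)
    (hi : n ≤ 2 * i) : C.emb hA hk z ∈ (C.extension hA hk).orphans e := by
  refine mem_orphans_of_homogeneous he.eq_zero_of_ne (C.emb_mem hA hk hzi) fun j hij y hy => ?_
  obtain ⟨a, ha, b, r, -, hb, -, rfl⟩ := C.gr_le_linearPart hA hk (N := j) (by omega) hy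
  have h1 : ∀ i, e (C.emb hA hk z * (C.w hA hk i * C.emb hA hk (b i))) = 0 := by
    intro i'
    obtain ⟨s, hs⟩ := hb (by omega) i'
    rw [hs, map_smul, map_one, mul_smul_comm, mul_one, mul_smul_comm, map_smul,
      apply_comm_eq_zero (C.w_mem hA hk i') (C.emb_mem hA hk hzi) (he.w_t i' z (C.Z_le_T hz)),
      smul_zero]
  have h2 : ∀ i, e (C.emb hA hk z * (r i • C.c hA hk i)) = 0 := by
    intro i'
    rw [mul_smul_comm, map_smul, apply_comm_eq_zero (C.c_mem hA hk i') (C.emb_mem hA hk hzi)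
      (he.apply_c i' z), smul_zero]
  rw [mul_add, mul_add, map_add, map_add, ← map_mul, he.apply_emb, C.Z_le_orphans hz a,
    Finset.mul_sum, Finset.mul_sum, map_sum, map_sum, Finset.sum_eq_zero fun i _ => h1 i,
    Finset.sum_eq_zero fun i _ => h2 i, add_zero, add_zero]

/-- A test element has degree `n - k + 1 ≤ k - 1`, and among its terms only the `cⱼ` can pair
nontrivially with `cᵢ`; the hypothesis `hr` is orthogonality to these. -/
theorem sum_c_mem_orphans (r : Fin C.l → 𝕜) (hr : ∀ j, ∑ i, r i * ε (C.γ i * C.γ j) = 0) :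
    ∑ i, r i • C.c hA hk i ∈ (C.extension hA hk).orphans e := by
  have h7 := hA.seven_le
  refine mem_orphans_of_homogeneous he.eq_zero_of_ne (i := k - 1)
    (sum_mem fun i _ => Submodule.smul_mem _ _ (C.c_mem hA hk i)) fun j hij y hy => ?_
  obtain ⟨a, ha, b, s, -, -, -, rfl⟩ := C.gr_le_linearPart hA hk (N := j) (by omega) hy
  have h1 : ∀ i, e (C.c hA hk i * C.emb hA hk a) = 0 := fun i => he.apply_c i a
  have h2 : ∀ i, e (C.c hA hk i * ∑ i', C.w hA hk i' * C.emb hA hk (b i')) = 0 := by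
    intro i
    rw [Finset.mul_sum, map_sum]
    exact Finset.sum_eq_zero fun i' _ => by rw [← mul_assoc, he.apply_c_w]
  have h3 : ∑ i, r i * e (C.c hA hk i * ∑ i', s i' • C.c hA hk i') = 0 := by
    simp only [Finset.mul_sum, map_sum, mul_smul_comm, map_smul, he.c_c, smul_eq_mul]
    rw [Finset.sum_comm]
    refine Finset.sum_eq_zero fun i' _ => ?_
    have h4 : ∑ i, r i * (s i' * -ε (C.γ i * C.γ i')) =
        -s i' * ∑ i, r i * ε (C.γ i * C.γ i') := by
      rw [Finset.mul_sum]
      exact Finset.sum_congr rfl fun i _ => by ring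
    rw [h4, hr, mul_zero]
  rw [Finset.sum_mul, map_sum, ← h3]
  refine Finset.sum_congr rfl fun i _ => ?_
  rw [smul_mul_assoc, map_smul, mul_add, mul_add, map_add, map_add, h1, h2, zero_add, zero_add,
    smul_eq_mul]

/-- An orphan of degree at most `k` that is a cocycle comes from an orphan of `A`. -/
theorem exists_of_orphan_cocycle {N : ℕ} (hN : N ≤ k) {x : (C.extension hA hk).carrier}
    (hx : x ∈ (C.extension hA hk).gr N) (hdx : (C.extension hA hk).d x = 0)
    (hxo : x ∈ (C.extension hA hk).orphans e) :
    ∃ a ∈ A.gr N, a ∈ A.orphans ε ∧ A.d a = 0 ∧ x = C.emb hA hk a := by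
  obtain ⟨a, ha, r, hr, hda, rfl⟩ := C.exists_of_cocycle hA hk hN hx hdx
  -- The `cᵢ` pair to zero with `A`, so testing against `A` only sees `a`.
  have hao : a ∈ A.orphans ε := by
    intro b
    have h := hxo (C.emb hA hk b)
    rw [add_mul, Finset.sum_mul, map_add, map_sum, ← map_mul, he.apply_emb,
      Finset.sum_eq_zero fun i _ => by rw [smul_mul_assoc, map_smul, he.apply_c, smul_zero],
      add_zero] at h
    exact h
  -- In degree `k - 1`, `da + ∑ rᵢ αᵢ = 0` with `a` an orphan contradicts the choice of the `αᵢ`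
  -- unless all `rᵢ` vanish.
  have hr0 : ∀ i, r i = 0 := by
    by_cases h : N + 1 = k
    · exact C.eq_zero_of_sum_α r hao (by rwa [show k - 1 = N by omega]) hda
    · exact hr h
  simp only [hr0, zero_smul, Finset.sum_const_zero, add_zero] at hda ⊢
  exact ⟨a, ha, hao, hda, rfl⟩

theorem isHalfAcyclic (hac : A.IsHalfAcyclic n ε (k - 1)) :
    (C.extension hA hk).IsHalfAcyclic n e k := by
  intro N hN hNk x hx hxo hdx
  obtain ⟨a, ha, hao, hda, rfl⟩ := he.exists_of_orphan_cocycle hNk hx hdx hxo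
  by_cases h : N = k
  · subst h
    have hmem : a ∈ A.orphans ε ⊓ A.gr N ⊓ LinearMap.ker A.d := ⟨⟨hao, ha⟩, hda⟩
    rw [← C.sup_α] at hmem
    obtain ⟨_, ⟨o, ⟨ho, hog⟩, rfl⟩, y, hy, rfl⟩ := Submodule.mem_sup.1 hmem
    obtain ⟨r, rfl⟩ := (Submodule.mem_span_range_iff_exists_fun 𝕜).1 hy
    obtain ⟨z, hz, hzg, hzo⟩ := C.exists_mem_Z_d_eq hog ho
    have hd : A.d o + ∑ i, r i • C.α i = A.d (z + ∑ i, r i • C.γ i) := by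
      rw [map_add, hzo, map_sum]
      congr 1
      exact Finset.sum_congr rfl fun i _ => by rw [map_smul, C.d_γ]
    -- The orphan `a = d (z + ∑ rᵢ γᵢ)` pairs to zero with `wⱼ`, and the condition on `wⱼ dξ` turns
    -- this pairing into `± ε (γⱼ (z + ∑ rᵢ γᵢ))`, where `z` contributes nothing.
    have hγ : ∀ j, ∑ i, r i * ε (C.γ i * C.γ j) = 0 := by
      intro j
      have h1 := apply_comm_eq_zero (C.emb_mem hA hk ha) (C.w_mem hA hk j) (hxo (C.w hA hk j))
      rw [hd, he.apply_w_d] at h1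
      have h2 := (mul_eq_zero.1 h1).resolve_left (pow_ne_zero _ (neg_ne_zero.2 one_ne_zero))
      have h3 := apply_comm_eq_zero (e := ε) (C.γ_mem hA.orientation j) (add_mem hzg
        (sum_mem fun i _ => Submodule.smul_mem _ (r i) (C.γ_mem hA.orientation i))) h2
      rw [add_mul, map_add, C.Z_le_orphans hz, zero_add, Finset.sum_mul, map_sum] at h3
      rw [← h3]
      exact Finset.sum_congr rfl fun i _ => by rw [smul_mul_assoc, map_smul, smul_eq_mul]
    -- Replacing `γᵢ` by `cᵢ` keeps the differential and turns the primitive into an orphan.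
    refine ⟨C.emb hA hk z + ∑ i, r i • C.c hA hk i, add_mem (C.emb_mem hA hk hzg)
      (sum_mem fun i _ => Submodule.smul_mem _ _ (C.c_mem hA hk i)),
      add_mem (he.emb_mem_orphans hz hzg (by omega)) (he.sum_c_mem_orphans r hγ), ?_⟩
    rw [map_add, map_sum, C.d_emb, hzo, map_add, map_sum]
    congr 1
    exact Finset.sum_congr rfl fun i _ => by rw [map_smul, map_smul, C.d_c]
  -- Below degree `k` the orphan primitive in `A` is exchanged for one in `Z`, which stays an orphan
  -- in `Â`.
  · obtain ⟨o, hog, ho, rfl⟩ := hac N hN (by omega) a ha hao hda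
    obtain ⟨z, hz, hzg, hzo⟩ := C.exists_mem_Z_d_eq hog ho
    exact ⟨C.emb hA hk z, C.emb_mem hA hk hzg, he.emb_mem_orphans hz hzg (by omega),
      by rw [C.d_emb, hzo]⟩

end IsExtendedOrientation

end ExtensionChoice

end HalfAcyclic

end CDGA

theorem mainTheorem3 {𝕜 : Type u} [Field 𝕜] (A : CDGA.{u, v} 𝕜) (n : ℕ) (ε : A.carrier →ₗ[𝕜] 𝕜)
    (hA : A.IsReduced n ε) (k : ℕ) (hk : n + 2 ≤ 2 * k) :
    Nonempty (CDGA.ExtensionChoice A n ε k) ∧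
    ∀ C : CDGA.ExtensionChoice A n ε k,
      ∃ e : (C.extension hA hk).carrier →ₗ[𝕜] 𝕜,
        C.IsExtendedOrientation hA hk e ∧
        (∀ e', C.IsExtendedOrientation hA hk e' → e' = e) ∧
        (C.extension hA hk).IsReduced n e ∧
        (A.IsHalfAcyclic n ε (k - 1) → (C.extension hA hk).IsHalfAcyclic n e k) := by
  refine ⟨CDGA.nonempty_extensionChoice hA (hA.three_le hk), fun C => ?_⟩
  obtain ⟨e, he⟩ := C.exists_isExtendedOrientation hA hk
  exact ⟨e, he, fun _ he' => he.unique he', he.isReduced, he.isHalfAcyclic⟩
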